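/- **Theorem 4.3.** Let $\mathcal H_1$ be a finite-dimensional complex Hilbert space (inner products are linear in the second variable) and let $Z$ be a CAR field over $\mathcal H_1$ acting irreducibly on a nonzero finite-dimensional complex Hilbert space $\mathcal K$: $\psi\mapsto Z(\psi)\in\mathcal B(\mathcal K)$ is conjugate linear, $Z(\psi)Z^*(\phi)+Z^*(\phi)Z(\psi)=\langle\psi,\phi\rangle \mathbf 1$, $Z(\psi)Z(\phi)+Z(\phi)Z(\psi)=0$, $Z^*(\psi)Z^*(\phi)+Z^*(\phi)Z^*(\psi)=0$, and no subspace of $\mathcal K$ other than $0$ and $\mathcal K$ is invariant under all $Z(\psi)$ and $Z^*(\psi)$. *Definitions.* Let $\tau=\mathrm{Tr}/\dim$ be the normalized trace, $\mathcal N=\sum_jZ^*(\psi_j)Z(\psi_j)$ ($\{\psi_j\}$ an orthonormal basis of $\mathcal H_1$) the number operator, and $W=e^{i\pi\mathcal N}$ the parity operator. The Araki–Wyss algebra $\mathscr G$ is the commutant of $\mathcal N$ in $\mathcal B(\mathcal K)$. For an operator $0\le Q\le\mathbf 1$ on $\mathcal H_1$, the gauge invariant Gaussian (GIG) state with symbol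 $Q$ is the state $X\mapsto\tau(\rho_QX)$, with $\rho_Q\ge0$ and $\tau(\rho_Q)=1$, determined by $$\tau\big(\rho_Q\,Z^*(\psi_1)\cdots Z^*(\psi_m)Z(\phi_n)\cdots Z(\phi_1)\big)=\delta_{mn}\det\big(\langle\phi_j,Q\psi_k\rangle\big)_{j,k}.$$ $\mathfrak S_{GIG}$ denotes the set of the density matrices $\rho_Q$. A quantum operation is a completely positive, trace preserving linear map; a GIG quantum operation on $\mathcal B(\mathcal K)$ is one that commutes with all $X\mapsto e^{it\mathcal N}Xe^{-it\mathcal N}$, $t\in\mathbb R$, and maps $\mathfrak S_{GIG}$ into itself. A semigroup of quantum operations on $\mathscr G$ is a continuous family $\{\mathscr P_t\}_{t\ge0}$ of quantum operations on $\mathscr G$ with $\mathscr P_0=\mathbf 1$ and $\mathscr P_{s+t}=\mathscr P_s\mathscr P_t$. A pair $(S,R)$ of operators on $\mathcal H_1$ is compatible if $\|S\|\le1$ and $0\le R\le\mathbf 1-SS^*$. Its Evans–Hugenholtz–Kadison (EHK) operation $\Phi_{S,R}$ on $\mathcal B(\mathcal K)$ is defined as follows. Let $T$ be the unique operator with $0\le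 T\le\mathbf 1$, $\ker(\mathbf 1-SS^*)\subseteq\ker T$ and $R=(\mathbf 1-SS^*)^{1/2}T(\mathbf 1-SS^*)^{1/2}$. Put $\widetilde Z(\psi\oplus\eta)=Z(\psi)\otimes W+\mathbf 1\otimes Z(\eta)$, a CAR field over $\mathcal H_1\oplus\mathcal H_1$ on $\mathcal K\otimes\mathcal K$, and $$U_S=\begin{bmatrix}-(\mathbf 1-SS^*)^{1/2}&S\\S^*&(\mathbf 1-S^*S)^{1/2}\end{bmatrix},$$ and let $\mathcal U$ be a unitary on $\mathcal K\otimes\mathcal K$ (unique up to a phase) with $\mathcal U\widetilde Z(\chi)\mathcal U^*=\widetilde Z(U_S\chi)$ for all $\chi$. Let $\iota$ be the $*$-homomorphism $\mathcal B(\mathcal K)\to\mathcal B(\mathcal K\otimes\mathcal K)$ with $\iota(Z(\psi))=Z(\psi)\otimes W$, and $\mathbb E$ the tracial conditional expectation onto its range. Then $\Phi_{S,R}(\rho)=\iota^{-1}\big(\mathbb E\big(\mathcal U^*\,\iota(\rho_T)(\mathbf 1\otimes\rho)\,\mathcal U\big)\big)$. Finally, call $(G,A)$ a generating pair if $G$ and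 $A$ are operators on $\mathcal H_1$, $G$ generates a contraction semigroup (that is, $\|e^{tG}\|\le1$ for all $t\ge0$), and $0\le A\le-G-G^*$; put $R_t=\int_0^te^{sG}Ae^{sG^*}\,ds$. *Statement.* 1. For every semigroup $\{\mathscr P_t\}_{t\ge0}$ of quantum operations on $\mathscr G$ such that every $\mathscr P_t$ maps $\mathfrak S_{GIG}$ into itself, there is a generating pair $(G,A)$ with $\mathscr P_t=\Phi_{e^{tG},R_t}\big|_{\mathscr G}$ for all $t\ge0$. 2. Conversely, let $(G,A)$ be a generating pair. Then for every $t\ge0$ the pair $(e^{tG},R_t)$ is compatible and $\Phi_{e^{tG},R_t}$ is a GIG quantum operation on $\mathcal B(\mathcal K)$. The maps $\mathscr P_t=\Phi_{e^{tG},R_t}\big|_{\mathscr G}$ map $\mathscr G$ into itself and form a semigroup of quantum operations on $\mathscr G$ each of which maps $\mathfrak S_{GIG}$ into itself. 3. Two generating pairs $(G,A)$ and $(G',A')$ give the same semigroup on $\mathscr G$ if and only if $A=A'$ and $G'=G+ic\mathbf 1$ for some $c\in\mathbb R$. Hence $(G,A)\mapsto\{\Phi_{e^{tG},R_t}|_{\mathscr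 G}\}_{t\ge0}$ is a one-to-one correspondence between the generating pairs with $\operatorname{Im}\operatorname{Tr}G=0$ and the semigroups of quantum operations on $\mathscr G$ that map $\mathfrak S_{GIG}$ into itself. -/

import Mathlib

open scoped TensorProduct ComplexOrder InnerProductSpace NNReal

noncomputable section

namespace GIG

/-! ### Operators, normalized trace, complete positivity -/

section Operators

variable {K : Type*} [NormedAddCommGroup K] [InnerProductSpace ℂ K] [FiniteDimensional ℂ K]

/-- The normalized trace `τ(X) = Tr X / dim K` on the operators on `K`, as a linear functional. -/
def tau : Module.End ℂ K →ₗ[ℂ] ℂ :=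
  ((Module.finrank ℂ K : ℂ)⁻¹) • LinearMap.trace ℂ K

/-- An `n × n` matrix of operators on `K` is positive as an operator on `K ⊕ ⋯ ⊕ K`. -/
def IsBlockPositive {n : ℕ} (a : Fin n → Fin n → Module.End ℂ K) : Prop :=
  ∀ v : Fin n → K, 0 ≤ ∑ i, ∑ j, ⟪v i, a i j (v j)⟫_ℂ

/-- A quantum operation, that is a completely positive trace preserving linear map, on a space
`X` of operators on `K`; `ι : X → B(K)` is the inclusion (the identity when `X = B(K)`). -/
structure IsQuantumOperation {X : Type*} [AddCommGroup X] [Module ℂ X]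
    (ι : X →ₗ[ℂ] Module.End ℂ K) (P : X →ₗ[ℂ] X) : Prop where
  completelyPositive : ∀ (n : ℕ) (a : Fin n → Fin n → X),
    IsBlockPositive (fun i j => ι (a i j)) → IsBlockPositive (fun i j => ι (P (a i j)))
  tracePreserving : ∀ x : X, tau (ι (P x)) = tau (ι x)

end Operators

section TracialAdjoint

variable {K L : Type*}
  [NormedAddCommGroup K] [InnerProductSpace ℂ K] [FiniteDimensional ℂ K]
  [NormedAddCommGroup L] [InnerProductSpace ℂ L]

/-- The adjoint `f†` of a linear map `f : B(K) → B(L)` with respect to the normalized traces: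
`τ(f†(Y) X) = τ(Y f(X))` (see `tau_tracialAdjoint_mul`). If `f` is an injective unital
`*`-homomorphism, then `f(f†(Y))` is the unique element `E` of the range of `f` with
`τ(E C) = τ(Y C)` for all `C` in the range of `f`. In other words, `f†` is then the tracial
conditional expectation onto the range of `f`, followed by the identification of the range
with `B(K)` through `f`. -/
def tracialAdjoint (f : Module.End ℂ K →ₗ[ℂ] Module.End ℂ L) :
    Module.End ℂ L →ₗ[ℂ] Module.End ℂ K where
  toFun Y := Matrix.toLin (Module.finBasis ℂ K) (Module.finBasis ℂ K)
    (Matrix.of fun i j => (Module.finrank ℂ K : ℂ) *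
      tau (Y * f (Matrix.toLin (Module.finBasis ℂ K) (Module.finBasis ℂ K)
        (Matrix.single j i 1))))
  map_add' Y₁ Y₂ := by
    rw [← map_add]
    congr 1
    ext i j
    simp [add_mul, mul_add]
  map_smul' c Y := by
    rw [RingHom.id_apply, ← map_smul]
    congr 1
    ext i j
    simp only [Matrix.of_apply, Matrix.smul_apply, smul_mul_assoc, map_smul, smul_eq_mul]
    ring

theorem tau_tracialAdjoint_mul [Nontrivial K]
    (f : Module.End ℂ K →ₗ[ℂ] Module.End ℂ L) (Y : Module.End ℂ L) (X : Module.End ℂ K) :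
    tau (tracialAdjoint f Y * X) = tau (Y * f X) := by
  set b := Module.finBasis ℂ K with hb
  have hd : (Module.finrank ℂ K : ℂ) ≠ 0 := by
    exact_mod_cast (Module.finrank_pos (R := ℂ) (M := K)).ne'
  have key : ∀ M : Matrix (Fin (Module.finrank ℂ K)) (Fin (Module.finrank ℂ K)) ℂ,
      tau (tracialAdjoint f Y * Matrix.toLin b b M) = tau (Y * f (Matrix.toLin b b M)) := by
    intro M
    induction M using Matrix.induction_on' with
    | h_zero => simp
    | h_add p q hp hq => simp only [map_add, mul_add, hp, hq]
    | h_std_basis i j x =>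
      have hx : (Matrix.single i j x : Matrix (Fin (Module.finrank ℂ K)) _ ℂ)
          = x • Matrix.single i j 1 := by simp [Matrix.smul_single]
      rw [hx]
      simp only [map_smul, mul_smul_comm]
      congr 1
      change (Module.finrank ℂ K : ℂ)⁻¹ • LinearMap.trace ℂ K
        (Matrix.toLin b b _ * Matrix.toLin b b (Matrix.single i j 1)) = _
      rw [Module.End.mul_eq_comp, ← Matrix.toLin_mul, Matrix.trace_toLin_eq,
        Matrix.trace_mul_single]
      simp only [Matrix.of_apply, smul_eq_mul, MulOpposite.op_one, one_smul]
      rw [← mul_assoc, inv_mul_cancel₀ hd, one_mul]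
  simpa using key (LinearMap.toMatrix b b X)

end TracialAdjoint

/-! ### CAR fields -/

section CAR

variable {V K : Type*} [NormedAddCommGroup V] [InnerProductSpace ℂ V]
  [NormedAddCommGroup K] [InnerProductSpace ℂ K] [FiniteDimensional ℂ K]

/-- The conjugate linear map `Z` is a field of canonical anticommutation relations over `V`
acting on `K`; `star` is the Hilbert space adjoint. -/
structure IsCARField (Z : V →ₗ⋆[ℂ] Module.End ℂ K) : Prop where
  anticomm_star : ∀ ψ φ : V, Z ψ * star (Z φ) + star (Z φ) * Z ψ = ⟪ψ, φ⟫_ℂ • 1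
  anticomm : ∀ ψ φ : V, Z ψ * Z φ + Z φ * Z ψ = 0
  star_anticomm : ∀ ψ φ : V, star (Z ψ) * star (Z φ) + star (Z φ) * star (Z ψ) = 0

/-- `Z` acts irreducibly: `K ≠ 0`, and no subspace other than `0` and `K` is invariant under all
the operators `Z ψ` and their adjoints. -/
structure IsIrreducibleField (Z : V →ₗ⋆[ℂ] Module.End ℂ K) : Prop where
  nontrivial : Nontrivial K
  eq_bot_or_eq_top : ∀ p : Submodule ℂ K,
    (∀ ψ : V, ∀ x ∈ p, Z ψ x ∈ p ∧ star (Z ψ) x ∈ p) → p = ⊥ ∨ p = ⊤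

/-- The number operator `∑ Z*(ψ_j) Z(ψ_j)`, with `(ψ_j)` an orthonormal basis. -/
def numberOp [FiniteDimensional ℂ V] (Z : V →ₗ⋆[ℂ] Module.End ℂ K) : Module.End ℂ K :=
  ∑ j, star (Z (stdOrthonormalBasis ℂ V j)) * Z (stdOrthonormalBasis ℂ V j)

/-- The gauge unitary `exp(i t N)`, where `N` is the number operator. -/
def gaugeUnitary [FiniteDimensional ℂ V] (Z : V →ₗ⋆[ℂ] Module.End ℂ K) (t : ℝ) :
    Module.End ℂ K :=
  ((NormedSpace.exp (((t : ℂ) * Complex.I) • LinearMap.toContinuousLinearMap (numberOp Z)) :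
    K →L[ℂ] K) : Module.End ℂ K)

/-- The parity operator `W = exp(i π N) = (-1)^N`. -/
def parityOp [FiniteDimensional ℂ V] (Z : V →ₗ⋆[ℂ] Module.End ℂ K) : Module.End ℂ K :=
  gaugeUnitary Z Real.pi

/-- The Araki–Wyss algebra: the commutant of the number operator. -/
def arakiWyss [FiniteDimensional ℂ V] (Z : V →ₗ⋆[ℂ] Module.End ℂ K) :
    Subalgebra ℂ (Module.End ℂ K) :=
  Subalgebra.centralizer ℂ {numberOp Z}

/-- The inclusion of the Araki–Wyss algebra in `B(K)`. -/
def arakiWyssIncl [FiniteDimensional ℂ V] (Z : V →ₗ⋆[ℂ] Module.End ℂ K) :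
    arakiWyss Z →ₗ[ℂ] Module.End ℂ K :=
  (arakiWyss Z).val.toLinearMap

/-- `D` is the density matrix, with respect to the normalized trace, of the gauge invariant
Gaussian state with symbol `Q`: all the moments of the state `X ↦ τ(D X)` are determined by the
second moments `⟨φ, Q ψ⟩ = τ(D Z*(ψ) Z(φ))` through
`τ(D Z*(ψ₁) ⋯ Z*(ψ_m) Z(φ_n) ⋯ Z(φ₁)) = δ_{mn} det ⟨φ_j, Q ψ_k⟩`. -/
structure IsGaussianWithSymbol (Z : V →ₗ⋆[ℂ] Module.End ℂ K) (Q : V →L[ℂ] V)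
    (D : Module.End ℂ K) : Prop where
  isPositive : D.IsPositive
  tau_eq_one : tau D = 1
  symbol : ∀ φ ψ : V, ⟪φ, Q ψ⟫_ℂ = tau (D * (star (Z ψ) * Z φ))
  moment_of_ne : ∀ (m n : ℕ) (ψ : Fin m → V) (φ : Fin n → V), m ≠ n →
    tau (D * ((List.ofFn fun k => star (Z (ψ k))).prod *
      (List.ofFn fun j => Z (φ j)).reverse.prod)) = 0
  moment_eq_det : ∀ (n : ℕ) (ψ φ : Fin n → V),
    tau (D * ((List.ofFn fun k => star (Z (ψ k))).prod *
      (List.ofFn fun j => Z (φ j)).reverse.prod)) =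
      (Matrix.of fun j k => ⟪φ j, Q (ψ k)⟫_ℂ).det

/-- `D` is the density matrix of a gauge invariant Gaussian (GIG) state. -/
def IsGIGState (Z : V →ₗ⋆[ℂ] Module.End ℂ K) (D : Module.End ℂ K) : Prop :=
  ∃ Q : V →L[ℂ] V, IsGaussianWithSymbol Z Q D

open Classical in
/-- The density matrix of the GIG state with symbol `Q` (it is unique, since the moments determine
a state; for an irreducible CAR field it exists exactly when `0 ≤ Q ≤ 1`). -/
def gaussianDensity (Z : V →ₗ⋆[ℂ] Module.End ℂ K) (Q : V →L[ℂ] V) : Module.End ℂ K :=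
  if h : ∃ D, IsGaussianWithSymbol Z Q D then h.choose else 0

/-- A GIG quantum operation on `B(K)`: a quantum operation that commutes with the gauge group
`X ↦ exp(itN) X exp(-itN)` and maps GIG states to GIG states. -/
structure IsGIGQuantumOperation [FiniteDimensional ℂ V] (Z : V →ₗ⋆[ℂ] Module.End ℂ K)
    (Φ : Module.End ℂ K →ₗ[ℂ] Module.End ℂ K) : Prop where
  isQuantumOperation : IsQuantumOperation LinearMap.id Φ
  gaugeCovariant : ∀ (t : ℝ) (X : Module.End ℂ K),
    Φ (gaugeUnitary Z t * X * gaugeUnitary Z (-t)) =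
      gaugeUnitary Z t * Φ X * gaugeUnitary Z (-t)
  map_gig : ∀ D, IsGIGState Z D → IsGIGState Z (Φ D)

open Classical in
/-- Second quantization: a unitary `𝒰` on `K` with `𝒰 Z(χ) 𝒰* = Z(U χ)` for all `χ`. For a unitary
`U` and an irreducible CAR field such a `𝒰` exists and is unique up to a phase, and only the
conjugation `Y ↦ 𝒰* Y 𝒰`, which does not depend on the phase, is ever used. -/
def secondQuant (Z : V →ₗ⋆[ℂ] Module.End ℂ K) (U : V →ₗ[ℂ] V) : Module.End ℂ K :=
  if h : ∃ 𝒰 : Module.End ℂ K, 𝒰 * star 𝒰 = 1 ∧ star 𝒰 * 𝒰 = 1 ∧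
    ∀ χ : V, 𝒰 * Z χ * star 𝒰 = Z (U χ) then h.choose else 1

/-- The action `Y ↦ 𝒰* Y 𝒰` on density matrices dual to the automorphism
`X ↦ 𝒰 X 𝒰*`, where `𝒰` is the second quantization of `U`. -/
def dualAut (Z : V →ₗ⋆[ℂ] Module.End ℂ K) (U : V →ₗ[ℂ] V) :
    Module.End ℂ K →ₗ[ℂ] Module.End ℂ K :=
  LinearMap.mulLeft ℂ (star (secondQuant Z U)) ∘ₗ LinearMap.mulRight ℂ (secondQuant Z U)

end CAR

/-! ### The Evans–Hugenholtz–Kadison construction -/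

section EHK

variable {H K : Type*}
  [NormedAddCommGroup H] [InnerProductSpace ℂ H] [FiniteDimensional ℂ H] [CompleteSpace H]
  [NormedAddCommGroup K] [InnerProductSpace ℂ K] [FiniteDimensional ℂ K]

/-- A compatible pair: `S` is a contraction and `0 ≤ R ≤ 1 - S S*`. -/
structure IsCompatiblePair (S R : H →L[ℂ] H) : Prop where
  contraction : ‖S‖ ≤ 1
  nonneg : 0 ≤ R
  le : R ≤ 1 - S * star S

/-- The operator `T = ((1 - S S*)⁺)^{1/2} R ((1 - S S*)⁺)^{1/2}`, where `⁺` is the Moore–Penrose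
inverse (in the functional calculus `0⁻¹ = 0`). For a compatible pair it is the unique operator
`0 ≤ T ≤ 1` with `ker (1 - S S*) ⊆ ker T` and
`R = (1 - S S*)^{1/2} T (1 - S S*)^{1/2}`. -/
def ancillaSymbol (S R : H →L[ℂ] H) : H →L[ℂ] H :=
  cfc (fun x : ℝ => (√x)⁻¹) (1 - S * star S) * R * cfc (fun x : ℝ => (√x)⁻¹) (1 - S * star S)

/-- The unitary dilation
`[[-(1 - S S*)^{1/2}, S], [S*, (1 - S* S)^{1/2}]]` of the contraction `S` on `H ⊕ H`. -/
def dilation (S : H →L[ℂ] H) : WithLp 2 (H × H) →ₗ[ℂ] WithLp 2 (H × H) where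
  toFun χ := WithLp.toLp 2
    (-((cfc Real.sqrt (1 - S * star S) : H →L[ℂ] H) χ.fst) + S χ.snd,
      star S χ.fst + (cfc Real.sqrt (1 - star S * S) : H →L[ℂ] H) χ.snd)
  map_add' χ₁ χ₂ := by
    refine (WithLp.toLp_injective 2).eq_iff.2 (Prod.ext ?_ ?_)
    · change -(_ : H) + _ = (-(_ : H) + _) + (-(_ : H) + _)
      rw [WithLp.add_fst, WithLp.add_snd, map_add, map_add]
      abel
    · change (_ : H) + _ = (_ + _) + (_ + _)
      rw [WithLp.add_fst, WithLp.add_snd, map_add, map_add]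
      abel
  map_smul' c χ := by
    refine (WithLp.toLp_injective 2).eq_iff.2 (Prod.ext ?_ ?_)
    · change -(_ : H) + _ = c • (-(_ : H) + _)
      rw [WithLp.smul_fst, WithLp.smul_snd, map_smul, map_smul, smul_add, smul_neg]
    · change (_ : H) + _ = c • (_ + _)
      rw [WithLp.smul_fst, WithLp.smul_snd, map_smul, map_smul, smul_add]

/-- The field `ψ ⊕ η ↦ Z(ψ) ⊗ W + 1 ⊗ Z(η)` over `H ⊕ H`, acting on `K ⊗ K`. -/
def doubledField (Z : H →ₗ⋆[ℂ] Module.End ℂ K) :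
    WithLp 2 (H × H) →ₗ⋆[ℂ] Module.End ℂ (K ⊗[ℂ] K) where
  toFun χ := TensorProduct.map (Z χ.fst) (parityOp Z) + TensorProduct.map 1 (Z χ.snd)
  map_add' χ₁ χ₂ := by
    simp only [WithLp.add_fst, WithLp.add_snd, map_add, TensorProduct.map_add_left,
      TensorProduct.map_add_right]
    abel
  map_smul' c χ := by
    simp only [WithLp.smul_fst, WithLp.smul_snd, LinearMap.map_smulₛₗ,
      TensorProduct.map_smul_left, TensorProduct.map_smul_right, smul_add]

/-- The embedding of `B(K)`, the algebra generated by the `Z(ψ)`, in `B(K ⊗ K)` as the algebra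
generated by the `Z(ψ) ⊗ W`: it sends an even operator `X` (one that commutes with `W`) to `X ⊗ 1`
and an odd one (one that anticommutes with `W`) to `X ⊗ W`. -/
def embedFst (Z : H →ₗ⋆[ℂ] Module.End ℂ K) :
    Module.End ℂ K →ₗ[ℂ] Module.End ℂ (K ⊗[ℂ] K) where
  toFun X :=
    TensorProduct.map ((1 / 2 : ℂ) • (X + parityOp Z * X * star (parityOp Z))) 1 +
    TensorProduct.map ((1 / 2 : ℂ) • (X - parityOp Z * X * star (parityOp Z))) (parityOp Z)
  map_add' X Y := by
    simp only [mul_add, add_mul, sub_eq_add_neg, neg_add, smul_add, TensorProduct.map_add_left]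
    abel
  map_smul' c X := by
    simp only [mul_smul_comm, smul_mul_assoc, ← smul_add, ← smul_sub, smul_comm _ c,
      TensorProduct.map_smul_left, RingHom.id_apply]

/-- The embedding `X ↦ 1 ⊗ X` of `B(K)` as the algebra generated by the `1 ⊗ Z(η)`. -/
def embedSnd : Module.End ℂ K →ₗ[ℂ] Module.End ℂ (K ⊗[ℂ] K) where
  toFun X := TensorProduct.map 1 X
  map_add' _ _ := TensorProduct.map_add_right _ _ _
  map_smul' _ _ := TensorProduct.map_smul_right _ _ _

/-- The Evans–Hugenholtz–Kadison map `Φ_{S,R}`: place `ρ` in the second factor and the GIG state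
with symbol `T` in the first, apply the dual of the quasi-free automorphism given by the dilation
of `S`, and take the tracial conditional expectation onto the first factor. -/
def ehk (Z : H →ₗ⋆[ℂ] Module.End ℂ K) (S R : H →L[ℂ] H) :
    Module.End ℂ K →ₗ[ℂ] Module.End ℂ K :=
  tracialAdjoint (embedFst Z) ∘ₗ dualAut (doubledField Z) (dilation S) ∘ₗ
    LinearMap.mulLeft ℂ (embedFst Z (gaussianDensity Z (ancillaSymbol S R))) ∘ₗ embedSnd

end EHK

/-! ### Semigroups -/

section Semigroups

variable {H K : Type*}
  [NormedAddCommGroup H] [InnerProductSpace ℂ H] [FiniteDimensional ℂ H] [CompleteSpace H]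
  [NormedAddCommGroup K] [InnerProductSpace ℂ K] [FiniteDimensional ℂ K]

/-- `e^{tG}`. -/
def expSemigroup (G : H →L[ℂ] H) (t : ℝ) : H →L[ℂ] H :=
  NormedSpace.exp ((t : ℂ) • G)

/-- `G` generates a contraction semigroup and `0 ≤ A ≤ -G - G*`. -/
structure IsGeneratingPair (G A : H →L[ℂ] H) : Prop where
  contraction : ∀ t : ℝ, 0 ≤ t → ‖expSemigroup G t‖ ≤ 1
  nonneg : 0 ≤ A
  le : A ≤ -G - star G

/-- `R_t = ∫₀ᵗ e^{sG} A e^{sG*} ds`. -/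
def Rint (G A : H →L[ℂ] H) (t : ℝ) : H →L[ℂ] H :=
  ∫ s in (0 : ℝ)..t, expSemigroup G s * A * expSemigroup (star G) s

/-- The map `Φ_{e^{tG}, R_t}` on `B(K)`. -/
def ehkFlow (Z : H →ₗ⋆[ℂ] Module.End ℂ K) (G A : H →L[ℂ] H) (t : ℝ≥0) :
    Module.End ℂ K →ₗ[ℂ] Module.End ℂ K :=
  ehk Z (expSemigroup G t) (Rint G A t)

/-- A (continuous) semigroup of quantum operations on the Araki–Wyss algebra, each of which maps
the set of GIG states into itself. -/
structure IsGIGSemigroup (Z : H →ₗ⋆[ℂ] Module.End ℂ K)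
    (P : ℝ≥0 → (arakiWyss Z →ₗ[ℂ] arakiWyss Z)) : Prop where
  zero : P 0 = LinearMap.id
  add : ∀ s t : ℝ≥0, P (s + t) = P s ∘ₗ P t
  continuous : ∀ X : arakiWyss Z,
    Continuous fun t => LinearMap.toContinuousLinearMap (arakiWyssIncl Z (P t X))
  isQuantumOperation : ∀ t : ℝ≥0, IsQuantumOperation (arakiWyssIncl Z) (P t)
  map_gig : ∀ (t : ℝ≥0) (X : arakiWyss Z),
    IsGIGState Z (arakiWyssIncl Z X) → IsGIGState Z (arakiWyssIncl Z (P t X))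

/-- `P_t` is the restriction of `Φ_{e^{tG}, R_t}` to the Araki–Wyss algebra, for all `t ≥ 0`. -/
def IsRestrictedFlow (Z : H →ₗ⋆[ℂ] Module.End ℂ K) (G A : H →L[ℂ] H)
    (P : ℝ≥0 → (arakiWyss Z →ₗ[ℂ] arakiWyss Z)) : Prop :=
  ∀ (t : ℝ≥0) (X : arakiWyss Z),
    arakiWyssIncl Z (P t X) = ehkFlow Z G A t (arakiWyssIncl Z X)

end Semigroups

end GIG

end

/-!
The theorem is reduced to the motion of the symbol `Q`. The relation
`ρ Z*((1 - Q) ψ) = Z*(Q ψ) ρ` between a density matrix and the creation operators already implies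
Wick's theorem (`IsQuasiFree.isGaussianWithSymbol`), and it is easy to verify: for the trace, for
which `Q = 1 / 2`, after a change of the occupation of one mode (`IsQuasiFree.update`), and for
tensor products. For an irreducible field the normally ordered monomials span all operators, so
that moments determine an operator (`eq_of_moments`) and Gaussian density matrices exist and are
unique. The moments of the Gaussian states are rich enough for their density matrices to span the
Araki–Wyss algebra (`mem_gaussianSpan_of_mem_arakiWyss`); therefore a linear map on this algebra is
known once it is known on the `ρ_Q` (`eq_of_eq_on_gaussian`).

*From pairs to semigroups.* In the Heisenberg picture the Evans–Hugenholtz–Kadison operation is the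
embedding of the first factor, rotated by the implementer of the dilation `U_S`, followed by the
partial expectation in the state `ρ_T` of the ancilla (`tau_ehk_mul`). Complete positivity, gauge
covariance and `Φ_{S,R} ρ_Q = ρ_{S Q S* + R}` (`ehk_gaussianDensity`) are read off from this. On
the Araki–Wyss algebra the semigroup law thus amounts to the cocycle identity
`R_{s+t} = e^{sG} R_t e^{sG*} + R_s` (`Rint_add`).

*From semigroups to pairs.* A continuous semigroup in finite dimension has a generator
(`exists_eq_exp`). Since all moments of a Gaussian state are determinants of second moments, the
generator is determined by the drift `v(Q)` of the symbol (`IsGIGSemigroup.generator_ext`), and it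
has to be shown that `v(Q) = A + G Q + Q G*`. The density matrix `ρ_{Q + s |x⟩⟨x|}`, with `Q x = 0`,
is affine in `s` (`gaussianDensity_line`), and so is its evolution. The evolved states have to be
Gaussian for `s = 0, 1 / 2, 1`, and the `2 × 2` determinants of their moments then force the
difference of the evolved symbols for `s = 0, 1` to have rank at most one. At time `0` this
difference is `|x⟩⟨x|`, and differentiation shows that `v(Q + |x⟩⟨x|) - v(Q)` has no corner on the orthogonal complement of `x` (`IsGIGSemigroup.corner_drift`). For two orthogonal modes
`x, z` the sum `ρ_{Q + |x⟩⟨x|} + ρ_{Q + |z⟩⟨z|}` depends on the plane spanned by `x` and `z` only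
(`gaussianDensity_plane`). So the second difference of `v` is without corner on the complement of
every vector of this plane and vanishes (`drift_add_drift`). Therefore `v(Q) - v(0)` is the sum of
the contributions of the eigenmodes of `Q`. The contribution of a mode `x` is the diagonal value of a
sesquilinear form in `x`, because `ρ_{|x⟩⟨x|} = Z*(x) ρ_0 Z(x)`, and a hermitian operator-valued
form without corners is `|G x⟩⟨x| + |x⟩⟨G x|` (`exists_rankOne_of_corner`). The symbol
can leave neither `0 ≤ Q` at `Q = 0` nor `Q ≤ 1` at `Q = 1`, which gives `0 ≤ A ≤ -G - G*`.

*Uniqueness.* Two flows agree if and only if their drifts do (`restrictedFlow_eq_iff`), and the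
drift determines `A` and, up to an imaginary constant, `G` (`drift_eq_iff`). The constant is fixed by
`Im Tr G = 0`.
-/

noncomputable section

namespace GIG

/-! ### The normalized trace -/

section Trace

variable {K : Type*} [NormedAddCommGroup K] [InnerProductSpace ℂ K] [FiniteDimensional ℂ K]

omit [FiniteDimensional ℂ K] in
theorem tau_apply (X : Module.End ℂ K) :
    tau X = (Module.finrank ℂ K : ℂ)⁻¹ * LinearMap.trace ℂ K X := rfl

omit [FiniteDimensional ℂ K] in
theorem tau_mul_comm (X Y : Module.End ℂ K) : tau (X * Y) = tau (Y * X) := by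
  rw [tau_apply, tau_apply, LinearMap.trace_mul_comm]

theorem tau_one [Nontrivial K] : tau (1 : Module.End ℂ K) = 1 := by
  have hd : (Module.finrank ℂ K : ℂ) ≠ 0 := by
    exact_mod_cast (Module.finrank_pos (R := ℂ) (M := K)).ne'
  rw [tau_apply, LinearMap.trace_one, inv_mul_cancel₀ hd]

omit [FiniteDimensional ℂ K] in
theorem tau_nonneg {X : Module.End ℂ K} (hX : X.IsPositive) : 0 ≤ tau X := by
  rw [tau_apply]
  refine mul_nonneg ?_ hX.trace_nonneg
  rw [inv_nonneg]
  exact Nat.cast_nonneg _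

/-- The operator `|x⟩⟨y|`, which sends `z` to `⟪y, z⟫ x`. -/
def ketbra (x y : K) : Module.End ℂ K := (InnerProductSpace.rankOne ℂ x y : K →L[ℂ] K)

omit [FiniteDimensional ℂ K] in
@[simp] theorem ketbra_apply (x y z : K) : ketbra x y z = ⟪y, z⟫_ℂ • x := rfl

theorem star_ketbra (x y : K) : star (ketbra x y) = ketbra y x := by
  rw [LinearMap.star_eq_adjoint]
  refine ((LinearMap.eq_adjoint_iff _ _).2 fun u v => ?_).symm
  simp [inner_smul_left, inner_smul_right, mul_comm]

omit [FiniteDimensional ℂ K] in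
theorem mul_ketbra (X : Module.End ℂ K) (x y : K) : X * ketbra x y = ketbra (X x) y := by
  ext z; simp

theorem trace_ketbra (x y : K) : LinearMap.trace ℂ K (ketbra x y) = ⟪y, x⟫_ℂ :=
  InnerProductSpace.trace_rankOne x y

omit [FiniteDimensional ℂ K] in
theorem sum_ketbra (X : Module.End ℂ K) {ι : Type*} [Fintype ι] (b : OrthonormalBasis ι ℂ K) :
    X = ∑ i, ketbra (X (b i)) (b i) := by
  ext z
  conv_lhs => rw [← b.sum_repr' z]
  simp

/-- The trace form is nondegenerate. -/
theorem eq_zero_of_tau_mul_ketbra {X : Module.End ℂ K} (h : ∀ x y, tau (X * ketbra x y) = 0) :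
    X = 0 := by
  rcases subsingleton_or_nontrivial K with hK | hK
  · ext x; exact Subsingleton.elim _ _
  have hd : (Module.finrank ℂ K : ℂ)⁻¹ ≠ 0 := by
    exact inv_ne_zero (by exact_mod_cast (Module.finrank_pos (R := ℂ) (M := K)).ne')
  ext x
  have h1 := h x (X x)
  rw [mul_ketbra, tau_apply, trace_ketbra] at h1
  simpa using (mul_eq_zero.1 h1).resolve_left hd

theorem eq_of_tau_mul {X Y : Module.End ℂ K} (h : ∀ T, tau (X * T) = tau (Y * T)) : X = Y := by
  rw [← sub_eq_zero]
  refine eq_zero_of_tau_mul_ketbra fun x y => ?_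
  rw [sub_mul, map_sub, h, sub_self]

theorem isPositive_star_mul_self (X : Module.End ℂ K) : (star X * X).IsPositive :=
  LinearMap.isPositive_adjoint_comp_self X

theorem eq_zero_of_tau_star_mul_self {X : Module.End ℂ K} (h : tau (star X * X) = 0) : X = 0 := by
  rcases subsingleton_or_nontrivial K with hK | hK
  · ext x; exact Subsingleton.elim _ _
  have hd : (Module.finrank ℂ K : ℂ)⁻¹ ≠ 0 := by
    exact inv_ne_zero (by exact_mod_cast (Module.finrank_pos (R := ℂ) (M := K)).ne')
  rw [tau_apply, mul_eq_zero, or_iff_right hd,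
    LinearMap.trace_eq_sum_inner _ (stdOrthonormalBasis ℂ K)] at h
  have h1 : ∀ i, ⟪stdOrthonormalBasis ℂ K i, (star X * X) (stdOrthonormalBasis ℂ K i)⟫_ℂ
      = ((‖X (stdOrthonormalBasis ℂ K i)‖ ^ 2 : ℝ) : ℂ) := by
    intro i
    rw [Module.End.mul_apply, LinearMap.star_eq_adjoint, LinearMap.adjoint_inner_right,
      inner_self_eq_norm_sq_to_K]
    simp
  simp only [h1] at h
  rw [← Complex.ofReal_sum, Complex.ofReal_eq_zero,
    Finset.sum_eq_zero_iff_of_nonneg (fun i _ => by positivity)] at h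
  refine (stdOrthonormalBasis ℂ K).toBasis.ext fun i => ?_
  have := h i (Finset.mem_univ _)
  simpa using this

theorem isPositive_conj {X : Module.End ℂ K} (hX : X.IsPositive) (Y : Module.End ℂ K) :
    (star Y * X * Y).IsPositive := by
  have := hX.adjoint_conj Y
  rwa [← LinearMap.star_eq_adjoint, ← Module.End.mul_eq_comp, ← Module.End.mul_eq_comp,
    ← mul_assoc] at this

theorem star_eq_of_isPositive {X : Module.End ℂ K} (hX : X.IsPositive) : star X = X :=
  hX.isSelfAdjoint

end Trace

/-! ### Products of creation operators and Wick's theorem -/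

section Wick

variable {V K : Type*} [NormedAddCommGroup V] [InnerProductSpace ℂ V]
  [NormedAddCommGroup K] [InnerProductSpace ℂ K] [FiniteDimensional ℂ K]

/-- The product `Z*(v₁) ⋯ Z*(v_m)` of creation operators. -/
def creation (Z : V →ₗ⋆[ℂ] Module.End ℂ K) {m : ℕ} (v : Fin m → V) : Module.End ℂ K :=
  (List.ofFn fun k => star (Z (v k))).prod

variable {Z : V →ₗ⋆[ℂ] Module.End ℂ K}

@[simp] theorem creation_zero (v : Fin 0 → V) : creation Z v = 1 := by simp [creation]

theorem creation_succ {m : ℕ} (v : Fin (m + 1) → V) :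
    creation Z v = star (Z (v 0)) * creation Z (fun k => v k.succ) := by
  simp [creation, List.ofFn_succ]

theorem star_creation {m : ℕ} (v : Fin m → V) :
    star (creation Z v) = (List.ofFn fun k => Z (v k)).reverse.prod := by
  induction m with
  | zero => simp
  | succ m ih => simp [creation_succ, ih, List.ofFn_succ]

variable (Z) in
/-- The field `ψ ↦ Z*(ψ)` as a linear map. -/
def starField : V →ₗ[ℂ] Module.End ℂ K where
  toFun ψ := star (Z ψ)
  map_add' ψ φ := by rw [map_add, star_add]
  map_smul' c ψ := by rw [LinearMap.map_smulₛₗ, star_smul]; simp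

theorem starField_apply (ψ : V) : starField Z ψ = star (Z ψ) := rfl

/-- A density matrix `D` that is quasi-free with symbol `Q` by virtue of the exchange relation
`D Z*((1 - Q) ψ) = Z*(Q ψ) D`. The operator `N` in `gauge` plays the role of the number operator:
it need not be the operator `numberOp Z`, which makes the notion easy to verify for tensor
products. -/
structure IsQuasiFree (Z : V →ₗ⋆[ℂ] Module.End ℂ K) (Q : V →L[ℂ] V) (D : Module.End ℂ K) :
    Prop where
  isPositive : D.IsPositive
  tau_eq_one : tau D = 1
  gauge : ∃ N : Module.End ℂ K, (∀ ψ, N * star (Z ψ) = star (Z ψ) * N + star (Z ψ)) ∧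
    (∀ ψ, N * Z ψ = Z ψ * N - Z ψ) ∧ D * N = N * D
  exchange : ∀ ψ, D * star (Z (ψ - Q ψ)) = star (Z (Q ψ)) * D

theorem number_mul_creation {N : Module.End ℂ K}
    (hN : ∀ ψ, N * star (Z ψ) = star (Z ψ) * N + star (Z ψ)) {m : ℕ} (v : Fin m → V) :
    N * creation Z v = creation Z v * N + (m : ℂ) • creation Z v := by
  induction m with
  | zero => simp
  | succ m ih =>
    rw [creation_succ, ← mul_assoc, hN, add_mul, mul_assoc, ih, mul_add, mul_smul_comm, add_assoc,
      ← mul_assoc]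
    push_cast
    rw [add_smul, one_smul]

theorem number_mul_star_creation {N : Module.End ℂ K}
    (hN : ∀ ψ, N * Z ψ = Z ψ * N - Z ψ) {m : ℕ} (v : Fin m → V) :
    N * star (creation Z v) = star (creation Z v) * N - (m : ℂ) • star (creation Z v) := by
  induction m with
  | zero => simp
  | succ m ih =>
    rw [creation_succ, star_mul, star_star, ← mul_assoc, ih, sub_mul, mul_assoc, hN, mul_sub,
      smul_mul_assoc, ← mul_assoc]
    push_cast
    rw [add_smul, one_smul]
    abel

theorem tau_number_moment {N D : Module.End ℂ K}
    (hN : ∀ ψ, N * star (Z ψ) = star (Z ψ) * N + star (Z ψ))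
    (hN' : ∀ ψ, N * Z ψ = Z ψ * N - Z ψ) (hD : D * N = N * D)
    {m n : ℕ} (hmn : m ≠ n) (v : Fin m → V) (w : Fin n → V) :
    tau (D * (creation Z v * star (creation Z w))) = 0 := by
  set M := creation Z v * star (creation Z w) with hM
  have h1 : N * M - M * N = ((m : ℂ) - n) • M := by
    rw [hM, ← mul_assoc, number_mul_creation hN, add_mul, mul_assoc, number_mul_star_creation hN',
      mul_sub, sub_smul, smul_mul_assoc, mul_smul_comm, mul_assoc]
    abel
  clear_value M
  have h2 : tau (D * (N * M - M * N)) = 0 := by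
    rw [mul_sub, map_sub, ← mul_assoc, ← mul_assoc, tau_mul_comm (D * M) N, ← mul_assoc, hD,
      sub_self]
  rw [h1, mul_smul_comm, map_smul, smul_eq_mul] at h2
  refine (mul_eq_zero.1 h2).resolve_left (sub_ne_zero.2 ?_)
  exact_mod_cast hmn

variable (hZ : IsCARField Z)
include hZ

theorem creation_mul_star {m : ℕ} (v : Fin m → V) (χ : V) :
    creation Z v * star (Z χ) = (-1 : ℂ) ^ m • (star (Z χ) * creation Z v) := by
  induction m with
  | zero => simp
  | succ m ih =>
    have h := eq_neg_of_add_eq_zero_left (hZ.star_anticomm (v 0) χ)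
    rw [creation_succ, mul_assoc, ih, mul_smul_comm, ← mul_assoc, h, pow_succ, neg_mul, mul_assoc]
    simp

theorem star_creation_mul_star {n : ℕ} (w : Fin (n + 1) → V) (χ : V) :
    star (creation Z w) * star (Z χ) =
      (∑ j : Fin (n + 1), ((-1 : ℂ) ^ (j : ℕ) * ⟪w j, χ⟫_ℂ) •
        star (creation Z fun k => w (j.succAbove k))) +
      (-1 : ℂ) ^ (n + 1) • (star (Z χ) * star (creation Z w)) := by
  induction n with
  | zero =>
    have h := eq_sub_of_add_eq (hZ.anticomm_star (w 0) χ)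
    simp [creation_succ, h, sub_eq_add_neg]
  | succ n ih =>
    have h := eq_sub_of_add_eq (hZ.anticomm_star (w 0) χ)
    rw [creation_succ, star_mul, star_star, mul_assoc, h, mul_sub, mul_smul_comm, mul_one,
      ← mul_assoc, ih, Fin.sum_univ_succ (n := n + 1), add_mul, Finset.sum_mul, smul_mul_assoc,
      mul_assoc]
    simp only [Fin.val_zero, pow_zero, one_mul, Fin.zero_succAbove, Fin.val_succ]
    rw [sub_eq_add_neg]
    refine Eq.trans ?_ (add_assoc _ _ _).symm
    congr 1
    rw [neg_add]
    congr 1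
    · rw [← Finset.sum_neg_distrib]
      refine Finset.sum_congr rfl fun j _ => ?_
      conv_rhs => rw [creation_succ, star_mul, star_star]
      simp only [Fin.succ_succAbove_zero, Fin.succ_succAbove_succ]
      rw [smul_mul_assoc, ← neg_smul]
      congr 1
      ring
    · rw [← neg_smul]
      congr 1
      ring

/-- The Laplace expansion of moments: move one creation operator around the trace. -/
theorem IsQuasiFree.moment_succ {Q : V →L[ℂ] V} {D : Module.End ℂ K} (hD : IsQuasiFree Z Q D)
    {n : ℕ} (v w : Fin (n + 1) → V) :
    tau (D * (creation Z v * star (creation Z w))) =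
      ∑ j : Fin (n + 1), (-1 : ℂ) ^ (j : ℕ) * ⟪w j, Q (v 0)⟫_ℂ *
        tau (D * (creation Z (fun k => v k.succ) *
          star (creation Z fun k => w (j.succAbove k)))) := by
  set Y := creation Z (fun k => v k.succ) with hY
  set B := star (creation Z w) with hB
  have h1 : star (Z (v 0)) = star (Z (v 0 - Q (v 0))) + star (Z (Q (v 0))) := by
    rw [← star_add, ← map_add, sub_add_cancel]
  have h2 : Y * B * star (Z (Q (v 0))) =
      (∑ j : Fin (n + 1), ((-1 : ℂ) ^ (j : ℕ) * ⟪w j, Q (v 0)⟫_ℂ) •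
        (Y * star (creation Z fun k => w (j.succAbove k)))) - star (Z (Q (v 0))) * (Y * B) := by
    rw [mul_assoc, hB, star_creation_mul_star hZ, mul_add, Finset.mul_sum, mul_smul_comm,
      ← mul_assoc, hY, creation_mul_star hZ, smul_mul_assoc, smul_smul, ← pow_add,
      show n + 1 + n = 2 * n + 1 by ring, pow_succ, pow_mul]
    simp [mul_assoc, sub_eq_add_neg]
  rw [creation_succ, ← hY, h1, add_mul, add_mul, mul_add, map_add, mul_assoc, ← mul_assoc D,
    hD.exchange, mul_assoc, tau_mul_comm, mul_assoc D, h2, mul_sub, map_sub, mul_assoc (star _),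
    sub_add_cancel, Finset.mul_sum, map_sum]
  refine Finset.sum_congr rfl fun j _ => ?_
  rw [mul_smul_comm, map_smul, smul_eq_mul]

/-- **Wick's theorem**: the moments of a quasi-free density matrix are determinants. -/
theorem IsQuasiFree.isGaussianWithSymbol {Q : V →L[ℂ] V} {D : Module.End ℂ K}
    (hD : IsQuasiFree Z Q D) : IsGaussianWithSymbol Z Q D := by
  have hdet : ∀ (n : ℕ) (v w : Fin n → V), tau (D * (creation Z v * star (creation Z w))) =
      (Matrix.of fun j k => ⟪w j, Q (v k)⟫_ℂ).det := by
    intro n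
    induction n with
    | zero => intro v w; simp [hD.tau_eq_one]
    | succ n ih =>
      intro v w
      rw [hD.moment_succ hZ, Matrix.det_succ_column_zero]
      refine Finset.sum_congr rfl fun j _ => ?_
      rw [ih]
      rfl
  refine ⟨hD.isPositive, hD.tau_eq_one, fun φ ψ => ?_, fun m n v w hmn => ?_, fun n v w => ?_⟩
  · have := hdet 1 (fun _ => ψ) (fun _ => φ)
    rw [Matrix.det_fin_one] at this
    simpa [creation_succ] using this.symm
  · rw [← star_creation]
    obtain ⟨N, hN, hN', hDN⟩ := hD.gauge
    exact tau_number_moment hN hN' hDN hmn v w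
  · rw [← star_creation]
    exact hdet n v w

end Wick

/-! ### Occupation numbers and the number operator -/

section Occupation

variable {V K : Type*} [NormedAddCommGroup V] [InnerProductSpace ℂ V]
  [NormedAddCommGroup K] [InnerProductSpace ℂ K] [FiniteDimensional ℂ K]
  {Z : V →ₗ⋆[ℂ] Module.End ℂ K}

variable (Z) in
/-- The operator `Z*(x) Z(x)`, which for a unit vector `x` is the projection onto the states in
which the mode `x` is occupied. -/
def occ (x : V) : Module.End ℂ K := star (Z x) * Z x

theorem star_occ (x : V) : star (occ Z x) = occ Z x := by simp [occ]

theorem number_comm_occ {N : Module.End ℂ K}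
    (hN : ∀ ψ, N * star (Z ψ) = star (Z ψ) * N + star (Z ψ))
    (hN' : ∀ ψ, N * Z ψ = Z ψ * N - Z ψ) (x : V) : occ Z x * N = N * occ Z x := by
  rw [occ, ← mul_assoc, hN, add_mul, mul_assoc _ N, hN', mul_sub, ← mul_assoc]
  abel

variable (hZ : IsCARField Z)
include hZ

theorem Z_mul_self (x : V) : Z x * Z x = 0 := by
  have h := hZ.anticomm x x
  rw [← two_smul ℂ] at h
  exact (smul_eq_zero.1 h).resolve_left two_ne_zero

theorem star_Z_mul_self (x : V) : star (Z x) * star (Z x) = 0 := by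
  rw [← star_mul, Z_mul_self hZ, star_zero]

theorem Z_mul_star_self {x : V} (hx : ‖x‖ = 1) : Z x * star (Z x) = 1 - occ Z x := by
  have h := hZ.anticomm_star x x
  rw [inner_self_eq_norm_sq_to_K, hx] at h
  rw [occ, eq_sub_iff_add_eq, h]
  simp

theorem occ_mul_star {x : V} (hx : ‖x‖ = 1) : occ Z x * star (Z x) = star (Z x) := by
  rw [occ, mul_assoc, Z_mul_star_self hZ hx, mul_sub, occ, ← mul_assoc, star_Z_mul_self hZ]
  simp

theorem star_mul_occ (x : V) : star (Z x) * occ Z x = 0 := by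
  rw [occ, ← mul_assoc, star_Z_mul_self hZ, zero_mul]

theorem occ_mul_Z (x : V) : occ Z x * Z x = 0 := by
  rw [occ, mul_assoc, Z_mul_self hZ, mul_zero]

theorem Z_mul_occ {x : V} (hx : ‖x‖ = 1) : Z x * occ Z x = Z x := by
  have := congrArg star (occ_mul_star hZ hx)
  simpa [star_occ] using this

theorem occ_mul_self {x : V} (hx : ‖x‖ = 1) : occ Z x * occ Z x = occ Z x := by
  conv_lhs => rw [occ, mul_assoc, ← occ, Z_mul_occ hZ hx]
  rfl

theorem occ_mul_star_of_inner_eq_zero {x y : V} (h : ⟪x, y⟫_ℂ = 0) :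
    occ Z x * star (Z y) = star (Z y) * occ Z x := by
  have h1 := hZ.anticomm_star x y
  rw [h, zero_smul] at h1
  have h2 := hZ.star_anticomm x y
  rw [occ, mul_assoc, eq_neg_of_add_eq_zero_left h1, mul_neg, ← mul_assoc,
    eq_neg_of_add_eq_zero_left h2, neg_mul, neg_neg, mul_assoc]

theorem occ_mul_Z_of_inner_eq_zero {x y : V} (h : ⟪x, y⟫_ℂ = 0) :
    occ Z x * Z y = Z y * occ Z x := by
  have := congrArg star (occ_mul_star_of_inner_eq_zero hZ h)
  simpa [star_occ] using this.symm

section Number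

variable [FiniteDimensional ℂ V]

omit hZ in
theorem star_numberOp : star (numberOp Z) = numberOp Z := by
  simp [numberOp, star_sum]

theorem numberOp_mul_star (ψ : V) :
    numberOp Z * star (Z ψ) = star (Z ψ) * numberOp Z + star (Z ψ) := by
  obtain ⟨b, hb⟩ : ∃ b, b = stdOrthonormalBasis ℂ V := ⟨_, rfl⟩
  have h : ∀ j, star (Z (b j)) * Z (b j) * star (Z ψ) =
      star (Z ψ) * (star (Z (b j)) * Z (b j)) + starField Z (⟪b j, ψ⟫_ℂ • b j) := by
    intro j
    have h1 := eq_sub_of_add_eq (hZ.anticomm_star (b j) ψ)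
    have h2 := eq_neg_of_add_eq_zero_left (hZ.star_anticomm (b j) ψ)
    rw [mul_assoc, h1, mul_sub, ← mul_assoc, h2, map_smul, starField_apply]
    simp [mul_assoc, add_comm]
  rw [numberOp, ← hb, Finset.sum_mul, Finset.mul_sum]
  simp only [h]
  rw [Finset.sum_add_distrib, ← map_sum, b.sum_repr' ψ, starField_apply]

theorem numberOp_mul (ψ : V) : numberOp Z * Z ψ = Z ψ * numberOp Z - Z ψ := by
  have := congrArg star (numberOp_mul_star hZ ψ)
  simp only [star_mul, star_add, star_star, star_numberOp] at this
  rw [this, add_sub_cancel_right]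

end Number

/-! ### Existence of quasi-free density matrices -/

/-- Changing the occupation probability of a mode `x` from `1 / 2` to `q`. -/
theorem IsQuasiFree.update {Q : V →L[ℂ] V} {D : Module.End ℂ K} (hD : IsQuasiFree Z Q D)
    (hQ : ∀ φ ψ, ⟪Q φ, ψ⟫_ℂ = ⟪φ, Q ψ⟫_ℂ) {x : V} (hx : ‖x‖ = 1)
    (hQx : Q x = (1 / 2 : ℂ) • x) {q : ℝ} (hq0 : 0 ≤ q) (hq1 : q ≤ 1) :
    IsQuasiFree Z (Q + ((q : ℂ) - 1 / 2) • InnerProductSpace.rankOne ℂ x x)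
      (D * ((2 * q : ℂ) • occ Z x + (2 - 2 * q : ℂ) • (1 - occ Z x))) := by
  have hDa : D * star (Z x) = star (Z x) * D := by
    have h := hD.exchange x
    have h1 : x - (1 / 2 : ℂ) • x = (1 / 2 : ℂ) • x := by module
    rw [hQx, h1, ← starField_apply, map_smul, mul_smul_comm, smul_mul_assoc] at h
    exact smul_right_injective _ (by norm_num) h
  have hDz : D * Z x = Z x * D := by
    have := congrArg star hDa
    simpa [star_eq_of_isPositive hD.isPositive] using this.symm
  have hDn : D * occ Z x = occ Z x * D := by
    rw [occ, ← mul_assoc, hDa, mul_assoc, hDz, mul_assoc]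
  have hnn := occ_mul_self hZ hx
  have hτ : tau (D * occ Z x) = 1 / 2 := by
    have h1 : tau (D * occ Z x) = tau (D * (1 - occ Z x)) := by
      conv_lhs => rw [occ, ← mul_assoc, tau_mul_comm, ← mul_assoc, ← hDz, mul_assoc,
        Z_mul_star_self hZ hx]
    rw [mul_sub, mul_one, map_sub, hD.tau_eq_one] at h1
    linear_combination h1 / 2
  have hex : ∀ ψ, D * starField Z (ψ - Q ψ) = starField Z (Q ψ) * D := hD.exchange
  refine ⟨?_, ?_, ?_, fun ψ => ?_⟩
  · have h1 : D * ((2 * q : ℂ) • occ Z x + (2 - 2 * q : ℂ) • (1 - occ Z x)) =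
        (2 * q : ℂ) • (star (occ Z x) * D * occ Z x) +
        (2 - 2 * q : ℂ) • (star (1 - occ Z x) * D * (1 - occ Z x)) := by
      have h2 : (1 - occ Z x) * (1 - occ Z x) = 1 - occ Z x := by
        rw [sub_mul, one_mul, mul_sub, mul_one, hnn, sub_self, sub_zero]
      have h3 : (1 - occ Z x) * D = D * (1 - occ Z x) := by rw [sub_mul, mul_sub, hDn]; simp
      rw [star_sub, star_one, star_occ, ← hDn, h3, mul_assoc, mul_assoc, hnn, h2, mul_add,
        mul_smul_comm, mul_smul_comm]
    rw [h1]
    refine ((isPositive_conj hD.isPositive _).smul_of_nonneg ?_).add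
      ((isPositive_conj hD.isPositive _).smul_of_nonneg ?_)
    · exact_mod_cast (by positivity : 0 ≤ 2 * q)
    · exact_mod_cast (by linarith : 0 ≤ 2 - 2 * q)
  · rw [mul_add, mul_smul_comm, mul_smul_comm, mul_sub, mul_one, map_add, map_smul, map_smul,
      map_sub, hτ, hD.tau_eq_one, smul_eq_mul, smul_eq_mul]
    ring
  · obtain ⟨N, hN, hN', hDN⟩ := hD.gauge
    refine ⟨N, hN, hN', ?_⟩
    have hc := number_comm_occ hN hN' x
    rw [mul_assoc, add_mul, smul_mul_assoc, smul_mul_assoc, sub_mul, hc, one_mul]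
    have : (2 * q : ℂ) • (N * occ Z x) + (2 - 2 * q : ℂ) • (N - N * occ Z x) =
        N * ((2 * q : ℂ) • occ Z x + (2 - 2 * q : ℂ) • (1 - occ Z x)) := by
      rw [mul_add, mul_smul_comm, mul_smul_comm, mul_sub, mul_one]
    rw [this, ← mul_assoc, hDN, mul_assoc]
  · -- split `ψ` into its component along `x` and the orthogonal one
    set s := ⟪x, ψ⟫_ℂ with hs
    obtain ⟨ψ', hψ'⟩ : ∃ ψ', ψ' = ψ - s • x := ⟨_, rfl⟩
    have hxx : ⟪x, x⟫_ℂ = 1 := by rw [inner_self_eq_norm_sq_to_K, hx]; simp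
    have hxψ' : ⟪x, ψ'⟫_ℂ = 0 := by
      rw [hψ', inner_sub_right, inner_smul_right, hxx, ← hs]; simp
    have hxQ : ⟪x, Q ψ'⟫_ℂ = 0 := by
      rw [← hQ, hQx, inner_smul_left, hxψ', mul_zero]
    have hψ : ψ = s • x + ψ' := by rw [hψ']; abel
    have hQψ : (Q + ((q : ℂ) - 1 / 2) • InnerProductSpace.rankOne ℂ x x) ψ =
        (s * q) • x + Q ψ' := by
      simp only [add_apply, smul_apply,
        InnerProductSpace.rankOne_apply, ← hs]
      conv_lhs => rw [hψ]
      rw [map_add, map_smul, hQx]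
      module
    have hψQ : ψ - ((s * q) • x + Q ψ') = (s * (1 - q)) • x + (ψ' - Q ψ') := by
      conv_lhs => rw [hψ]
      module
    have hB : ∀ χ, ⟪x, χ⟫_ℂ = 0 →
        ((2 * q : ℂ) • occ Z x + (2 - 2 * q : ℂ) • (1 - occ Z x)) * starField Z χ =
        starField Z χ * ((2 * q : ℂ) • occ Z x + (2 - 2 * q : ℂ) • (1 - occ Z x)) := by
      intro χ hχ
      have h := occ_mul_star_of_inner_eq_zero hZ hχ
      rw [starField_apply, add_mul, mul_add, smul_mul_assoc, smul_mul_assoc, mul_smul_comm,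
        mul_smul_comm, sub_mul, mul_sub, h, one_mul, mul_one]
    have hBa : ((2 * q : ℂ) • occ Z x + (2 - 2 * q : ℂ) • (1 - occ Z x)) * starField Z x =
        (2 * q : ℂ) • starField Z x := by
      rw [starField_apply, add_mul, smul_mul_assoc, smul_mul_assoc, sub_mul, occ_mul_star hZ hx]
      simp
    have haB : starField Z x * ((2 * q : ℂ) • occ Z x + (2 - 2 * q : ℂ) • (1 - occ Z x)) =
        (2 - 2 * q : ℂ) • starField Z x := by
      rw [starField_apply, mul_add, mul_smul_comm, mul_smul_comm, mul_sub, star_mul_occ hZ]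
      simp
    rw [hQψ, hψQ, ← starField_apply, ← starField_apply, map_add, map_add, mul_add, add_mul,
      map_smul, map_smul]
    congr 1
    · rw [mul_smul_comm, smul_mul_assoc, ← mul_assoc, starField_apply, ← hDa, ← starField_apply,
        mul_assoc, mul_assoc, hBa, haB, mul_smul_comm, mul_smul_comm, smul_smul, smul_smul]
      congr 1
      ring
    · rw [mul_assoc, hB _ (by rw [inner_sub_right, hxψ', hxQ, sub_zero]), ← mul_assoc, hex,
        mul_assoc]

section Existence

variable [FiniteDimensional ℂ V] [Nontrivial K]

/-- The trace is the quasi-free state in which every mode has occupation probability `1 / 2`. -/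
theorem isQuasiFree_half : IsQuasiFree Z ((1 / 2 : ℂ) • (1 : V →L[ℂ] V)) 1 := by
  refine ⟨LinearMap.isPositive_one, tau_one,
    ⟨numberOp Z, numberOp_mul_star hZ, numberOp_mul hZ, by rw [one_mul, mul_one]⟩, fun ψ => ?_⟩
  have : ψ - ((1 / 2 : ℂ) • (1 : V →L[ℂ] V)) ψ = ((1 / 2 : ℂ) • (1 : V →L[ℂ] V)) ψ := by
    simp only [smul_apply, one_apply_eq_self]
    module
  rw [this, one_mul, mul_one]

/-- A density matrix with a symbol that is diagonal in a given orthonormal basis. It belongs to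
every space of operators that contains `1` and is stable under left multiplication by all the
occupation numbers. -/
theorem exists_isQuasiFree_diagonal {ι : Type*} [Fintype ι] (b : OrthonormalBasis ι ℂ V)
    (q : ι → ℝ) (hq0 : ∀ i, 0 ≤ q i) (hq1 : ∀ i, q i ≤ 1) (p : Submodule ℂ (Module.End ℂ K))
    (hp1 : 1 ∈ p) (hp : ∀ x, ∀ T ∈ p, occ Z x * T ∈ p) (s : Finset ι) :
    ∃ D ∈ p, IsQuasiFree Z ((1 / 2 : ℂ) • (1 : V →L[ℂ] V) +
      ∑ i ∈ s, ((q i : ℂ) - 1 / 2) • InnerProductSpace.rankOne ℂ (b i) (b i)) D := by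
  classical
  induction s using Finset.induction_on with
  | empty => exact ⟨1, hp1, by simpa using isQuasiFree_half hZ⟩
  | insert k s hk ih =>
    obtain ⟨D, hDp, hD⟩ := ih
    set Q := (1 / 2 : ℂ) • (1 : V →L[ℂ] V) +
      ∑ i ∈ s, ((q i : ℂ) - 1 / 2) • InnerProductSpace.rankOne ℂ (b i) (b i) with hQ
    have hQx : Q (b k) = (1 / 2 : ℂ) • b k := by
      have h0 : ∀ i ∈ s, ⟪b i, b k⟫_ℂ = 0 := fun i hi => by
        rw [b.inner_eq_zero]
        rintro rfl
        exact hk hi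
      simp only [hQ, add_apply, smul_apply,
        one_apply_eq_self, sum_apply,
        InnerProductSpace.rankOne_apply, add_eq_left]
      exact Finset.sum_eq_zero fun i hi => by simp [h0 i hi]
    have hsa : ∀ φ ψ, ⟪Q φ, ψ⟫_ℂ = ⟪φ, Q ψ⟫_ℂ := by
      intro φ ψ
      simp only [hQ, add_apply, smul_apply,
        one_apply_eq_self, sum_apply,
        InnerProductSpace.rankOne_apply, inner_add_left, inner_add_right, inner_smul_left,
        inner_smul_right, sum_inner, inner_sum, inner_conj_symm, map_sub, Complex.conj_ofReal,
        map_div₀, map_one, map_ofNat]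
      congr 1
      exact Finset.sum_congr rfl fun i _ => by ring
    have hD' := hD.update hZ hsa (b.orthonormal.1 k) hQx (hq0 k) (hq1 k)
    have hDn : occ Z (b k) * D = D * occ Z (b k) := by
      have hDa : D * star (Z (b k)) = star (Z (b k)) * D := by
        have h := hD.exchange (b k)
        have h1 : b k - (1 / 2 : ℂ) • b k = (1 / 2 : ℂ) • b k := by module
        rw [hQx, h1, ← starField_apply, map_smul, mul_smul_comm, smul_mul_assoc] at h
        exact smul_right_injective _ (by norm_num) h
      have hDz : D * Z (b k) = Z (b k) * D := by
        have := congrArg star hDa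
        simpa [star_eq_of_isPositive hD.isPositive] using this.symm
      rw [occ, ← mul_assoc, hDa, mul_assoc, mul_assoc, hDz]
    refine ⟨_, ?_, by
      rw [Finset.sum_insert hk, add_comm (_ • _) (∑ i ∈ s, _), ← add_assoc]; exact hD'⟩
    rw [mul_add, mul_smul_comm, mul_smul_comm, mul_sub, mul_one, ← hDn]
    have := hp (b k) D hDp
    exact p.add_mem (p.smul_mem _ this) (p.smul_mem _ (p.sub_mem hDp this))

theorem exists_isQuasiFree_zero_mem (p : Submodule ℂ (Module.End ℂ K))
    (hp1 : 1 ∈ p) (hp : ∀ x, ∀ T ∈ p, occ Z x * T ∈ p) :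
    ∃ D ∈ p, IsQuasiFree Z (0 : V →L[ℂ] V) D := by
  obtain ⟨D, hDp, hD⟩ := exists_isQuasiFree_diagonal hZ (stdOrthonormalBasis ℂ V)
    (fun _ => 0) (fun _ => le_rfl) (fun _ => zero_le_one) p hp1 hp Finset.univ
  refine ⟨D, hDp, ?_⟩
  convert hD using 1
  ext ψ
  simp only [add_apply, smul_apply,
    one_apply_eq_self, sum_apply,
    InnerProductSpace.rankOne_apply, ← Finset.smul_sum, OrthonormalBasis.sum_repr']
  simp

omit hZ [FiniteDimensional ℂ V] in
theorem sum_rankOne_eq_one {ι : Type*} [Fintype ι] (b : OrthonormalBasis ι ℂ V) :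
    ∑ i, InnerProductSpace.rankOne ℂ (b i) (b i) = 1 := by
  ext x
  simp [b.sum_repr' x]

omit hZ in
theorem exists_eq_sum_rankOne [CompleteSpace V] {Q : V →L[ℂ] V} (hQ0 : 0 ≤ Q) (hQ1 : Q ≤ 1) :
    ∃ (b : OrthonormalBasis (Fin (Module.finrank ℂ V)) ℂ V) (q : Fin (Module.finrank ℂ V) → ℝ),
      (∀ i, 0 ≤ q i) ∧ (∀ i, q i ≤ 1) ∧
        Q = ∑ i, (q i : ℂ) • InnerProductSpace.rankOne ℂ (b i) (b i) := by
  rw [ContinuousLinearMap.nonneg_iff_isPositive] at hQ0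
  rw [ContinuousLinearMap.le_def] at hQ1
  have hs := hQ0.isSymmetric
  set b := hs.eigenvectorBasis rfl with hb
  set q := hs.eigenvalues rfl with hq
  have happ : ∀ i, Q (b i) = (q i : ℂ) • b i := fun i => hs.apply_eigenvectorBasis rfl i
  have hin : ∀ i, ⟪b i, Q (b i)⟫_ℂ = (q i : ℂ) := fun i => by
    rw [happ, inner_smul_right, inner_self_eq_norm_sq_to_K, b.orthonormal.1 i]
    simp
  refine ⟨b, q, fun i => ?_, fun i => ?_, ?_⟩
  · have := hQ0.inner_nonneg_right (b i)
    rw [hin] at this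
    exact_mod_cast this
  · have := hQ1.inner_nonneg_right (b i)
    rw [sub_apply, inner_sub_right, hin, one_apply_eq_self,
      inner_self_eq_norm_sq_to_K, b.orthonormal.1 i] at this
    have h2 : (0 : ℂ) ≤ ((1 - q i : ℝ) : ℂ) := by simpa using this
    have h3 : 0 ≤ 1 - q i := by exact_mod_cast h2
    linarith
  · refine ContinuousLinearMap.coe_injective (b.toBasis.ext fun i => ?_)
    simp only [OrthonormalBasis.coe_toBasis, ContinuousLinearMap.coe_coe, sum_apply, smul_apply,
      InnerProductSpace.rankOne_apply, happ]
    rw [Finset.sum_eq_single i (fun k _ hk => by rw [b.inner_eq_zero hk]; simp)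
      (fun h => absurd (Finset.mem_univ _) h), inner_self_eq_norm_sq_to_K, b.orthonormal.1 i]
    simp

theorem exists_isQuasiFree [CompleteSpace V] {Q : V →L[ℂ] V} (hQ0 : 0 ≤ Q) (hQ1 : Q ≤ 1) :
    ∃ D, IsQuasiFree Z Q D := by
  obtain ⟨b, q, h0, h1, rfl⟩ := exists_eq_sum_rankOne hQ0 hQ1
  obtain ⟨D, -, hD⟩ := exists_isQuasiFree_diagonal hZ b q h0 h1 ⊤ trivial
    (fun _ _ _ => trivial) Finset.univ
  refine ⟨D, ?_⟩
  convert hD using 1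
  simp only [sub_smul, Finset.sum_sub_distrib, ← Finset.smul_sum, sum_rankOne_eq_one b]
  abel

end Existence

end Occupation

/-! ### Irreducibility: normally ordered monomials span all operators -/

section Irreducible

variable {V K : Type*} [NormedAddCommGroup V] [InnerProductSpace ℂ V]
  [NormedAddCommGroup K] [InnerProductSpace ℂ K] [FiniteDimensional ℂ K]
  {Z : V →ₗ⋆[ℂ] Module.End ℂ K}

variable (Z) in
/-- The span of the normally ordered monomials `Z*(v₁) ⋯ Z*(v_m) Z(w_n) ⋯ Z(w₁)`. -/
def monomialSpan : Submodule ℂ (Module.End ℂ K) :=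
  Submodule.span ℂ {T | ∃ (m n : ℕ) (v : Fin m → V) (w : Fin n → V),
    T = creation Z v * star (creation Z w)}

theorem creation_cons {m : ℕ} (ψ : V) (v : Fin m → V) :
    creation Z (Fin.cons ψ v : Fin (m + 1) → V) = star (Z ψ) * creation Z v := by
  rw [creation_succ]
  simp

theorem monomial_mem {m n : ℕ} (v : Fin m → V) (w : Fin n → V) :
    creation Z v * star (creation Z w) ∈ monomialSpan Z :=
  Submodule.subset_span ⟨m, n, v, w, rfl⟩

theorem one_mem_monomialSpan : (1 : Module.End ℂ K) ∈ monomialSpan Z := by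
  have := monomial_mem (Z := Z) (Fin.elim0 : Fin 0 → V) (Fin.elim0 : Fin 0 → V)
  simpa using this

theorem star_mul_mem_monomialSpan (ψ : V) {T : Module.End ℂ K} (hT : T ∈ monomialSpan Z) :
    star (Z ψ) * T ∈ monomialSpan Z := by
  induction hT using Submodule.span_induction with
  | mem x hx =>
    obtain ⟨m, n, v, w, rfl⟩ := hx
    rw [← mul_assoc, ← creation_cons]
    exact monomial_mem _ _
  | zero => simp
  | add x y _ _ hx hy => rw [mul_add]; exact add_mem hx hy
  | smul c x _ hx => rw [mul_smul_comm]; exact Submodule.smul_mem _ _ hx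

theorem star_mem_monomialSpan {T : Module.End ℂ K} (hT : T ∈ monomialSpan Z) :
    star T ∈ monomialSpan Z := by
  induction hT using Submodule.span_induction with
  | mem x hx =>
    obtain ⟨m, n, v, w, rfl⟩ := hx
    rw [star_mul, star_star]
    exact monomial_mem _ _
  | zero => simp
  | add x y _ _ hx hy => rw [star_add]; exact add_mem hx hy
  | smul c x _ hx => rw [star_smul]; exact Submodule.smul_mem _ _ hx

theorem creation_mul_mem {p : Submodule ℂ (Module.End ℂ K)}
    (hp : ∀ ψ, ∀ T ∈ p, star (Z ψ) * T ∈ p) {T : Module.End ℂ K} (hT : T ∈ p)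
    {m : ℕ} (v : Fin m → V) : creation Z v * T ∈ p := by
  induction m with
  | zero => simpa
  | succ m ih =>
    rw [creation_succ, mul_assoc]
    exact hp _ _ (ih _)

variable (hZ : IsCARField Z)
include hZ

theorem Z_mul_creation_mul_mem {p : Submodule ℂ (Module.End ℂ K)}
    (hp : ∀ ψ, ∀ T ∈ p, star (Z ψ) * T ∈ p) {T : Module.End ℂ K} (hT : T ∈ p)
    (hZT : ∀ ψ, Z ψ * T ∈ p) {m : ℕ} (v : Fin m → V) (ψ : V) :
    Z ψ * (creation Z v * T) ∈ p := by
  induction m with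
  | zero => simpa using hZT ψ
  | succ m ih =>
    rw [creation_succ, mul_assoc, ← mul_assoc, eq_sub_of_add_eq (hZ.anticomm_star ψ (v 0)),
      sub_mul, smul_mul_assoc, one_mul, mul_assoc]
    exact p.sub_mem (p.smul_mem _ (creation_mul_mem hp hT _)) (hp _ _ (ih _))

theorem Z_mul_mem_monomialSpan (ψ : V) {T : Module.End ℂ K} (hT : T ∈ monomialSpan Z) :
    Z ψ * T ∈ monomialSpan Z := by
  induction hT using Submodule.span_induction with
  | mem x hx =>
    obtain ⟨m, n, v, w, rfl⟩ := hx
    have h1 : ∀ {k : ℕ} (u : Fin k → V), star (creation Z u) ∈ monomialSpan Z := fun u => by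
      simpa using monomial_mem (Z := Z) (Fin.elim0 : Fin 0 → V) u
    refine Z_mul_creation_mul_mem hZ (fun ψ T hT => star_mul_mem_monomialSpan ψ hT) (h1 w)
      (fun φ => ?_) v ψ
    have h2 : Z φ * star (creation Z w) = star (creation Z w * star (Z φ)) := by simp
    rw [h2, creation_mul_star hZ, star_smul, ← creation_cons]
    exact Submodule.smul_mem _ _ (h1 _)
  | zero => simp
  | add x y _ _ hx hy => rw [mul_add]; exact add_mem hx hy
  | smul c x _ hx => rw [mul_smul_comm]; exact Submodule.smul_mem _ _ hx

/-- For an irreducible field a vector that is annihilated by all the `Z(ψ)` is cyclic for the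
creation operators. -/
theorem span_creation_apply (hirr : IsIrreducibleField Z) {η : K} (hη : η ≠ 0)
    (hvac : ∀ ψ, Z ψ η = 0) (x : K) :
    x ∈ Submodule.span ℂ {y | ∃ (m : ℕ) (v : Fin m → V), y = creation Z v η} := by
  set q := Submodule.span ℂ {y | ∃ (m : ℕ) (v : Fin m → V), y = creation Z v η} with hq
  have hstar : ∀ ψ, ∀ y ∈ q, star (Z ψ) y ∈ q := by
    intro ψ y hy
    induction hy using Submodule.span_induction with
    | mem x hx =>
      obtain ⟨m, v, rfl⟩ := hx
      exact Submodule.subset_span ⟨m + 1, Fin.cons ψ v, by rw [creation_cons]; rfl⟩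
    | zero => simp
    | add x y _ _ hx hy => rw [map_add]; exact add_mem hx hy
    | smul c x _ hx => rw [map_smul]; exact Submodule.smul_mem _ _ hx
  have hηq : η ∈ q := Submodule.subset_span ⟨0, Fin.elim0, by simp⟩
  have hZq : ∀ ψ, ∀ y ∈ q, Z ψ y ∈ q := by
    intro ψ y hy
    induction hy using Submodule.span_induction with
    | mem x hx =>
      obtain ⟨m, v, rfl⟩ := hx
      have := Z_mul_creation_mul_mem hZ (p := q.comap (LinearMap.applyₗ η))
        (fun ψ T hT => hstar ψ _ hT) (T := 1) hηq (fun ψ => by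
          change Z ψ η ∈ q
          rw [hvac]; exact q.zero_mem) v ψ
      simpa using this
    | zero => simp
    | add x y _ _ hx hy => rw [map_add]; exact add_mem hx hy
    | smul c x _ hx => rw [map_smul]; exact Submodule.smul_mem _ _ hx
  rcases hirr.eq_bot_or_eq_top q (fun ψ y hy => ⟨hZq ψ y hy, hstar ψ y hy⟩) with h | h
  · rw [h] at hηq
    exact absurd ((Submodule.mem_bot ℂ).1 hηq) hη
  · rw [h]; trivial

omit hZ in
theorem IsQuasiFree.Z_mul_vacuum {D : Module.End ℂ K} (hD : IsQuasiFree Z (0 : V →L[ℂ] V) D)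
    (ψ : V) : Z ψ * D = 0 := by
  have h := hD.exchange ψ
  simp only [zero_apply, sub_zero, map_zero, star_zero, zero_mul] at h
  simpa [star_eq_of_isPositive hD.isPositive] using congrArg star h

theorem monomialSpan_eq_top [FiniteDimensional ℂ V] (hirr : IsIrreducibleField Z) :
    monomialSpan Z = ⊤ := by
  have := hirr.nontrivial
  obtain ⟨D, hDp, hD⟩ := exists_isQuasiFree_zero_mem hZ (monomialSpan Z) one_mem_monomialSpan
    (fun x T hT => by
      rw [occ, mul_assoc]
      exact star_mul_mem_monomialSpan _ (Z_mul_mem_monomialSpan hZ _ hT))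
  have hDs := star_eq_of_isPositive hD.isPositive
  have hZD := hD.Z_mul_vacuum
  have hDZ : ∀ ψ, D * star (Z ψ) = 0 := fun ψ => by
    simpa [hDs] using congrArg star (hZD ψ)
  have hD0 : D ≠ 0 := by
    rintro rfl
    simpa using hD.tau_eq_one
  obtain ⟨x₀, hx₀⟩ : ∃ x, D x ≠ 0 := by
    by_contra! h
    exact hD0 (LinearMap.ext h)
  -- `D` maps onto a line of vacuum vectors
  set η := D x₀ with hη
  have hvac : ∀ ψ, Z ψ η = 0 := fun ψ => LinearMap.congr_fun (hZD ψ) x₀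
  have hspan := span_creation_apply hZ hirr hx₀ hvac
  have hline : ∀ y, ∃ c : ℂ, D y = c • D η := by
    intro y
    have hy := hspan y
    induction hy using Submodule.span_induction with
    | mem x hx =>
      obtain ⟨m, v, rfl⟩ := hx
      cases m with
      | zero => exact ⟨1, by simp⟩
      | succ m =>
        refine ⟨0, ?_⟩
        rw [creation_succ, ← Module.End.mul_apply, ← mul_assoc, hDZ]
        simp
    | zero => exact ⟨0, by simp⟩
    | add x y _ _ hx hy =>
      obtain ⟨a, ha⟩ := hx
      obtain ⟨b, hb⟩ := hy
      exact ⟨a + b, by rw [map_add, ha, hb, add_smul]⟩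
    | smul c x _ hx =>
      obtain ⟨a, ha⟩ := hx
      exact ⟨c * a, by rw [map_smul, ha, smul_smul]⟩
  obtain ⟨c₀, hc₀⟩ := hline x₀
  rw [← hη] at hc₀
  have hsym : ∀ x y, ⟪D x, y⟫_ℂ = ⟪x, D y⟫_ℂ := hD.isPositive.isSymmetric
  have hc₀0 : c₀ ≠ 0 := by
    rintro rfl
    rw [zero_smul] at hc₀
    exact hx₀ hc₀
  have hηη : ⟪η, η⟫_ℂ ≠ 0 := inner_self_ne_zero.2 hx₀
  -- hence it is a multiple of a rank one operator
  have hrank : ∃ a : ℂ, a ≠ 0 ∧ D = a • ketbra η η := by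
    have hDη : D η = c₀⁻¹ • η := by
      rw [eq_inv_smul_iff₀ hc₀0, ← hc₀]
    refine ⟨c₀⁻¹ * (⟪η, η⟫_ℂ)⁻¹, mul_ne_zero (inv_ne_zero hc₀0) (inv_ne_zero hηη), ?_⟩
    ext y
    obtain ⟨c, hc⟩ := hline y
    have h1 := hsym η y
    rw [hc, hDη, smul_smul, inner_smul_left, inner_smul_right] at h1
    have h2 : (starRingEnd ℂ) c₀⁻¹ = c₀⁻¹ := by
      have h3 := hsym η η
      rw [hDη, inner_smul_left, inner_smul_right] at h3
      exact mul_right_cancel₀ hηη h3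
    rw [h2] at h1
    rw [hc, hDη, LinearMap.smul_apply, ketbra_apply, smul_smul, smul_smul]
    congr 1
    field_simp
    field_simp at h1
    rw [h1]
  obtain ⟨a, ha, hDa⟩ := hrank
  have hket : ketbra η η ∈ monomialSpan Z := by
    have : ketbra η η = a⁻¹ • D := by rw [hDa, smul_smul, inv_mul_cancel₀ ha, one_smul]
    rw [this]
    exact Submodule.smul_mem _ _ hDp
  have hket1 : ∀ x, ketbra x η ∈ monomialSpan Z := by
    intro x
    have hx := hspan x
    induction hx using Submodule.span_induction with
    | mem x hx =>
      obtain ⟨m, v, rfl⟩ := hx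
      rw [← mul_ketbra]
      exact creation_mul_mem (fun ψ T hT => star_mul_mem_monomialSpan ψ hT) hket v
    | zero => simp [ketbra]
    | add x y _ _ hx hy =>
      have : ketbra (x + y) η = ketbra x η + ketbra y η := by ext; simp
      rw [this]; exact add_mem hx hy
    | smul c x _ hx =>
      have : ketbra (c • x) η = c • ketbra x η := by ext; simp [smul_comm c]
      rw [this]; exact Submodule.smul_mem _ _ hx
  have hket2 : ∀ y x, ketbra x y ∈ monomialSpan Z := by
    intro y x
    have h1 : ketbra y x ∈ monomialSpan Z := by
      have hy := hspan y
      induction hy using Submodule.span_induction with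
      | mem y hy =>
        obtain ⟨m, v, rfl⟩ := hy
        rw [← mul_ketbra]
        refine creation_mul_mem (fun ψ T hT => star_mul_mem_monomialSpan ψ hT) ?_ v
        rw [← star_ketbra]
        exact star_mem_monomialSpan (hket1 x)
      | zero => simp [ketbra]
      | add y z _ _ hy hz =>
        have : ketbra (y + z) x = ketbra y x + ketbra z x := by ext; simp
        rw [this]; exact add_mem hy hz
      | smul c y _ hy =>
        have : ketbra (c • y) x = c • ketbra y x := by ext; simp [smul_comm c]
        rw [this]; exact Submodule.smul_mem _ _ hy
    rw [← star_ketbra]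
    exact star_mem_monomialSpan h1
  rw [eq_top_iff]
  intro X _
  rw [sum_ketbra X (stdOrthonormalBasis ℂ K)]
  exact Submodule.sum_mem _ fun i _ => hket2 _ _

/-- For an irreducible field, an operator is determined by its moments. -/
theorem eq_of_moments [FiniteDimensional ℂ V] (hirr : IsIrreducibleField Z)
    {X Y : Module.End ℂ K}
    (h : ∀ (m n : ℕ) (v : Fin m → V) (w : Fin n → V),
      tau (X * (creation Z v * star (creation Z w))) =
        tau (Y * (creation Z v * star (creation Z w)))) : X = Y := by
  refine eq_of_tau_mul fun T => ?_
  have hT : T ∈ monomialSpan Z := by rw [monomialSpan_eq_top hZ hirr]; trivial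
  induction hT using Submodule.span_induction with
  | mem x hx => obtain ⟨m, n, v, w, rfl⟩ := hx; exact h m n v w
  | zero => simp
  | add x y _ _ hx hy => rw [mul_add, mul_add, map_add, map_add, hx, hy]
  | smul c x _ hx => rw [mul_smul_comm, mul_smul_comm, map_smul, map_smul, hx]

/-! ### Uniqueness and symbols of Gaussian states -/

omit [FiniteDimensional ℂ K] hZ in
theorem nonneg_of_forall_inner {A : V →L[ℂ] V} (h : ∀ x, 0 ≤ ⟪x, A x⟫_ℂ) : 0 ≤ A := by
  rw [ContinuousLinearMap.nonneg_iff_isPositive, ContinuousLinearMap.isPositive_iff_complex]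
  intro x
  have h1 : 0 ≤ ⟪A x, x⟫_ℂ := by
    rw [← inner_conj_symm]
    exact star_nonneg_iff.2 (h x)
  rw [Complex.le_def] at h1
  exact ⟨Complex.ext (by simp) (by simpa using h1.2), by simpa using h1.1⟩

theorem IsGaussianWithSymbol.unique [FiniteDimensional ℂ V] (hirr : IsIrreducibleField Z)
    {Q : V →L[ℂ] V} {D D' : Module.End ℂ K} (hD : IsGaussianWithSymbol Z Q D)
    (hD' : IsGaussianWithSymbol Z Q D') : D = D' := by
  refine eq_of_moments hZ hirr fun m n v w => ?_
  rcases eq_or_ne m n with rfl | hmn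
  · rw [star_creation, creation, hD.moment_eq_det, hD'.moment_eq_det]
  · rw [star_creation, creation, hD.moment_of_ne _ _ _ _ hmn, hD'.moment_of_ne _ _ _ _ hmn]

omit hZ in
theorem IsGaussianWithSymbol.nonneg {Q : V →L[ℂ] V} {D : Module.End ℂ K}
    (hD : IsGaussianWithSymbol Z Q D) : 0 ≤ Q := by
  refine nonneg_of_forall_inner fun x => ?_
  have h : 0 ≤ ⟪x, Q x⟫_ℂ := by
    rw [hD.symbol, ← mul_assoc, tau_mul_comm, ← mul_assoc]
    simpa using tau_nonneg (isPositive_conj hD.isPositive (star (Z x)))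
  exact h

theorem IsGaussianWithSymbol.le_one {Q : V →L[ℂ] V} {D : Module.End ℂ K}
    (hD : IsGaussianWithSymbol Z Q D) : Q ≤ 1 := by
  rw [ContinuousLinearMap.le_def, ← ContinuousLinearMap.nonneg_iff_isPositive]
  refine nonneg_of_forall_inner fun x => ?_
  have h : 0 ≤ ⟪x, (1 - Q) x⟫_ℂ := by
    have h1 : ⟪x, (1 - Q) x⟫_ℂ = tau (D * (Z x * star (Z x))) := by
      rw [eq_sub_of_add_eq (hZ.anticomm_star x x), mul_sub, map_sub, ← hD.symbol, mul_smul_comm,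
        mul_one, map_smul, hD.tau_eq_one, sub_apply, inner_sub_right, one_apply_eq_self]
      simp
    rw [h1, ← mul_assoc, tau_mul_comm, ← mul_assoc]
    exact tau_nonneg (isPositive_conj hD.isPositive (Z x))
  exact h

variable [FiniteDimensional ℂ V] [CompleteSpace V]

theorem isQuasiFree_gaussianDensity (hirr : IsIrreducibleField Z) {Q : V →L[ℂ] V} (hQ0 : 0 ≤ Q)
    (hQ1 : Q ≤ 1) : IsQuasiFree Z Q (gaussianDensity Z Q) := by
  have := hirr.nontrivial
  obtain ⟨D, hD⟩ := exists_isQuasiFree hZ hQ0 hQ1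
  have h : ∃ D, IsGaussianWithSymbol Z Q D := ⟨D, hD.isGaussianWithSymbol hZ⟩
  have h1 : gaussianDensity Z Q = D := by
    rw [gaussianDensity, dif_pos h]
    exact h.choose_spec.unique hZ hirr (hD.isGaussianWithSymbol hZ)
  rwa [h1]

theorem IsGaussianWithSymbol.eq_gaussianDensity (hirr : IsIrreducibleField Z) {Q : V →L[ℂ] V}
    {D : Module.End ℂ K} (hD : IsGaussianWithSymbol Z Q D) : D = gaussianDensity Z Q :=
  hD.unique hZ hirr
    ((isQuasiFree_gaussianDensity hZ hirr hD.nonneg (hD.le_one hZ)).isGaussianWithSymbol hZ)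

theorem isGIGState_iff (hirr : IsIrreducibleField Z) {D : Module.End ℂ K} :
    IsGIGState Z D ↔ ∃ Q : V →L[ℂ] V, 0 ≤ Q ∧ Q ≤ 1 ∧ D = gaussianDensity Z Q := by
  constructor
  · rintro ⟨Q, hQ⟩
    exact ⟨Q, hQ.nonneg, hQ.le_one hZ, hQ.eq_gaussianDensity hZ hirr⟩
  · rintro ⟨Q, h0, h1, rfl⟩
    exact ⟨Q, (isQuasiFree_gaussianDensity hZ hirr h0 h1).isGaussianWithSymbol hZ⟩

end Irreducible

/-! ### The gauge group and the parity operator -/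

section Gauge

variable {V K : Type*} [NormedAddCommGroup V] [InnerProductSpace ℂ V] [FiniteDimensional ℂ V]
  [NormedAddCommGroup K] [InnerProductSpace ℂ K] [FiniteDimensional ℂ K]
  {Z : V →ₗ⋆[ℂ] Module.End ℂ K}

omit [FiniteDimensional ℂ K] in
theorem coe_mul_clm (X Y : K →L[ℂ] K) :
    ((X * Y : K →L[ℂ] K) : Module.End ℂ K) = (X : Module.End ℂ K) * (Y : Module.End ℂ K) := rfl

theorem toCLM_mul (X Y : Module.End ℂ K) :
    LinearMap.toContinuousLinearMap (X * Y) =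
      LinearMap.toContinuousLinearMap X * LinearMap.toContinuousLinearMap Y := rfl

theorem star_coe_clm (X : K →L[ℂ] K) :
    ((star X : K →L[ℂ] K) : Module.End ℂ K) = star (X : Module.End ℂ K) := by
  rw [LinearMap.star_eq_adjoint, LinearMap.eq_adjoint_iff]
  intro x y
  exact ContinuousLinearMap.adjoint_inner_left X y x

variable (Z) in
theorem gaugeUnitary_zero : gaugeUnitary Z 0 = 1 := by
  simp [gaugeUnitary, NormedSpace.exp_zero]

variable (Z) in
theorem gaugeUnitary_add (s t : ℝ) :
    gaugeUnitary Z (s + t) = gaugeUnitary Z s * gaugeUnitary Z t := by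
  let := NormedAlgebra.restrictScalars ℚ ℂ (K →L[ℂ] K)
  rw [gaugeUnitary, gaugeUnitary, gaugeUnitary, ← coe_mul_clm, ← NormedSpace.exp_add_of_commute]
  · push_cast
    rw [add_mul, add_smul]
  · exact (Commute.refl _).smul_left _ |>.smul_right _

theorem gaugeUnitary_mul_neg (t : ℝ) : gaugeUnitary Z t * gaugeUnitary Z (-t) = 1 := by
  rw [← gaugeUnitary_add, add_neg_cancel, gaugeUnitary_zero]

theorem gaugeUnitary_neg_mul (t : ℝ) : gaugeUnitary Z (-t) * gaugeUnitary Z t = 1 := by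
  rw [← gaugeUnitary_add, neg_add_cancel, gaugeUnitary_zero]

theorem star_gaugeUnitary (t : ℝ) : star (gaugeUnitary Z t) = gaugeUnitary Z (-t) := by
  rw [gaugeUnitary, gaugeUnitary, ← star_coe_clm, NormedSpace.star_exp, star_smul]
  have h : star (LinearMap.toContinuousLinearMap (numberOp Z)) =
      LinearMap.toContinuousLinearMap (numberOp Z) := by
    refine ContinuousLinearMap.coe_injective ?_
    rw [star_coe_clm]
    exact star_numberOp
  rw [h]
  simp

theorem gaugeUnitary_comm {X : Module.End ℂ K} (h : X * numberOp Z = numberOp Z * X) (t : ℝ) :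
    X * gaugeUnitary Z t = gaugeUnitary Z t * X := by
  let := NormedAlgebra.restrictScalars ℚ ℂ (K →L[ℂ] K)
  have h1 : Commute (LinearMap.toContinuousLinearMap X)
      (LinearMap.toContinuousLinearMap (numberOp Z)) := by
    rw [Commute, SemiconjBy, ← toCLM_mul, h, toCLM_mul]
  have h2 := ((h1.smul_right ((t : ℂ) * Complex.I)).exp_right).eq
  have := congrArg (fun T : K →L[ℂ] K => (T : Module.End ℂ K)) h2
  exact this

variable (hZ : IsCARField Z)
include hZ

theorem Z_mul_gaugeUnitary (t : ℝ) (ψ : V) :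
    Z ψ * gaugeUnitary Z t = Complex.exp (t * Complex.I) • (gaugeUnitary Z t * Z ψ) := by
  let := NormedAlgebra.restrictScalars ℚ ℂ (K →L[ℂ] K)
  set N := LinearMap.toContinuousLinearMap (numberOp Z) with hN
  set A := LinearMap.toContinuousLinearMap (Z ψ) with hA
  have hNA : N * A = A * N - A := by
    rw [hN, hA, ← toCLM_mul, numberOp_mul hZ, map_sub, toCLM_mul]
  have h1 : SemiconjBy A (((t : ℂ) * Complex.I) • N)
      (((t : ℂ) * Complex.I) • N + algebraMap ℂ (K →L[ℂ] K) ((t : ℂ) * Complex.I)) := by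
    rw [SemiconjBy, Algebra.algebraMap_eq_smul_one, add_mul, smul_mul_assoc, smul_mul_assoc,
      mul_smul_comm, hNA, one_mul, ← smul_add, sub_add_cancel]
  have h2 := h1.exp_right
  rw [NormedSpace.exp_add_of_commute (Algebra.commutes' _ _).symm,
    ← NormedSpace.algebraMap_exp_comm, Algebra.algebraMap_eq_smul_one, ← Complex.exp_eq_exp_ℂ,
    mul_smul_comm, mul_one, SemiconjBy, smul_mul_assoc] at h2
  exact congrArg (fun T : K →L[ℂ] K => (T : Module.End ℂ K)) h2

theorem star_mul_gaugeUnitary (t : ℝ) (ψ : V) :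
    star (Z ψ) * gaugeUnitary Z t =
      Complex.exp (-(t * Complex.I)) • (gaugeUnitary Z t * star (Z ψ)) := by
  have h := congrArg star (Z_mul_gaugeUnitary hZ (-t) ψ)
  rw [star_smul, star_mul, star_mul, star_gaugeUnitary, neg_neg] at h
  rw [h, smul_smul]
  have : Complex.exp (-(t * Complex.I)) * star (Complex.exp ((-t : ℝ) * Complex.I)) = 1 := by
    rw [RCLike.star_def, ← Complex.exp_conj, ← Complex.exp_add]
    simp
  rw [this, one_smul]

theorem parityOp_mul_Z (ψ : V) : parityOp Z * Z ψ = -(Z ψ * parityOp Z) := by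
  rw [parityOp, Z_mul_gaugeUnitary hZ, Complex.exp_pi_mul_I]
  simp

theorem parityOp_mul_star (ψ : V) : parityOp Z * star (Z ψ) = -(star (Z ψ) * parityOp Z) := by
  rw [parityOp, star_mul_gaugeUnitary hZ, Complex.exp_neg, Complex.exp_pi_mul_I]
  simp

omit [FiniteDimensional ℂ V] in
theorem exp_two_pi_occ {x : V} (hx : ‖x‖ = 1) :
    NormedSpace.exp ((2 * Real.pi * Complex.I : ℂ) • LinearMap.toContinuousLinearMap (occ Z x))
      = 1 := by
  let := NormedAlgebra.restrictScalars ℚ ℂ (K →L[ℂ] K)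
  set n := LinearMap.toContinuousLinearMap (occ Z x) with hn
  have hnn : n * n = n := by rw [hn, ← toCLM_mul, occ_mul_self hZ hx]
  set c : ℂ := 2 * Real.pi * Complex.I with hc
  have h1 : SemiconjBy n (algebraMap ℂ (K →L[ℂ] K) c) (c • n) := by
    rw [SemiconjBy, Algebra.algebraMap_eq_smul_one, smul_mul_assoc, mul_smul_comm, hnn, mul_one]
  have h2 : SemiconjBy (1 - n) 0 (c • n) := by
    rw [SemiconjBy, mul_zero, smul_mul_assoc, mul_sub, hnn]
    simp
  have h3 := h1.exp_right
  have h4 := h2.exp_right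
  rw [← NormedSpace.algebraMap_exp_comm, ← Complex.exp_eq_exp_ℂ, hc, Complex.exp_two_pi_mul_I,
    map_one, SemiconjBy, mul_one] at h3
  rw [NormedSpace.exp_zero, SemiconjBy, mul_one] at h4
  calc NormedSpace.exp (c • n) = NormedSpace.exp (c • n) * n +
        NormedSpace.exp (c • n) * (1 - n) := by rw [← mul_add, add_sub_cancel, mul_one]
    _ = 1 := by rw [← h3, ← h4, add_sub_cancel]

/-- The number operator has integer spectrum: it is a sum of commuting projections. -/
theorem gaugeUnitary_two_pi : gaugeUnitary Z (2 * Real.pi) = 1 := by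
  let := NormedAlgebra.restrictScalars ℚ ℂ (K →L[ℂ] K)
  have h1 : ((2 * Real.pi : ℝ) * Complex.I : ℂ) • LinearMap.toContinuousLinearMap (numberOp Z) =
      ∑ j, (2 * Real.pi * Complex.I : ℂ) •
        LinearMap.toContinuousLinearMap (occ Z (stdOrthonormalBasis ℂ V j)) := by
    rw [numberOp, map_sum, Finset.smul_sum]
    push_cast
    rfl
  have hcomm : ∀ i j, i ≠ j → Commute
      ((2 * Real.pi * Complex.I : ℂ) •
        LinearMap.toContinuousLinearMap (occ Z (stdOrthonormalBasis ℂ V i)))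
      ((2 * Real.pi * Complex.I : ℂ) •
        LinearMap.toContinuousLinearMap (occ Z (stdOrthonormalBasis ℂ V j))) := by
    intro i j hij
    refine (Commute.smul_left ?_ _).smul_right _
    have h0 := (stdOrthonormalBasis ℂ V).inner_eq_zero hij
    rw [Commute, SemiconjBy, ← toCLM_mul, ← toCLM_mul]
    congr 1
    conv_lhs => rw [occ.eq_1 Z (stdOrthonormalBasis ℂ V j), ← mul_assoc,
      occ_mul_star_of_inner_eq_zero hZ h0, mul_assoc, occ_mul_Z_of_inner_eq_zero hZ h0, ← mul_assoc]
    rfl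
  have key : ∀ s : Finset (Fin (Module.finrank ℂ V)), NormedSpace.exp
      (∑ j ∈ s, (2 * Real.pi * Complex.I : ℂ) •
        LinearMap.toContinuousLinearMap (occ Z (stdOrthonormalBasis ℂ V j))) = 1 := by
    intro s
    induction s using Finset.induction_on with
    | empty => rw [Finset.sum_empty, NormedSpace.exp_zero]
    | insert a s ha ih =>
      rw [Finset.sum_insert ha, NormedSpace.exp_add_of_commute, ih,
        exp_two_pi_occ hZ ((stdOrthonormalBasis ℂ V).orthonormal.1 a), one_mul]
      exact Commute.sum_right _ _ _ fun i hi => hcomm _ _ (by rintro rfl; exact ha hi)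
  rw [gaugeUnitary, h1, key]
  rfl

theorem parityOp_mul_self : parityOp Z * parityOp Z = 1 := by
  rw [parityOp, ← gaugeUnitary_add, ← two_mul, gaugeUnitary_two_pi hZ]

theorem star_parityOp : star (parityOp Z) = parityOp Z := by
  have h : star (parityOp Z) * parityOp Z = 1 := by
    rw [parityOp, star_gaugeUnitary, gaugeUnitary_neg_mul]
  calc star (parityOp Z) = star (parityOp Z) * (parityOp Z * parityOp Z) := by
        rw [parityOp_mul_self hZ, mul_one]
    _ = parityOp Z := by rw [← mul_assoc, h, one_mul]

end Gauge

/-! ### Gaussian states span the Araki–Wyss algebra -/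

section Span

variable {V K : Type*} [NormedAddCommGroup V] [InnerProductSpace ℂ V] [FiniteDimensional ℂ V]
  [NormedAddCommGroup K] [InnerProductSpace ℂ K] [FiniteDimensional ℂ K]
  {Z : V →ₗ⋆[ℂ] Module.End ℂ K}

theorem mem_arakiWyss_iff {X : Module.End ℂ K} :
    X ∈ arakiWyss Z ↔ X * numberOp Z = numberOp Z * X := by
  rw [arakiWyss, Subalgebra.mem_centralizer_iff]
  simp [eq_comm]

theorem star_mem_arakiWyss {X : Module.End ℂ K} (hX : X ∈ arakiWyss Z) : star X ∈ arakiWyss Z := by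
  rw [mem_arakiWyss_iff] at hX ⊢
  simpa [star_numberOp] using (congrArg star hX).symm

variable (hZ : IsCARField Z)
include hZ

/-- The product of creation operators is an alternating function of its arguments. -/
def creationAlternating (m : ℕ) : V [⋀^Fin m]→ₗ[ℂ] Module.End ℂ K :=
  (ExteriorAlgebra.lift ℂ
    ⟨starField Z, fun x => star_Z_mul_self hZ x⟩).toLinearMap.compAlternatingMap
    (ExteriorAlgebra.ιMulti ℂ m)

omit [FiniteDimensional ℂ V] in
theorem creationAlternating_apply {m : ℕ} (v : Fin m → V) :
    creationAlternating hZ m v = creation Z v := by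
  rw [creationAlternating, LinearMap.compAlternatingMap_apply, ExteriorAlgebra.ιMulti_apply,
    AlgHom.toLinearMap_apply, map_list_prod, List.map_ofFn, creation]
  congr 2
  funext k
  exact ExteriorAlgebra.lift_ι_apply ℂ _ _ _

/-- For a linearly independent family, the product of creation operators is proportional to the
one for an orthonormal family; otherwise it vanishes. -/
theorem creation_eq_smul {m : ℕ} (v : Fin m → V) :
    creation Z v = 0 ∨ ∃ (c : ℂ) (e : Fin m → V), Orthonormal ℂ e ∧
      creation Z v = c • creation Z e := by
  by_cases hv : LinearIndependent ℂ v
  · right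
    set W := Submodule.span ℂ (Set.range v) with hW
    have hfin : Module.finrank ℂ W = m := by
      rw [hW, finrank_span_eq_card hv, Fintype.card_fin]
    set b := (stdOrthonormalBasis ℂ W).reindex (finCongr hfin) with hb
    have hvW : ∀ i, v i ∈ W := fun i => Submodule.subset_span ⟨i, rfl⟩
    set f : W [⋀^Fin m]→ₗ[ℂ] Module.End ℂ K :=
      (creationAlternating hZ m).compLinearMap W.subtype with hf
    have h1 : f = (LinearMap.toSpanSingleton ℂ _ (f b)).compAlternatingMap b.toBasis.det := by
      refine Module.Basis.ext_alternating b.toBasis fun i hi => ?_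
      let σ : Equiv.Perm (Fin m) := Equiv.ofBijective i (Finite.injective_iff_bijective.1 hi)
      change f (b ∘ σ) = b.toBasis.det (b.toBasis ∘ σ) • f b
      rw [AlternatingMap.map_perm, AlternatingMap.map_perm, Module.Basis.det_self]
      simp
    refine ⟨b.toBasis.det (fun i => ⟨v i, hvW i⟩), fun i => (b i : V), ?_, ?_⟩
    · exact b.orthonormal.comp_linearIsometry W.subtypeₗᵢ
    · rw [← creationAlternating_apply hZ, ← creationAlternating_apply hZ]
      exact congrFun (congrArg DFunLike.coe h1) (fun i => ⟨v i, hvW i⟩)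
  · left
    rw [← creationAlternating_apply hZ]
    exact AlternatingMap.map_linearDependent _ _ hv

omit hZ in
/-- Polarization: a subspace that contains the diagonal values of a sesquilinear map contains all
its values. -/
theorem mem_of_forall_diag_mem {E F : Type*} [AddCommGroup E] [Module ℂ E] [AddCommGroup F]
    [Module ℂ F] (f : E →ₗ[ℂ] E →ₗ⋆[ℂ] F) {p : Submodule ℂ F} (h : ∀ x, f x x ∈ p) (x y : E) :
    f x y ∈ p := by
  have h1 := p.sub_mem (p.sub_mem (h (x + y)) (h x)) (h y)
  have h2 := p.smul_mem Complex.I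
    (p.sub_mem (p.sub_mem (h (x + Complex.I • y)) (h x)) (h (Complex.I • y)))
  have h3 := p.smul_mem (1 / 2 : ℂ) (p.add_mem h1 h2)
  convert h3 using 1
  simp only [map_add, LinearMap.add_apply, LinearMap.map_smulₛₗ, LinearMap.smul_apply, map_smul,
    Complex.conj_I]
  match_scalars <;> ring_nf <;> simp only [Complex.I_sq] <;> norm_num

omit [FiniteDimensional ℂ V] hZ in
/-- The density matrix commutes with the creation operator of a mode whose occupation probability
is `1 / 2`. -/
theorem IsQuasiFree.mul_star_of_half {Q : V →L[ℂ] V} {D : Module.End ℂ K}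
    (hD : IsQuasiFree Z Q D) {x : V} (hQx : Q x = (1 / 2 : ℂ) • x) :
    D * star (Z x) = star (Z x) * D := by
  have h := hD.exchange x
  have h1 : x - (1 / 2 : ℂ) • x = (1 / 2 : ℂ) • x := by module
  rw [hQx, h1, ← starField_apply, map_smul, mul_smul_comm, smul_mul_assoc] at h
  exact smul_right_injective _ (by norm_num) h

/-- For an orthonormal family `e` the operator `Z*(e₁) ⋯ Z*(e_m) Z(e_m) ⋯ Z(e₁)` is a multiple of
a Gaussian density matrix: the modes in the family are occupied and the other ones are
maximally mixed. -/
theorem isQuasiFree_creation [Nontrivial K] {m : ℕ} {e : Fin m → V} (he : Orthonormal ℂ e) :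
    IsQuasiFree Z ((1 / 2 : ℂ) • (1 : V →L[ℂ] V) +
        ∑ i, (1 / 2 : ℂ) • InnerProductSpace.rankOne ℂ (e i) (e i))
      ((2 : ℂ) ^ m • (creation Z e * star (creation Z e))) := by
  induction m with
  | zero => simpa using isQuasiFree_half hZ
  | succ m ih =>
    have he' : Orthonormal ℂ (fun i : Fin m => e i.succ) := he.comp _ (Fin.succ_injective m)
    have hD := ih he'
    obtain ⟨Q, hQ⟩ : ∃ Q, Q = (1 / 2 : ℂ) • (1 : V →L[ℂ] V) +
        ∑ i : Fin m, (1 / 2 : ℂ) • InnerProductSpace.rankOne ℂ (e i.succ) (e i.succ) := ⟨_, rfl⟩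
    rw [← hQ] at hD
    have hQx : Q (e 0) = (1 / 2 : ℂ) • e 0 := by
      have h0 : ∀ i : Fin m, ⟪e i.succ, e 0⟫_ℂ = 0 := fun i => he.2 (Fin.succ_ne_zero i)
      simp [hQ, h0, sum_apply]
    have hsa : ∀ φ ψ, ⟪Q φ, ψ⟫_ℂ = ⟪φ, Q ψ⟫_ℂ := by
      intro φ ψ
      simp only [hQ, add_apply, smul_apply, one_apply_eq_self, sum_apply,
        InnerProductSpace.rankOne_apply, inner_add_left, inner_add_right, inner_smul_left,
        inner_smul_right, sum_inner, inner_sum, inner_conj_symm, map_div₀, map_one, map_ofNat]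
      congr 1
      exact Finset.sum_congr rfl fun i _ => by ring
    have h := hD.update hZ hsa (he.1 0) hQx zero_le_one le_rfl
    have hc := hD.mul_star_of_half hQx
    convert h using 1
    · rw [hQ, Fin.sum_univ_succ, add_comm (_ • InnerProductSpace.rankOne ℂ (e 0) (e 0)),
        ← add_assoc]
      norm_num
    · rw [creation_succ, star_mul, star_star]
      simp only [Complex.ofReal_one, mul_one, sub_self, zero_smul, add_zero]
      rw [mul_smul_comm, occ, ← mul_assoc (_ • _), hc, pow_succ', mul_smul]
      simp only [mul_smul_comm, smul_mul_assoc, mul_assoc]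

variable [CompleteSpace V] (hirr : IsIrreducibleField Z)
include hirr

theorem gaussianDensity_mem_arakiWyss {Q : V →L[ℂ] V} (hQ0 : 0 ≤ Q) (hQ1 : Q ≤ 1) :
    gaussianDensity Z Q ∈ arakiWyss Z := by
  rw [mem_arakiWyss_iff]
  have hD := (isQuasiFree_gaussianDensity hZ hirr hQ0 hQ1).isGaussianWithSymbol hZ
  set D := gaussianDensity Z Q
  refine eq_of_moments hZ hirr fun m n v w => ?_
  set M := creation Z v * star (creation Z w) with hM
  have h1 : numberOp Z * M = M * numberOp Z + ((m : ℂ) - n) • M := by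
    rw [hM, ← mul_assoc, number_mul_creation (numberOp_mul_star hZ), add_mul, mul_assoc,
      number_mul_star_creation (numberOp_mul hZ), mul_sub, sub_smul, smul_mul_assoc, mul_smul_comm,
      mul_assoc]
    abel
  have h2 : ((m : ℂ) - n) * tau (D * M) = 0 := by
    rcases eq_or_ne m n with rfl | hmn
    · simp
    · have := hD.moment_of_ne m n v w hmn
      rw [← star_creation] at this
      exact mul_eq_zero_of_right _ this
  clear_value M
  rw [mul_assoc, h1, mul_add, map_add, mul_smul_comm, map_smul, smul_eq_mul, h2, add_zero,
    mul_assoc (numberOp Z), tau_mul_comm (numberOp Z), mul_assoc]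

variable (Z) in
/-- The span of the density matrices of the gauge invariant Gaussian states. -/
def gaussianSpan : Submodule ℂ (Module.End ℂ K) :=
  Submodule.span ℂ {D | ∃ Q : V →L[ℂ] V, 0 ≤ Q ∧ Q ≤ 1 ∧ D = gaussianDensity Z Q}

theorem creation_mul_star_self_mem {m : ℕ} (v : Fin m → V) :
    creation Z v * star (creation Z v) ∈ gaussianSpan Z := by
  have := hirr.nontrivial
  rcases creation_eq_smul hZ v with h | ⟨c, e, he, h⟩
  · simp [h]
  · have h1 := (isQuasiFree_creation hZ he).isGaussianWithSymbol hZ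
    have h2 : (2 : ℂ) ^ m • (creation Z e * star (creation Z e)) ∈ gaussianSpan Z :=
      Submodule.subset_span ⟨_, h1.nonneg, h1.le_one hZ, h1.eq_gaussianDensity hZ hirr⟩
    have h3 : creation Z v * star (creation Z v) = (c * star c * ((2 : ℂ) ^ m)⁻¹) •
        (2 : ℂ) ^ m • (creation Z e * star (creation Z e)) := by
      rw [h, star_smul, smul_mul_assoc, mul_smul_comm, smul_smul, smul_smul]
      congr 1
      field_simp
    rw [h3]
    exact Submodule.smul_mem _ _ h2

theorem balanced_mem_gaussianSpan {m : ℕ} (v w : Fin m → V) :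
    creation Z v * star (creation Z w) ∈ gaussianSpan Z := by
  -- polarize one pair of slots after the other
  have key : ∀ (s : Finset (Fin m)) (v w : Fin m → V), (∀ i ∉ s, v i = w i) →
      creation Z v * star (creation Z w) ∈ gaussianSpan Z := by
    intro s
    induction s using Finset.induction_on with
    | empty =>
      intro v w h
      obtain rfl : v = w := funext fun i => h i (by simp)
      exact creation_mul_star_self_mem hZ hirr v
    | insert k s hk ih =>
      intro v w h
      let f : V →ₗ[ℂ] V →ₗ⋆[ℂ] Module.End ℂ K :=
        LinearMap.mk₂'ₛₗ (RingHom.id ℂ) (starRingEnd ℂ) (fun x y =>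
          creation Z (Function.update v k x) * star (creation Z (Function.update w k y)))
          (fun x y z => by simp [← creationAlternating_apply hZ, add_mul])
          (fun c x y => by simp [← creationAlternating_apply hZ])
          (fun x y z => by simp [← creationAlternating_apply hZ, mul_add])
          (fun c x y => by simp [← creationAlternating_apply hZ])
      have hf := mem_of_forall_diag_mem f (p := gaussianSpan Z) (fun x => by
        refine ih _ _ fun i hi => ?_
        rcases eq_or_ne i k with rfl | hik
        · simp
        · simp [hik, h i (by simp [hik, hi])]) (v k) (w k)
      simpa [f] using hf
  exact key Finset.univ v w (fun i hi => absurd (Finset.mem_univ i) hi)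

/-- The density matrices of the gauge invariant Gaussian states span the Araki–Wyss algebra. -/
theorem mem_gaussianSpan_of_mem_arakiWyss {X : Module.End ℂ K} (hX : X ∈ arakiWyss Z) :
    X ∈ gaussianSpan Z := by
  set p : Submodule ℂ (Module.End ℂ K) := Submodule.span ℂ
    {T | ∃ (m n : ℕ) (v : Fin m → V) (w : Fin n → V), m ≠ n ∧
      T = creation Z v * star (creation Z w)} with hp
  have hle : monomialSpan Z ≤ gaussianSpan Z ⊔ p := by
    refine Submodule.span_le.2 ?_
    rintro _ ⟨m, n, v, w, rfl⟩
    rcases eq_or_ne m n with rfl | hmn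
    · exact Submodule.mem_sup_left (balanced_mem_gaussianSpan hZ hirr v w)
    · exact Submodule.mem_sup_right (Submodule.subset_span ⟨m, n, v, w, hmn, rfl⟩)
  have hX1 : X ∈ gaussianSpan Z ⊔ p := hle (by rw [monomialSpan_eq_top hZ hirr]; trivial)
  obtain ⟨X₀, hX₀, Y, hY, rfl⟩ := Submodule.mem_sup.1 hX1
  have hX₀' : X₀ ∈ arakiWyss Z := by
    have : gaussianSpan Z ≤ Subalgebra.toSubmodule (arakiWyss Z) := by
      refine Submodule.span_le.2 ?_
      rintro _ ⟨Q, h0, h1, rfl⟩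
      exact gaussianDensity_mem_arakiWyss hZ hirr h0 h1
    exact this hX₀
  have hY' : star Y ∈ arakiWyss Z := star_mem_arakiWyss (by simpa using sub_mem hX hX₀')
  rw [mem_arakiWyss_iff] at hY'
  have h0 : ∀ T ∈ p, tau (star Y * T) = 0 := by
    intro T hT
    induction hT using Submodule.span_induction with
    | mem x hx =>
      obtain ⟨m, n, v, w, hmn, rfl⟩ := hx
      exact tau_number_moment (numberOp_mul_star hZ) (numberOp_mul hZ) hY' hmn v w
    | zero => simp
    | add x y _ _ hx hy => rw [mul_add, map_add, hx, hy, add_zero]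
    | smul c x _ hx => rw [mul_smul_comm, map_smul, hx, smul_zero]
  rw [eq_zero_of_tau_star_mul_self (h0 Y hY), add_zero]
  exact hX₀

/-- Two linear maps that agree on the Gaussian density matrices agree on the Araki–Wyss
algebra. -/
theorem eq_of_eq_on_gaussian {E : Type*} [AddCommGroup E] [Module ℂ E]
    {f g : arakiWyss Z →ₗ[ℂ] E}
    (h : ∀ (Q : V →L[ℂ] V) (h0 : 0 ≤ Q) (h1 : Q ≤ 1),
      f ⟨gaussianDensity Z Q, gaussianDensity_mem_arakiWyss hZ hirr h0 h1⟩ =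
        g ⟨gaussianDensity Z Q, gaussianDensity_mem_arakiWyss hZ hirr h0 h1⟩) : f = g := by
  have key : gaussianSpan Z ≤
      (LinearMap.eqLocus f g).map (arakiWyssIncl Z) := by
    refine Submodule.span_le.2 ?_
    rintro _ ⟨Q, h0, h1, rfl⟩
    exact ⟨⟨_, gaussianDensity_mem_arakiWyss hZ hirr h0 h1⟩, h Q h0 h1, rfl⟩
  ext X
  obtain ⟨Y, hY, hYX⟩ := key (mem_gaussianSpan_of_mem_arakiWyss hZ hirr X.2)
  obtain rfl : Y = X := Subtype.ext hYX
  exact hY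

end Span

/-! ### Second quantization of reflections -/

section SecondQuantization

variable {V K : Type*} [NormedAddCommGroup V] [InnerProductSpace ℂ V] [FiniteDimensional ℂ V]
  [NormedAddCommGroup K] [InnerProductSpace ℂ K] [FiniteDimensional ℂ K]
  {Z : V →ₗ⋆[ℂ] Module.End ℂ K}

/-- A self-adjoint unitary `U` is implemented by the product of the reflections `1 - 2 Z*(e) Z(e)`
over an orthonormal basis `e` of the eigenspace of `U` with eigenvalue `-1`. -/
theorem exists_secondQuant (hZ : IsCARField Z) {U : V →ₗ[ℂ] V} (hU : U.IsSymmetric)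
    (hU2 : ∀ χ, U (U χ) = χ) : ∃ 𝒰 : Module.End ℂ K, 𝒰 * star 𝒰 = 1 ∧ star 𝒰 * 𝒰 = 1 ∧
      ∀ χ : V, 𝒰 * Z χ * star 𝒰 = Z (U χ) := by
  classical
  set b := hU.eigenvectorBasis rfl with hb
  set q := hU.eigenvalues rfl with hq
  have happ : ∀ i, U (b i) = (q i : ℂ) • b i := fun i => hU.apply_eigenvectorBasis rfl i
  have hq2 : ∀ i, q i = 1 ∨ q i = -1 := by
    intro i
    have h := hU2 (b i)
    rw [happ, map_smul, happ, smul_smul] at h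
    have h0 : b i ≠ 0 := b.orthonormal.ne_zero i
    have h1 : ((q i : ℂ) * q i - 1) • b i = 0 := by rw [sub_smul, h, one_smul, sub_self]
    have h2 := (smul_eq_zero.1 h1).resolve_right h0
    have h3 : q i * q i = 1 := by
      have : ((q i * q i : ℝ) : ℂ) = (1 : ℝ) := by push_cast; linear_combination h2
      exact_mod_cast this
    exact mul_self_eq_one_iff.1 h3
  have key : ∀ s : Finset (Fin (Module.finrank ℂ V)), ∃ 𝒰 : Module.End ℂ K,
      𝒰 * star 𝒰 = 1 ∧ star 𝒰 * 𝒰 = 1 ∧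
      ∀ i, 𝒰 * Z (b i) * star 𝒰 = if i ∈ s then -Z (b i) else Z (b i) := by
    intro s
    induction s using Finset.induction_on with
    | empty => exact ⟨1, by simp⟩
    | insert k s hk ih =>
      obtain ⟨𝒰, h1, h2, h3⟩ := ih
      set r : Module.End ℂ K := 1 - (2 : ℂ) • occ Z (b k) with hr
      have hnn := occ_mul_self hZ (b.orthonormal.1 k)
      have hrs : star r = r := by
        rw [hr, star_sub, star_one, star_smul, star_occ]
        simp
      have hrr : r * r = 1 := by
        rw [hr, sub_mul, one_mul, mul_sub, mul_one, smul_mul_assoc, mul_smul_comm, hnn]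
        module
      have hrk : r * Z (b k) * r = -Z (b k) := by
        rw [hr, sub_mul, one_mul, smul_mul_assoc, occ_mul_Z hZ, smul_zero, sub_zero, mul_sub,
          mul_one, mul_smul_comm, Z_mul_occ hZ (b.orthonormal.1 k)]
        module
      have hri : ∀ i, i ≠ k → r * Z (b i) * r = Z (b i) := by
        intro i hi
        have h4 := occ_mul_Z_of_inner_eq_zero hZ (b.inner_eq_zero hi.symm)
        have h5 : r * Z (b i) = Z (b i) * r := by
          rw [hr, sub_mul, mul_sub, smul_mul_assoc, h4, mul_smul_comm, one_mul, mul_one]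
        rw [h5, mul_assoc, hrr, mul_one]
      refine ⟨r * 𝒰, ?_, ?_, fun i => ?_⟩
      · rw [star_mul, mul_assoc, ← mul_assoc 𝒰, h1, one_mul, hrs, hrr]
      · rw [star_mul, mul_assoc, ← mul_assoc (star r), hrs, hrr, one_mul, h2]
      · have h4 : r * 𝒰 * Z (b i) * star (r * 𝒰) = r * (𝒰 * Z (b i) * star 𝒰) * r := by
          rw [star_mul, hrs]
          simp only [mul_assoc]
        rw [h4, h3]
        rcases eq_or_ne i k with rfl | hik
        · rw [if_neg hk, if_pos (Finset.mem_insert_self _ _), hrk]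
        · simp only [Finset.mem_insert, hik, false_or]
          split_ifs
          · rw [mul_neg, neg_mul, hri i hik]
          · rw [hri i hik]
  obtain ⟨𝒰, h1, h2, h3⟩ := key (Finset.univ.filter fun i => q i = -1)
  refine ⟨𝒰, h1, h2, fun χ => ?_⟩
  let f : V →ₗ⋆[ℂ] Module.End ℂ K :=
    (LinearMap.mulRight ℂ (star 𝒰) ∘ₗ LinearMap.mulLeft ℂ 𝒰).comp Z
  let g : V →ₗ⋆[ℂ] Module.End ℂ K := Z.comp U
  have hfg : f = g := by
    refine b.toBasis.ext fun i => ?_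
    change 𝒰 * Z (b.toBasis i) * star 𝒰 = Z (U (b.toBasis i))
    rw [OrthonormalBasis.coe_toBasis, h3, happ, LinearMap.map_smulₛₗ, Complex.conj_ofReal]
    rcases hq2 i with h | h
    · have : ¬ (1 : ℝ) = -1 := by norm_num
      simp [h, this]
    · simp [h]
  exact LinearMap.congr_fun hfg χ

theorem secondQuant_spec (hZ : IsCARField Z) {U : V →ₗ[ℂ] V} (hU : U.IsSymmetric)
    (hU2 : ∀ χ, U (U χ) = χ) : secondQuant Z U * star (secondQuant Z U) = 1 ∧
      star (secondQuant Z U) * secondQuant Z U = 1 ∧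
      ∀ χ : V, secondQuant Z U * Z χ * star (secondQuant Z U) = Z (U χ) := by
  have h := exists_secondQuant hZ hU hU2
  rw [secondQuant, dif_pos h]
  exact h.choose_spec

end SecondQuantization

/-! ### The dilation of a contraction -/

section Dilation

variable {H : Type*} [NormedAddCommGroup H] [InnerProductSpace ℂ H] [FiniteDimensional ℂ H]
  [CompleteSpace H]

omit [CompleteSpace H] in
theorem finite_spectrum_real (a : H →L[ℂ] H) : (spectrum ℝ a).Finite := by
  have h1 : (spectrum ℂ a).Finite := by
    rw [← AlgEquiv.spectrum_eq (Module.End.toContinuousLinearMap H).symm a]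
    exact Module.End.finite_spectrum _
  rw [← spectrum.preimage_algebraMap ℂ]
  exact h1.preimage (algebraMap ℝ ℂ).injective.injOn

omit [CompleteSpace H] in
theorem continuousOn_spectrum (a : H →L[ℂ] H) (f : ℝ → ℝ) : ContinuousOn f (spectrum ℝ a) :=
  (finite_spectrum_real a).continuousOn f

/-- The functional calculus respects intertwining relations between self-adjoint operators. -/
theorem cfc_intertwine {a b S : H →L[ℂ] H} (ha : IsSelfAdjoint a) (hb : IsSelfAdjoint b)
    (h : a * S = S * b) (f : ℝ → ℝ) : cfc f a * S = S * cfc f b := by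
  have hfin := (finite_spectrum_real a).union (finite_spectrum_real b)
  -- interpolate `f` by a polynomial on the two finite spectra
  obtain ⟨p, hp⟩ : ∃ p : Polynomial ℝ, ∀ x ∈ spectrum ℝ a ∪ spectrum ℝ b, p.eval x = f x :=
    ⟨Lagrange.interpolate hfin.toFinset id f, fun x hx =>
      Lagrange.eval_interpolate_at_node f Function.injective_id.injOn
        (hfin.mem_toFinset.2 hx)⟩
  have hpa : cfc f a = Polynomial.aeval a p := by
    rw [← cfc_polynomial p a ha]
    exact cfc_congr fun x hx => (hp x (Or.inl hx)).symm
  have hpb : cfc f b = Polynomial.aeval b p := by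
    rw [← cfc_polynomial p b hb]
    exact cfc_congr fun x hx => (hp x (Or.inr hx)).symm
  rw [hpa, hpb]
  clear hpa hpb hp
  induction p using Polynomial.induction_on' with
  | add p q hp hq => rw [map_add, map_add, add_mul, mul_add, hp, hq]
  | monomial n c =>
    have h1 : SemiconjBy S (b ^ n) (a ^ n) := SemiconjBy.pow_right h.symm n
    rw [Polynomial.aeval_monomial, Polynomial.aeval_monomial, mul_assoc, ← h1.eq, ← mul_assoc,
      Algebra.commutes c S, mul_assoc]

omit [FiniteDimensional ℂ H] in
theorem one_sub_mul_star_nonneg {S : H →L[ℂ] H} (hS : ‖S‖ ≤ 1) : 0 ≤ 1 - S * star S := by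
  refine nonneg_of_forall_inner fun x => ?_
  have h1 : ⟪x, (1 - S * star S) x⟫_ℂ = ((‖x‖ ^ 2 - ‖star S x‖ ^ 2 : ℝ) : ℂ) := by
    rw [sub_apply, inner_sub_right, one_apply_eq_self, mul_apply_eq_comp,
      ← ContinuousLinearMap.adjoint_inner_left, ← ContinuousLinearMap.star_eq_adjoint,
      inner_self_eq_norm_sq_to_K, inner_self_eq_norm_sq_to_K]
    simp
  have h2 : ‖star S x‖ ≤ ‖x‖ := by
    have := (star S).le_opNorm x
    rw [norm_star] at this
    nlinarith [norm_nonneg x]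
  rw [h1]
  have h3 : 0 ≤ ‖x‖ ^ 2 - ‖star S x‖ ^ 2 := by nlinarith [norm_nonneg (star S x)]
  exact_mod_cast h3

/-- The defect operator `(1 - S S*)^{1/2}`. -/
def defect (S : H →L[ℂ] H) : H →L[ℂ] H := cfc Real.sqrt (1 - S * star S)

omit [FiniteDimensional ℂ H] in
theorem star_defect (S : H →L[ℂ] H) : star (defect S) = defect S :=
  (cfc_predicate (p := IsSelfAdjoint) Real.sqrt (1 - S * star S)).star_eq

omit [FiniteDimensional ℂ H] in
theorem isSelfAdjoint_one_sub (S : H →L[ℂ] H) : IsSelfAdjoint (1 - S * star S) :=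
  (IsSelfAdjoint.one _).sub (IsSelfAdjoint.mul_star_self S)

omit [FiniteDimensional ℂ H] in
theorem cfc_eq_self_of_nonneg {a : H →L[ℂ] H} (ha : 0 ≤ a) {f : ℝ → ℝ}
    (hf : ∀ x, 0 ≤ x → f x = x) : cfc f a = a := by
  conv_rhs => rw [← cfc_id' ℝ a (IsSelfAdjoint.of_nonneg ha)]
  exact cfc_congr fun x hx => hf x (spectrum_nonneg_of_nonneg ha hx)

theorem defect_mul_defect {S : H →L[ℂ] H} (hS : ‖S‖ ≤ 1) :
    defect S * defect S = 1 - S * star S := by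
  rw [defect, ← cfc_mul _ _ _ (continuousOn_spectrum _ _) (continuousOn_spectrum _ _)]
  exact cfc_eq_self_of_nonneg (one_sub_mul_star_nonneg hS) fun x hx => Real.mul_self_sqrt hx

theorem defect_mul (S : H →L[ℂ] H) : defect S * S = S * defect (star S) := by
  refine cfc_intertwine (isSelfAdjoint_one_sub S) (isSelfAdjoint_one_sub _) ?_ _
  rw [star_star, sub_mul, mul_sub, one_mul, mul_one, mul_assoc]

omit [FiniteDimensional ℂ H] in
theorem dilation_fst (S : H →L[ℂ] H) (χ : WithLp 2 (H × H)) :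
    (dilation S χ).fst = -(defect S χ.fst) + S χ.snd := rfl

omit [FiniteDimensional ℂ H] in
theorem dilation_snd (S : H →L[ℂ] H) (χ : WithLp 2 (H × H)) :
    (dilation S χ).snd = star S χ.fst + defect (star S) χ.snd := by
  rw [defect, star_star]
  rfl

omit [FiniteDimensional ℂ H] in
theorem inner_star_right (S : H →L[ℂ] H) (x y : H) : ⟪x, star S y⟫_ℂ = ⟪S x, y⟫_ℂ :=
  ContinuousLinearMap.adjoint_inner_right S x y

omit [FiniteDimensional ℂ H] in
theorem inner_star_left (S : H →L[ℂ] H) (x y : H) : ⟪star S x, y⟫_ℂ = ⟪x, S y⟫_ℂ :=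
  ContinuousLinearMap.adjoint_inner_left S y x

omit [FiniteDimensional ℂ H] in
theorem inner_defect (S : H →L[ℂ] H) (x y : H) : ⟪defect S x, y⟫_ℂ = ⟪x, defect S y⟫_ℂ := by
  conv_lhs => rw [← star_defect, inner_star_left]

omit [FiniteDimensional ℂ H] in
theorem dilation_isSymmetric (S : H →L[ℂ] H) : (dilation S).IsSymmetric := by
  intro χ₁ χ₂
  simp only [WithLp.prod_inner_apply, WithLp.ofLp_fst, WithLp.ofLp_snd, dilation_fst,
    dilation_snd, inner_add_left, inner_add_right, inner_neg_left, inner_neg_right, inner_defect,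
    inner_star_left, inner_star_right]
  ring

theorem dilation_dilation {S : H →L[ℂ] H} (hS : ‖S‖ ≤ 1) (χ : WithLp 2 (H × H)) :
    dilation S (dilation S χ) = χ := by
  have hS' : ‖star S‖ ≤ 1 := by rwa [norm_star]
  have h1 : ∀ x, defect S (defect S x) = x - S (star S x) := fun x =>
    DFunLike.congr_fun (defect_mul_defect hS) x
  have h2 : ∀ x, defect (star S) (defect (star S) x) = x - star S (S x) := fun x => by
    have := DFunLike.congr_fun (defect_mul_defect hS') x
    rwa [star_star] at this
  have h3 : ∀ x, defect S (S x) = S (defect (star S) x) := fun x =>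
    DFunLike.congr_fun (defect_mul S) x
  have h4 : ∀ x, defect (star S) (star S x) = star S (defect S x) := fun x => by
    have := DFunLike.congr_fun (defect_mul (star S)) x
    rwa [star_star] at this
  refine (WithLp.ofLp_injective 2) (Prod.ext ?_ ?_)
  · change (dilation S (dilation S χ)).fst = χ.fst
    rw [dilation_fst, dilation_fst, dilation_snd, map_add, map_add, map_neg, h1, h3]
    abel
  · change (dilation S (dilation S χ)).snd = χ.snd
    rw [dilation_snd, dilation_fst, dilation_snd, map_add, map_add, map_neg, h2, h4]
    abel

/-- Conjugation by the defect operator recovers `R` from the symbol `T` of the ancilla. -/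
theorem defect_ancillaSymbol {S R : H →L[ℂ] H} (h : IsCompatiblePair S R) :
    0 ≤ ancillaSymbol S R ∧ ancillaSymbol S R ≤ 1 ∧
      defect S * ancillaSymbol S R * defect S = R := by
  set a := 1 - S * star S with ha
  have ha0 : 0 ≤ a := one_sub_mul_star_nonneg h.contraction
  have hasa : IsSelfAdjoint a := isSelfAdjoint_one_sub S
  set c := cfc (fun x : ℝ => (√x)⁻¹) a with hc
  have hcs : star c = c := (cfc_predicate (p := IsSelfAdjoint) _ a).star_eq
  set P := cfc (fun x : ℝ => (√x)⁻¹ * √x) a with hP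
  have hPs : star P = P := (cfc_predicate (p := IsSelfAdjoint) _ a).star_eq
  have hcD : c * defect S = P :=
    (cfc_mul _ _ _ (continuousOn_spectrum _ _) (continuousOn_spectrum _ _)).symm
  have hDc : defect S * c = P := by
    have := congrArg star hcD
    rwa [star_mul, star_defect, hcs, hPs] at this
  have hPle : P ≤ 1 := by
    refine cfc_le_one _ _ fun x _ => ?_
    by_cases hx : √x = 0
    · simp [hx]
    · rw [inv_mul_cancel₀ hx]
  have hDa : defect S * defect S = a := defect_mul_defect h.contraction
  have hPD : P * defect S = defect S := by
    rw [hP, defect, ← cfc_mul _ _ _ (continuousOn_spectrum _ _) (continuousOn_spectrum _ _)]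
    refine cfc_congr fun x _ => ?_
    by_cases hx : √x = 0
    · simp [hx]
    · simp [inv_mul_cancel₀ hx]
  have hPP : P * P = P := by
    conv_rhs => rw [← hDc, ← hPD, mul_assoc, hDc]
  have hT : ancillaSymbol S R = c * R * c := rfl
  refine ⟨?_, ?_, ?_⟩
  · have := star_left_conjugate_nonneg h.nonneg c
    rwa [hcs] at this
  · have h1 := star_left_conjugate_le_conjugate h.le c
    rw [hcs, ← ha, ← hDa, ← mul_assoc c (defect S), hcD, mul_assoc P, hDc, hPP] at h1
    exact h1.trans hPle
  · -- `R` vanishes on the kernel of `1 - S S*` since it is dominated by this operator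
    have h2 : (1 - P) * R * (1 - P) = 0 := by
      refine le_antisymm ?_ ?_
      · have h1 := star_left_conjugate_le_conjugate h.le (1 - P)
        rw [star_sub, star_one, hPs, ← ha, ← hDa] at h1
        refine h1.trans_eq ?_
        rw [← mul_assoc, sub_mul, one_mul, hPD, sub_self, zero_mul, zero_mul]
      · have h1 := star_left_conjugate_nonneg h.nonneg (1 - P)
        rwa [star_sub, star_one, hPs] at h1
    have h3 : R * (1 - P) = 0 := by
      obtain ⟨B, hB⟩ := CStarAlgebra.nonneg_iff_eq_star_mul_self.1 h.nonneg
      have h4 : star (B * (1 - P)) * (B * (1 - P)) = 0 := by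
        rw [star_mul, star_sub, star_one, hPs, mul_assoc, ← mul_assoc (star B), ← hB, ← mul_assoc,
          h2]
      rw [hB, mul_assoc, (CStarRing.star_mul_self_eq_zero_iff _).1 h4, mul_zero]
    have h4 : R * P = R := by
      rw [mul_sub, mul_one, sub_eq_zero] at h3
      exact h3.symm
    have h5 : P * R = R := by
      have := congrArg star h4
      rwa [star_mul, hPs, (IsSelfAdjoint.of_nonneg h.nonneg).star_eq] at this
    rw [hT, ← mul_assoc, ← mul_assoc, hDc, mul_assoc, hcD, h5, h4]

end Dilation

/-! ### The doubled field -/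

section Doubled

variable {H K : Type*}
  [NormedAddCommGroup H] [InnerProductSpace ℂ H] [FiniteDimensional ℂ H] [CompleteSpace H]
  [NormedAddCommGroup K] [InnerProductSpace ℂ K] [FiniteDimensional ℂ K]
  {Z : H →ₗ⋆[ℂ] Module.End ℂ K}

omit [FiniteDimensional ℂ K] in
theorem map_mul_map (A B C D : Module.End ℂ K) :
    TensorProduct.map A B * TensorProduct.map C D = TensorProduct.map (A * C) (B * D) :=
  (TensorProduct.map_mul A C B D).symm

theorem star_map (A B : Module.End ℂ K) :
    star (TensorProduct.map A B) = TensorProduct.map (star A) (star B) :=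
  TensorProduct.adjoint_map A B

omit [FiniteDimensional ℂ K] in
theorem map_one_one : TensorProduct.map (1 : Module.End ℂ K) (1 : Module.End ℂ K) = 1 :=
  TensorProduct.map_one

theorem tau_map (A B : Module.End ℂ K) : tau (TensorProduct.map A B) = tau A * tau B := by
  rw [tau_apply, tau_apply, tau_apply, LinearMap.trace_tensorProduct', Module.finrank_tensorProduct]
  push_cast
  rw [mul_inv]
  ring

omit [FiniteDimensional ℂ K] in
theorem map_neg_left (A B : Module.End ℂ K) :
    TensorProduct.map (-A) B = -TensorProduct.map A B := by
  refine eq_neg_of_add_eq_zero_left ?_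
  rw [← TensorProduct.map_add_left, neg_add_cancel, TensorProduct.map_zero_left]

omit [FiniteDimensional ℂ K] in
theorem map_neg_right (A B : Module.End ℂ K) :
    TensorProduct.map A (-B) = -TensorProduct.map A B := by
  refine eq_neg_of_add_eq_zero_left ?_
  rw [← TensorProduct.map_add_right, neg_add_cancel, TensorProduct.map_zero_right]

omit [FiniteDimensional ℂ K] in
theorem map_sub_left (A B C : Module.End ℂ K) :
    TensorProduct.map (A - B) C = TensorProduct.map A C - TensorProduct.map B C := by
  rw [sub_eq_add_neg, TensorProduct.map_add_left, map_neg_left, sub_eq_add_neg]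

omit [FiniteDimensional ℂ K] in
theorem map_sub_right (A B C : Module.End ℂ K) :
    TensorProduct.map A (B - C) = TensorProduct.map A B - TensorProduct.map A C := by
  rw [sub_eq_add_neg, TensorProduct.map_add_right, map_neg_right, sub_eq_add_neg]

/-! The additive structure of `K ⊗ K` is found along two paths, whose agreement is not seen by the
rewriting tactics; hence the following instances of general facts. -/

theorem star_add_tensor (A B : Module.End ℂ (K ⊗[ℂ] K)) : star (A + B) = star A + star B :=
  star_add A B

theorem star_mul_tensor (A B : Module.End ℂ (K ⊗[ℂ] K)) : star (A * B) = star B * star A :=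
  star_mul A B

theorem star_star_tensor (A : Module.End ℂ (K ⊗[ℂ] K)) : star (star A) = A :=
  star_star A

theorem star_zero_tensor : star (0 : Module.End ℂ (K ⊗[ℂ] K)) = 0 :=
  map_zero (LinearMap.adjoint (𝕜 := ℂ) (E := K ⊗[ℂ] K) (F := K ⊗[ℂ] K))

theorem exists_star_mul_self {A : Module.End ℂ K} (hA : A.IsPositive) :
    ∃ a : Module.End ℂ K, A = star a * a := by
  have := FiniteDimensional.complete ℂ K
  have h : 0 ≤ LinearMap.toContinuousLinearMap A := by
    rw [ContinuousLinearMap.nonneg_iff_isPositive]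
    exact (LinearMap.isPositive_toContinuousLinearMap_iff A).2 hA
  obtain ⟨b, hb⟩ := CStarAlgebra.nonneg_iff_eq_star_mul_self.1 h
  refine ⟨b, ?_⟩
  rw [← star_coe_clm, ← coe_mul_clm, ← hb]
  rfl

theorem map_isPositive {A B : Module.End ℂ K} (hA : A.IsPositive) (hB : B.IsPositive) :
    (TensorProduct.map A B).IsPositive := by
  obtain ⟨a, rfl⟩ := exists_star_mul_self hA
  obtain ⟨b, rfl⟩ := exists_star_mul_self hB
  rw [← map_mul_map, ← star_map]
  exact isPositive_star_mul_self _

omit [CompleteSpace H] in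
theorem doubledField_apply (χ : WithLp 2 (H × H)) : doubledField Z χ =
    TensorProduct.map (Z χ.fst) (parityOp Z) + TensorProduct.map 1 (Z χ.snd) := rfl

variable (hZ : IsCARField Z)
include hZ

omit [CompleteSpace H] in
theorem star_doubledField (χ : WithLp 2 (H × H)) : star (doubledField Z χ) =
    TensorProduct.map (star (Z χ.fst)) (parityOp Z) + TensorProduct.map 1 (star (Z χ.snd)) := by
  rw [doubledField_apply, star_add_tensor, star_map, star_map, star_parityOp hZ, star_one]

omit [CompleteSpace H] in
theorem isCARField_doubledField : IsCARField (doubledField Z) := by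
  have hW := parityOp_mul_self hZ
  have h2 : ∀ χ₁ χ₂, doubledField Z χ₁ * doubledField Z χ₂ +
      doubledField Z χ₂ * doubledField Z χ₁ = 0 := by
    intro χ₁ χ₂
    simp only [doubledField_apply, add_mul, mul_add, map_mul_map, hW, one_mul, mul_one,
      parityOp_mul_Z hZ, map_neg_right]
    have h3 := hZ.anticomm χ₁.fst χ₂.fst
    have h4 := hZ.anticomm χ₁.snd χ₂.snd
    rw [eq_neg_of_add_eq_zero_left h3, eq_neg_of_add_eq_zero_left h4, map_neg_left,
      map_neg_right]
    abel
  refine ⟨fun χ₁ χ₂ => ?_, h2, fun χ₁ χ₂ => ?_⟩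
  · rw [star_doubledField hZ, doubledField_apply]
    simp only [add_mul, mul_add, map_mul_map, hW, one_mul, mul_one,
      parityOp_mul_Z hZ, parityOp_mul_star hZ, map_neg_right]
    have h3 := hZ.anticomm_star χ₁.fst χ₂.fst
    have h4 := hZ.anticomm_star χ₁.snd χ₂.snd
    rw [eq_sub_of_add_eq h3, eq_sub_of_add_eq h4, map_sub_left,
      map_sub_right, TensorProduct.map_smul_left, TensorProduct.map_smul_right,
      map_one_one, WithLp.prod_inner_apply, add_smul]
    simp only [WithLp.ofLp_fst, WithLp.ofLp_snd]
    abel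
  · have := congrArg star (h2 χ₁ χ₂)
    rw [star_add_tensor, star_mul_tensor, star_mul_tensor, star_zero_tensor, add_comm] at this
    exact this

/-! ### The embedding of the first factor -/

omit [CompleteSpace H] in
theorem embedFst_eq (X : Module.End ℂ K) : embedFst Z X =
    TensorProduct.map X ((1 / 2 : ℂ) • (1 + parityOp Z)) +
      TensorProduct.map (parityOp Z * X * parityOp Z) ((1 / 2 : ℂ) • (1 - parityOp Z)) := by
  change TensorProduct.map _ _ + TensorProduct.map _ _ = _
  rw [star_parityOp hZ]
  simp only [smul_add, smul_sub, TensorProduct.map_add_left, TensorProduct.map_add_right,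
    map_sub_left, map_sub_right, TensorProduct.map_smul_left,
    TensorProduct.map_smul_right]
  abel

omit [CompleteSpace H] in
theorem embedFst_mul (X Y : Module.End ℂ K) :
    embedFst Z (X * Y) = embedFst Z X * embedFst Z Y := by
  have hW := parityOp_mul_self hZ
  have h1 : ((1 / 2 : ℂ) • (1 + parityOp Z)) * ((1 / 2 : ℂ) • (1 + parityOp Z)) =
      (1 / 2 : ℂ) • (1 + parityOp Z) := by
    rw [smul_mul_smul_comm, add_mul, mul_add, mul_add, hW]
    simp only [one_mul, mul_one]
    module
  have h2 : ((1 / 2 : ℂ) • (1 - parityOp Z)) * ((1 / 2 : ℂ) • (1 - parityOp Z)) =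
      (1 / 2 : ℂ) • (1 - parityOp Z) := by
    rw [smul_mul_smul_comm, sub_mul, mul_sub, mul_sub, hW]
    simp only [one_mul, mul_one]
    module
  have h3 : ((1 / 2 : ℂ) • (1 + parityOp Z)) * ((1 / 2 : ℂ) • (1 - parityOp Z)) = 0 := by
    rw [smul_mul_smul_comm, add_mul, mul_sub, mul_sub, hW]
    simp only [one_mul, mul_one]
    module
  have h4 : ((1 / 2 : ℂ) • (1 - parityOp Z)) * ((1 / 2 : ℂ) • (1 + parityOp Z)) = 0 := by
    rw [smul_mul_smul_comm, sub_mul, mul_add, mul_add, hW]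
    simp only [one_mul, mul_one]
    module
  have h5 : parityOp Z * X * parityOp Z * (parityOp Z * Y * parityOp Z) =
      parityOp Z * (X * Y) * parityOp Z := by
    rw [mul_assoc (parityOp Z * X), mul_assoc (parityOp Z) Y, ← mul_assoc (parityOp Z) (parityOp Z),
      hW, one_mul]
    simp only [mul_assoc]
  simp only [embedFst_eq hZ, add_mul, mul_add, map_mul_map, h1, h2, h3, h4, h5,
    TensorProduct.map_zero_right, add_zero, zero_add]

omit [CompleteSpace H] in
theorem star_embedFst (X : Module.End ℂ K) : star (embedFst Z X) = embedFst Z (star X) := by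
  rw [embedFst_eq hZ, embedFst_eq hZ, star_add_tensor, star_map, star_map]
  simp [star_parityOp hZ, mul_assoc]

omit [CompleteSpace H] in
theorem embedFst_of_comm {X : Module.End ℂ K} (hX : X * parityOp Z = parityOp Z * X) :
    embedFst Z X = TensorProduct.map X 1 := by
  have : parityOp Z * X * parityOp Z = X := by
    rw [← hX, mul_assoc, parityOp_mul_self hZ, mul_one]
  rw [embedFst_eq hZ, this, ← TensorProduct.map_add_right]
  congr 1
  module

omit [CompleteSpace H] in
theorem embedFst_one : embedFst Z 1 = 1 := by
  rw [embedFst_of_comm hZ (by rw [one_mul, mul_one]), map_one_one]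

omit [CompleteSpace H] in
theorem embedFst_Z (ψ : H) : embedFst Z (Z ψ) = doubledField Z (WithLp.toLp 2 (ψ, 0)) := by
  have : parityOp Z * Z ψ * parityOp Z = - Z ψ := by
    rw [parityOp_mul_Z hZ, neg_mul, mul_assoc, parityOp_mul_self hZ, mul_one]
  rw [embedFst_eq hZ, this, doubledField_apply, map_neg_left]
  simp only [WithLp.toLp_fst, WithLp.toLp_snd, map_zero, TensorProduct.map_zero_right, add_zero,
    smul_add, smul_sub, TensorProduct.map_add_right, map_sub_right,
    TensorProduct.map_smul_right]
  module

/-! ### The Heisenberg picture of the Evans–Hugenholtz–Kadison operation -/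

variable (Z) in
omit hZ in
/-- The embedding of `B(K)` in `B(K ⊗ K)` onto the algebra generated by the first factor,
followed by the quasi-free automorphism given by the dilation of `S`. -/
def dilatedEmbed (S : H →L[ℂ] H) (X : Module.End ℂ K) : Module.End ℂ (K ⊗[ℂ] K) :=
  secondQuant (doubledField Z) (dilation S) * embedFst Z X *
    star (secondQuant (doubledField Z) (dilation S))

section DilatedEmbedding

variable {S : H →L[ℂ] H} (hS : ‖S‖ ≤ 1)
include hS

theorem dilation_secondQuant_spec :
    secondQuant (doubledField Z) (dilation S) *
        star (secondQuant (doubledField Z) (dilation S)) = 1 ∧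
      star (secondQuant (doubledField Z) (dilation S)) *
        secondQuant (doubledField Z) (dilation S) = 1 ∧
      ∀ χ, secondQuant (doubledField Z) (dilation S) * doubledField Z χ *
        star (secondQuant (doubledField Z) (dilation S)) = doubledField Z (dilation S χ) :=
  secondQuant_spec (isCARField_doubledField hZ) (dilation_isSymmetric S) (dilation_dilation hS)

theorem dilatedEmbed_mul (X Y : Module.End ℂ K) :
    dilatedEmbed Z S (X * Y) = dilatedEmbed Z S X * dilatedEmbed Z S Y := by
  obtain ⟨-, h, -⟩ := dilation_secondQuant_spec hZ hS
  set 𝒰 := secondQuant (doubledField Z) (dilation S) with h𝒰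
  rw [dilatedEmbed, dilatedEmbed, dilatedEmbed, ← h𝒰, embedFst_mul hZ]
  calc 𝒰 * (embedFst Z X * embedFst Z Y) * star 𝒰
      = 𝒰 * embedFst Z X * 1 * embedFst Z Y * star 𝒰 := by rw [mul_one]; simp only [mul_assoc]
    _ = _ := by rw [← h]; simp only [mul_assoc]

omit hS in
theorem star_dilatedEmbed (X : Module.End ℂ K) :
    star (dilatedEmbed Z S X) = dilatedEmbed Z S (star X) := by
  rw [dilatedEmbed, dilatedEmbed, star_mul_tensor, star_mul_tensor, star_star_tensor,
    star_embedFst hZ, mul_assoc]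

theorem dilatedEmbed_one : dilatedEmbed Z S 1 = 1 := by
  rw [dilatedEmbed, embedFst_one hZ, mul_one, (dilation_secondQuant_spec hZ hS).1]

theorem dilatedEmbed_Z (ψ : H) :
    dilatedEmbed Z S (Z ψ) = doubledField Z (dilation S (WithLp.toLp 2 (ψ, 0))) := by
  rw [dilatedEmbed, embedFst_Z hZ, (dilation_secondQuant_spec hZ hS).2.2]

theorem dilatedEmbed_creation {m : ℕ} (v : Fin m → H) : dilatedEmbed Z S (creation Z v) =
    creation (doubledField Z) (fun k => dilation S (WithLp.toLp 2 (v k, 0))) := by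
  induction m with
  | zero => simp [dilatedEmbed_one hZ hS]
  | succ m ih =>
    rw [creation_succ, creation_succ, dilatedEmbed_mul hZ hS, ih, ← star_dilatedEmbed hZ,
      dilatedEmbed_Z hZ hS]

end DilatedEmbedding

/-- The block diagonal operator `T ⊕ Q`. -/
def directSum (T Q : H →L[ℂ] H) : WithLp 2 (H × H) →L[ℂ] WithLp 2 (H × H) :=
  LinearMap.toContinuousLinearMap
    { toFun := fun χ => WithLp.toLp 2 (T χ.fst, Q χ.snd)
      map_add' := fun χ₁ χ₂ => by
        refine (WithLp.ofLp_injective 2) (Prod.ext ?_ ?_) <;> simp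
      map_smul' := fun c χ => by
        refine (WithLp.ofLp_injective 2) (Prod.ext ?_ ?_) <;> simp }

omit hZ [CompleteSpace H] in
@[simp] theorem directSum_fst (T Q : H →L[ℂ] H) (χ : WithLp 2 (H × H)) :
    (directSum T Q χ).fst = T χ.fst := rfl

omit hZ [CompleteSpace H] in
@[simp] theorem directSum_snd (T Q : H →L[ℂ] H) (χ : WithLp 2 (H × H)) :
    (directSum T Q χ).snd = Q χ.snd := rfl

omit [CompleteSpace H] in
/-- The product of two quasi-free states is quasi-free for the doubled field. -/
theorem IsQuasiFree.map {T Q : H →L[ℂ] H} {D E : Module.End ℂ K} (hD : IsQuasiFree Z T D)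
    (hE : IsQuasiFree Z Q E) (hDN : D * numberOp Z = numberOp Z * D)
    (hEN : E * numberOp Z = numberOp Z * E) :
    IsQuasiFree (doubledField Z) (directSum T Q) (TensorProduct.map D E) := by
  have hEW : E * parityOp Z = parityOp Z * E := gaugeUnitary_comm hEN _
  have hNW : numberOp Z * parityOp Z = parityOp Z * numberOp Z := gaugeUnitary_comm rfl _
  refine ⟨map_isPositive hD.isPositive hE.isPositive, ?_,
    ⟨TensorProduct.map (numberOp Z) 1 + TensorProduct.map 1 (numberOp Z), fun χ => ?_, fun χ => ?_,
      ?_⟩, fun χ => ?_⟩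
  · rw [tau_map, hD.tau_eq_one, hE.tau_eq_one, mul_one]
  · rw [star_doubledField hZ]
    simp only [add_mul, mul_add, map_mul_map, one_mul, mul_one, numberOp_mul_star hZ, hNW,
      TensorProduct.map_add_left, TensorProduct.map_add_right]
    abel
  · rw [doubledField_apply]
    simp only [add_mul, mul_add, map_mul_map, one_mul, mul_one, numberOp_mul hZ, hNW,
      map_sub_left, map_sub_right]
    abel
  · simp only [add_mul, mul_add, map_mul_map, one_mul, mul_one, hDN, hEN]
  · rw [star_doubledField hZ, star_doubledField hZ]
    simp only [add_mul, mul_add, map_mul_map, one_mul, mul_one, WithLp.sub_fst, WithLp.sub_snd,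
      directSum_fst, directSum_snd, hD.exchange, hE.exchange, hEW]

variable (hirr : IsIrreducibleField Z)
include hirr

theorem gaussianDensity_comm_numberOp {Q : H →L[ℂ] H} (hQ0 : 0 ≤ Q) (hQ1 : Q ≤ 1) :
    gaussianDensity Z Q * numberOp Z = numberOp Z * gaussianDensity Z Q :=
  mem_arakiWyss_iff.1 (gaussianDensity_mem_arakiWyss hZ hirr hQ0 hQ1)

/-- The duality formula `τ(Φ_{S,R}(ρ) Y) = τ((ρ_T ⊗ ρ) α(Y))`, where `α` is the dilated
embedding. -/
theorem tau_ehk_mul {S R : H →L[ℂ] H} (h : IsCompatiblePair S R) (ρ Y : Module.End ℂ K) :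
    tau (ehk Z S R ρ * Y) =
      tau (TensorProduct.map (gaussianDensity Z (ancillaSymbol S R)) ρ * dilatedEmbed Z S Y) := by
  have := hirr.nontrivial
  obtain ⟨h0, h1, -⟩ := defect_ancillaSymbol h
  have hcomm := gaugeUnitary_comm (gaussianDensity_comm_numberOp hZ hirr h0 h1) Real.pi
  have h2 : embedFst Z (gaussianDensity Z (ancillaSymbol S R)) * embedSnd ρ =
      TensorProduct.map (gaussianDensity Z (ancillaSymbol S R)) ρ := by
    rw [embedFst_of_comm hZ hcomm]
    change _ * TensorProduct.map 1 ρ = _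
    rw [map_mul_map, one_mul, mul_one]
  have h3 : ehk Z S R ρ = tracialAdjoint (embedFst Z)
      (star (secondQuant (doubledField Z) (dilation S)) *
        (TensorProduct.map (gaussianDensity Z (ancillaSymbol S R)) ρ *
          secondQuant (doubledField Z) (dilation S))) := by
    rw [← h2]; rfl
  rw [h3, tau_tracialAdjoint_mul, mul_assoc, tau_mul_comm, dilatedEmbed]
  simp only [mul_assoc]

/-- Wick's theorem for the image of a Gaussian state. -/
theorem isGaussianWithSymbol_ehk_of_isPositive {S R Q : H →L[ℂ] H} (h : IsCompatiblePair S R)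
    (hQ0 : 0 ≤ Q) (hQ1 : Q ≤ 1) (hpos : (ehk Z S R (gaussianDensity Z Q)).IsPositive) :
    IsGaussianWithSymbol Z (S * Q * star S + R) (ehk Z S R (gaussianDensity Z Q)) := by
  obtain ⟨h0, h1, hR⟩ := defect_ancillaSymbol h
  have hS := h.contraction
  have hD := ((isQuasiFree_gaussianDensity hZ hirr h0 h1).map hZ
    (isQuasiFree_gaussianDensity hZ hirr hQ0 hQ1) (gaussianDensity_comm_numberOp hZ hirr h0 h1)
    (gaussianDensity_comm_numberOp hZ hirr hQ0 hQ1)).isGaussianWithSymbol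
      (isCARField_doubledField hZ)
  set T := ancillaSymbol S R
  have hin : ∀ φ ψ : H, ⟪dilation S (WithLp.toLp 2 (φ, 0)),
      directSum T Q (dilation S (WithLp.toLp 2 (ψ, 0)))⟫_ℂ =
      ⟪φ, (S * Q * star S + R) ψ⟫_ℂ := by
    intro φ ψ
    rw [WithLp.prod_inner_apply]
    simp only [WithLp.ofLp_fst, WithLp.ofLp_snd, directSum_fst, directSum_snd, dilation_fst,
      dilation_snd, WithLp.toLp_fst, WithLp.toLp_snd, map_zero, add_zero, map_neg, inner_neg_left,
      inner_neg_right, neg_neg, inner_defect, inner_star_left, add_apply, inner_add_right]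
    conv_rhs => rw [← hR]
    rw [add_comm]
    rfl
  have hmom : ∀ (m n : ℕ) (v : Fin m → H) (w : Fin n → H),
      tau (ehk Z S R (gaussianDensity Z Q) * (creation Z v * star (creation Z w))) =
      tau (TensorProduct.map (gaussianDensity Z T) (gaussianDensity Z Q) *
        (creation (doubledField Z) (fun k => dilation S (WithLp.toLp 2 (v k, 0))) *
          star (creation (doubledField Z) (fun k => dilation S (WithLp.toLp 2 (w k, 0)))))) := by
    intro m n v w
    rw [tau_ehk_mul hZ hirr h, dilatedEmbed_mul hZ hS, ← star_dilatedEmbed hZ,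
      dilatedEmbed_creation hZ hS, dilatedEmbed_creation hZ hS]
  refine ⟨hpos, ?_, fun φ ψ => ?_, fun m n v w hmn => ?_, fun n v w => ?_⟩
  · have := hmom 0 0 Fin.elim0 Fin.elim0
    simp only [creation_zero, star_one, mul_one] at this
    rw [this, hD.tau_eq_one]
  · have := hmom 1 1 (fun _ => ψ) (fun _ => φ)
    simp only [creation_succ, creation_zero, mul_one, star_star] at this
    rw [this, ← hD.symbol, hin]
  · rw [← star_creation, ← creation, hmom, star_creation]
    exact hD.moment_of_ne _ _ _ _ hmn
  · rw [← star_creation, ← creation, hmom, star_creation]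
    refine (hD.moment_eq_det _ _ _).trans ?_
    simp only [hin]

theorem ehk_tracePreserving {S R : H →L[ℂ] H} (h : IsCompatiblePair S R) (ρ : Module.End ℂ K) :
    tau (ehk Z S R ρ) = tau ρ := by
  have := hirr.nontrivial
  obtain ⟨h0, h1, -⟩ := defect_ancillaSymbol h
  have h2 := tau_ehk_mul hZ hirr h ρ 1
  rwa [dilatedEmbed_one hZ h.contraction, mul_one, mul_one, tau_map,
    (isQuasiFree_gaussianDensity hZ hirr h0 h1).tau_eq_one, one_mul] at h2

end Doubled

/-! ### Complete positivity and gauge covariance -/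

section Operation

variable {H K : Type*}
  [NormedAddCommGroup H] [InnerProductSpace ℂ H] [FiniteDimensional ℂ H] [CompleteSpace H]
  [NormedAddCommGroup K] [InnerProductSpace ℂ K] [FiniteDimensional ℂ K]
  {Z : H →ₗ⋆[ℂ] Module.End ℂ K}

omit [FiniteDimensional ℂ K] in
theorem exists_sum_tmul {ι : Type*} [Fintype ι] (b : OrthonormalBasis ι ℂ K) (w : K ⊗[ℂ] K) :
    ∃ f : ι → K, w = ∑ k, b k ⊗ₜ[ℂ] f k := by
  induction w using TensorProduct.induction_on with
  | zero => exact ⟨0, by simp⟩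
  | tmul x y =>
    refine ⟨fun k => ⟪b k, x⟫_ℂ • y, ?_⟩
    conv_lhs => rw [← b.sum_repr' x]
    simp [TensorProduct.sum_tmul, TensorProduct.smul_tmul]
  | add x y hx hy =>
    obtain ⟨f, rfl⟩ := hx
    obtain ⟨g, rfl⟩ := hy
    exact ⟨f + g, by simp [TensorProduct.tmul_add, Finset.sum_add_distrib]⟩

theorem isBlockPositive_map_one {n : ℕ} {a : Fin n → Fin n → Module.End ℂ K}
    (ha : IsBlockPositive a) (w : Fin n → K ⊗[ℂ] K) :
    0 ≤ ∑ i, ∑ j, ⟪w i, TensorProduct.map 1 (a i j) (w j)⟫_ℂ := by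
  classical
  let b := stdOrthonormalBasis ℂ K
  choose f hf using fun i => exists_sum_tmul b (w i)
  have h : ∀ i j, ⟪w i, TensorProduct.map 1 (a i j) (w j)⟫_ℂ =
      ∑ k, ⟪f i k, a i j (f j k)⟫_ℂ := by
    intro i j
    rw [hf i, hf j]
    simp [sum_inner, inner_sum, TensorProduct.inner_tmul, b.inner_eq_ite]
  simp_rw [h]
  have h2 : ∑ i, ∑ j, ∑ k, ⟪f i k, a i j (f j k)⟫_ℂ =
      ∑ k, ∑ i, ∑ j, ⟪f i k, a i j (f j k)⟫_ℂ := by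
    rw [Finset.sum_comm]
    rw [Finset.sum_comm' (t' := Finset.univ) (s' := fun _ => Finset.univ) (by simp)]
    simp_rw [Finset.sum_comm (s := Finset.univ (α := Fin n))
      (t := Finset.univ (α := Fin (Module.finrank ℂ K)))]
  rw [h2]
  exact Finset.sum_nonneg fun k _ => ha fun i => f i k

theorem inner_eq_tau [Nontrivial K] (X : Module.End ℂ K) (v w : K) :
    ⟪v, X w⟫_ℂ = Module.finrank ℂ K * tau (X * ketbra w v) := by
  have hd : (Module.finrank ℂ K : ℂ) ≠ 0 := by
    exact_mod_cast (Module.finrank_pos (R := ℂ) (M := K)).ne'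
  rw [mul_ketbra, tau_apply, trace_ketbra, mul_inv_cancel_left₀ hd]

variable (hZ : IsCARField Z) (hirr : IsIrreducibleField Z)
include hZ hirr

/-- By duality a matrix element of `Φ(a)` is a trace of `1 ⊗ a` between two vectors that depend on
one index each, because `|v j⟩⟨v i|` factors through a unit vector. -/
theorem ehk_completelyPositive {S R : H →L[ℂ] H} (h : IsCompatiblePair S R) {n : ℕ}
    {a : Fin n → Fin n → Module.End ℂ K} (ha : IsBlockPositive a) :
    IsBlockPositive fun i j => ehk Z S R (a i j) := by
  have := hirr.nontrivial
  intro v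
  obtain ⟨h0, h1, -⟩ := defect_ancillaSymbol h
  obtain ⟨u, hu⟩ := exists_norm_eq K (zero_le_one (α := ℝ))
  obtain ⟨c, hc⟩ := exists_star_mul_self (isQuasiFree_gaussianDensity hZ hirr h0 h1).isPositive
  have hket : ∀ i j, ketbra (v j) (v i) = ketbra (v j) u * star (ketbra (v i) u) := by
    intro i j
    rw [star_ketbra, mul_ketbra, ketbra_apply, inner_self_eq_norm_sq_to_K, hu]
    simp
  let V : Fin n → Module.End ℂ (K ⊗[ℂ] K) := fun i =>
    TensorProduct.map c 1 * dilatedEmbed Z S (ketbra (v i) u)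
  have key : ∀ i j, ⟪v i, ehk Z S R (a i j) (v j)⟫_ℂ =
      Module.finrank ℂ K * tau (star (V i) * (TensorProduct.map 1 (a i j) * V j)) := by
    intro i j
    rw [inner_eq_tau, tau_ehk_mul hZ hirr h, hket, dilatedEmbed_mul hZ h.contraction,
      ← star_dilatedEmbed hZ, ← mul_assoc, tau_mul_comm, hc]
    congr 2
    simp only [V]
    rw [star_mul_tensor, star_map, star_one, mul_assoc]
    congr 1
    rw [← mul_assoc, ← mul_assoc, map_mul_map, map_mul_map, mul_one, one_mul, mul_one]
  simp_rw [key, tau_apply, LinearMap.trace_eq_sum_inner _ (stdOrthonormalBasis ℂ (K ⊗[ℂ] K)),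
    ← Finset.mul_sum]
  refine mul_nonneg (Nat.cast_nonneg _) (mul_nonneg ?_ ?_)
  · rw [inv_nonneg]; exact Nat.cast_nonneg _
  have h2 : ∀ (i j : Fin n) (e : K ⊗[ℂ] K),
      ⟪e, (star (V i) * (TensorProduct.map 1 (a i j) * V j) : Module.End ℂ (K ⊗[ℂ] K)) e⟫_ℂ =
      ⟪V i e, TensorProduct.map 1 (a i j) (V j e)⟫_ℂ := fun i j e =>
    LinearMap.adjoint_inner_right (V i) e _
  simp_rw [h2]
  simp_rw [Finset.sum_comm (s := Finset.univ (α := Fin n))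
    (t := Finset.univ (α := Fin (Module.finrank ℂ (K ⊗[ℂ] K))))]
  exact Finset.sum_nonneg fun k _ => isBlockPositive_map_one ha _

theorem ehk_isPositive {S R : H →L[ℂ] H} (h : IsCompatiblePair S R) {ρ : Module.End ℂ K}
    (hρ : ρ.IsPositive) : (ehk Z S R ρ).IsPositive := by
  rw [LinearMap.isPositive_iff_complex]
  intro x
  have h1 := ehk_completelyPositive hZ hirr h (n := 1) (a := fun _ _ => ρ)
    (fun v => by simpa using hρ.inner_nonneg_right _) (fun _ => x)
  simp only [Finset.univ_unique, Finset.sum_singleton] at h1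
  rw [← inner_conj_symm, Complex.conj_eq_iff_real.2 ⟨_, (Complex.eq_re_of_ofReal_le h1)⟩]
  exact ⟨(Complex.eq_re_of_ofReal_le h1).symm, (Complex.le_def.1 h1).1⟩

/-- In the Heisenberg picture `ρ_Q` is tested through `ρ_T ⊗ ρ_Q` on the dilated monomials, whose
creation operators have the arguments `(1 - S S*)^{1/2} ψ` (up to a sign) and `S* ψ`. This makes
`(1 - S S*)^{1/2} T (1 - S S*)^{1/2} + S Q S*` the new symbol. -/
theorem ehk_gaussianDensity {S R Q : H →L[ℂ] H} (h : IsCompatiblePair S R)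
    (hQ0 : 0 ≤ Q) (hQ1 : Q ≤ 1) :
    ehk Z S R (gaussianDensity Z Q) = gaussianDensity Z (S * Q * star S + R) :=
  (isGaussianWithSymbol_ehk_of_isPositive hZ hirr h hQ0 hQ1
    (ehk_isPositive hZ hirr h
      (isQuasiFree_gaussianDensity hZ hirr hQ0 hQ1).isPositive)).eq_gaussianDensity hZ hirr

theorem map_symbol_nonneg {S R Q : H →L[ℂ] H} (h : IsCompatiblePair S R)
    (hQ0 : 0 ≤ Q) (hQ1 : Q ≤ 1) : 0 ≤ S * Q * star S + R :=
  (isGaussianWithSymbol_ehk_of_isPositive hZ hirr h hQ0 hQ1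
    (ehk_isPositive hZ hirr h
      (isQuasiFree_gaussianDensity hZ hirr hQ0 hQ1).isPositive)).nonneg

theorem map_symbol_le_one {S R Q : H →L[ℂ] H} (h : IsCompatiblePair S R)
    (hQ0 : 0 ≤ Q) (hQ1 : Q ≤ 1) : S * Q * star S + R ≤ 1 :=
  (isGaussianWithSymbol_ehk_of_isPositive hZ hirr h hQ0 hQ1
    (ehk_isPositive hZ hirr h
      (isQuasiFree_gaussianDensity hZ hirr hQ0 hQ1).isPositive)).le_one hZ

/-- The gauge transformations of the two factors implement the gauge transformation of the
dilated embedding. -/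
theorem gaugeUnitary_conj_dilatedEmbed {S : H →L[ℂ] H} (hS : ‖S‖ ≤ 1) (t : ℝ)
    (Y : Module.End ℂ K) :
    dilatedEmbed Z S (gaugeUnitary Z (-t) * Y * gaugeUnitary Z t) =
      TensorProduct.map (gaugeUnitary Z (-t)) (gaugeUnitary Z (-t)) * dilatedEmbed Z S Y *
        TensorProduct.map (gaugeUnitary Z t) (gaugeUnitary Z t) := by
  have huu : gaugeUnitary Z (-t) * gaugeUnitary Z t = 1 := gaugeUnitary_neg_mul t
  have huu' : gaugeUnitary Z t * gaugeUnitary Z (-t) = 1 := gaugeUnitary_mul_neg t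
  let p : Module.End ℂ K → Prop := fun Y =>
    dilatedEmbed Z S (gaugeUnitary Z (-t) * Y * gaugeUnitary Z t) =
      TensorProduct.map (gaugeUnitary Z (-t)) (gaugeUnitary Z (-t)) * dilatedEmbed Z S Y *
        TensorProduct.map (gaugeUnitary Z t) (gaugeUnitary Z t)
  have hmul : ∀ Y₁ Y₂, p Y₁ → p Y₂ → p (Y₁ * Y₂) := by
    intro Y₁ Y₂ h₁ h₂
    simp only [p] at h₁ h₂ ⊢
    have e1 : gaugeUnitary Z (-t) * (Y₁ * Y₂) * gaugeUnitary Z t =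
        (gaugeUnitary Z (-t) * Y₁ * gaugeUnitary Z t) *
          (gaugeUnitary Z (-t) * Y₂ * gaugeUnitary Z t) := by
      calc _ = gaugeUnitary Z (-t) * Y₁ * 1 * Y₂ * gaugeUnitary Z t := by
            rw [mul_one, mul_assoc _ Y₁]
        _ = _ := by rw [← huu']; simp only [mul_assoc]
    rw [e1, dilatedEmbed_mul hZ hS, h₁, h₂, dilatedEmbed_mul hZ hS]
    have e2 : TensorProduct.map (gaugeUnitary Z t) (gaugeUnitary Z t) *
        TensorProduct.map (gaugeUnitary Z (-t)) (gaugeUnitary Z (-t)) = 1 := by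
      rw [map_mul_map, huu', map_one_one]
    set a := TensorProduct.map (gaugeUnitary Z t) (gaugeUnitary Z t)
    set b := TensorProduct.map (gaugeUnitary Z (-t)) (gaugeUnitary Z (-t))
    calc _ = b * dilatedEmbed Z S Y₁ * (a * b) * dilatedEmbed Z S Y₂ * a := by
          simp only [mul_assoc]
      _ = _ := by rw [e2, mul_one, mul_assoc b]
  have hstar : ∀ Y, p Y → p (star Y) := by
    intro Y hY
    simp only [p] at hY ⊢
    have := congrArg star hY
    rw [star_dilatedEmbed hZ, star_mul_tensor, star_mul_tensor, star_map, star_map,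
      star_dilatedEmbed hZ, star_mul, star_mul, star_gaugeUnitary, star_gaugeUnitary,
      neg_neg, ← mul_assoc, ← mul_assoc] at this
    exact this
  have hone : p 1 := by
    simp only [p]
    rw [mul_one, huu, dilatedEmbed_one hZ hS, mul_one, map_mul_map, huu, map_one_one]
  have hfield : ∀ ψ, p (Z ψ) := by
    intro ψ
    have hu : ∀ η, gaugeUnitary Z (-t) * Z η * gaugeUnitary Z t =
        Complex.exp (t * Complex.I) • Z η := by
      intro η
      rw [mul_assoc, Z_mul_gaugeUnitary hZ, mul_smul_comm, ← mul_assoc, huu, one_mul]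
    have hW : gaugeUnitary Z (-t) * parityOp Z * gaugeUnitary Z t = parityOp Z := by
      rw [mul_assoc, parityOp, ← gaugeUnitary_add, add_comm, gaugeUnitary_add, ← mul_assoc,
        huu, one_mul]
    have hd : ∀ χ, TensorProduct.map (gaugeUnitary Z (-t)) (gaugeUnitary Z (-t)) *
        doubledField Z χ * TensorProduct.map (gaugeUnitary Z t) (gaugeUnitary Z t) =
        Complex.exp (t * Complex.I) • doubledField Z χ := by
      intro χ
      rw [doubledField_apply]
      simp only [mul_add, add_mul, map_mul_map, mul_one, hu, hW, huu, smul_add,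
        TensorProduct.map_smul_left, TensorProduct.map_smul_right]
    simp only [p]
    have hs : ∀ (c : ℂ) X, dilatedEmbed Z S (c • X) = c • dilatedEmbed Z S X := by
      intro c X
      rw [dilatedEmbed, dilatedEmbed, map_smul, mul_smul_comm, smul_mul_assoc]
    rw [hu, hs, dilatedEmbed_Z hZ hS, hd]
  have hcre : ∀ (m : ℕ) (v : Fin m → H), p (creation Z v) := by
    intro m
    induction m with
    | zero => intro v; rw [creation_zero]; exact hone
    | succ m ih =>
      intro v
      rw [creation_succ]
      exact hmul _ _ (hstar _ (hfield _)) (ih _)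
  have hY : Y ∈ monomialSpan Z := by rw [monomialSpan_eq_top hZ hirr]; trivial
  change p Y
  induction hY using Submodule.span_induction with
  | mem x hx =>
    obtain ⟨m, n, v, w, rfl⟩ := hx
    exact hmul _ _ (hcre _ _) (hstar _ (hcre _ _))
  | zero => simp [p, dilatedEmbed]
  | add x y _ _ hx hy =>
    simp only [p, dilatedEmbed, map_add, mul_add, add_mul] at hx hy ⊢
    rw [hx, hy]
  | smul c x _ hx =>
    simp only [p, dilatedEmbed, map_smul, mul_smul_comm, smul_mul_assoc] at hx ⊢
    rw [hx]

theorem ehk_gaugeCovariant {S R : H →L[ℂ] H} (h : IsCompatiblePair S R) (t : ℝ)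
    (X : Module.End ℂ K) :
    ehk Z S R (gaugeUnitary Z t * X * gaugeUnitary Z (-t)) =
      gaugeUnitary Z t * ehk Z S R X * gaugeUnitary Z (-t) := by
  obtain ⟨h0, h1, -⟩ := defect_ancillaSymbol h
  have hcomm := gaugeUnitary_comm (gaussianDensity_comm_numberOp hZ hirr h0 h1) t
  have hD : gaugeUnitary Z t * gaussianDensity Z (ancillaSymbol S R) * gaugeUnitary Z (-t) =
      gaussianDensity Z (ancillaSymbol S R) := by
    rw [← hcomm, mul_assoc, gaugeUnitary_mul_neg, mul_one]
  refine eq_of_tau_mul fun Y => ?_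
  rw [tau_ehk_mul hZ hirr h]
  have e1 : tau (gaugeUnitary Z t * ehk Z S R X * gaugeUnitary Z (-t) * Y) =
      tau (ehk Z S R X * (gaugeUnitary Z (-t) * Y * gaugeUnitary Z t)) := by
    rw [mul_assoc, mul_assoc, tau_mul_comm]
    simp only [mul_assoc]
  rw [e1, tau_ehk_mul hZ hirr h, gaugeUnitary_conj_dilatedEmbed hZ hirr h.contraction]
  have e2 : TensorProduct.map (gaussianDensity Z (ancillaSymbol S R))
      (gaugeUnitary Z t * X * gaugeUnitary Z (-t)) =
      TensorProduct.map (gaugeUnitary Z t) (gaugeUnitary Z t) *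
        TensorProduct.map (gaussianDensity Z (ancillaSymbol S R)) X *
        TensorProduct.map (gaugeUnitary Z (-t)) (gaugeUnitary Z (-t)) := by
    rw [map_mul_map, map_mul_map, hD]
  rw [e2, mul_assoc, mul_assoc, tau_mul_comm]
  simp only [mul_assoc]

theorem ehk_isGIGQuantumOperation {S R : H →L[ℂ] H} (h : IsCompatiblePair S R) :
    IsGIGQuantumOperation Z (ehk Z S R) := by
  refine ⟨⟨fun n a ha => ehk_completelyPositive hZ hirr h ha,
    fun x => ehk_tracePreserving hZ hirr h x⟩, ehk_gaugeCovariant hZ hirr h, fun D hD => ?_⟩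
  obtain ⟨Q, h0, h1, rfl⟩ := (isGIGState_iff hZ hirr).1 hD
  exact ⟨_, isGaussianWithSymbol_ehk_of_isPositive hZ hirr h h0 h1 (ehk_isPositive hZ hirr h
    (isQuasiFree_gaussianDensity hZ hirr h0 h1).isPositive)⟩

end Operation

/-! ### Contraction semigroups and the integrals `R_t` -/

section Contraction

variable {H : Type*} [NormedAddCommGroup H] [InnerProductSpace ℂ H] [FiniteDimensional ℂ H]
  [CompleteSpace H]

omit [FiniteDimensional ℂ H] in
theorem expSemigroup_zero (G : H →L[ℂ] H) : expSemigroup G 0 = 1 := by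
  rw [expSemigroup, Complex.ofReal_zero, zero_smul, NormedSpace.exp_zero]

omit [FiniteDimensional ℂ H] in
theorem expSemigroup_add (G : H →L[ℂ] H) (s t : ℝ) :
    expSemigroup G (s + t) = expSemigroup G s * expSemigroup G t := by
  let := NormedAlgebra.restrictScalars ℚ ℂ (H →L[ℂ] H)
  rw [expSemigroup, expSemigroup, expSemigroup, ← NormedSpace.exp_add_of_commute]
  · push_cast
    rw [add_smul]
  · exact (Commute.refl _).smul_left _ |>.smul_right _

omit [FiniteDimensional ℂ H] in
theorem star_expSemigroup (G : H →L[ℂ] H) (t : ℝ) :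
    star (expSemigroup G t) = expSemigroup (star G) t := by
  let := NormedAlgebra.restrictScalars ℚ ℂ (H →L[ℂ] H)
  rw [expSemigroup, expSemigroup, NormedSpace.star_exp, star_smul]
  simp

omit [FiniteDimensional ℂ H] in
theorem hasDerivAt_expSemigroup (G : H →L[ℂ] H) (t : ℝ) :
    HasDerivAt (expSemigroup G) (expSemigroup G t * G) t := by
  have := (hasDerivAt_exp_smul_const (𝕂 := ℂ) G (t : ℂ)).scomp t Complex.ofRealCLM.hasDerivAt
  rwa [Complex.ofRealCLM_apply, Complex.ofReal_one, one_smul] at this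

omit [FiniteDimensional ℂ H] in
theorem hasDerivAt_expSemigroup' (G : H →L[ℂ] H) (t : ℝ) :
    HasDerivAt (expSemigroup G) (G * expSemigroup G t) t := by
  have := (hasDerivAt_exp_smul_const' (𝕂 := ℂ) G (t : ℂ)).scomp t Complex.ofRealCLM.hasDerivAt
  rwa [Complex.ofRealCLM_apply, Complex.ofReal_one, one_smul] at this

omit [FiniteDimensional ℂ H] in
theorem continuous_expSemigroup (G : H →L[ℂ] H) : Continuous (expSemigroup G) :=
  continuous_iff_continuousAt.2 fun t => (hasDerivAt_expSemigroup G t).continuousAt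

omit [FiniteDimensional ℂ H] in
theorem continuous_Rint_integrand (G A : H →L[ℂ] H) :
    Continuous fun s => expSemigroup G s * A * expSemigroup (star G) s :=
  ((continuous_expSemigroup G).mul continuous_const).mul (continuous_expSemigroup _)

theorem hasDerivAt_Rint (G A : H →L[ℂ] H) (t : ℝ) :
    HasDerivAt (Rint G A) (expSemigroup G t * A * expSemigroup (star G) t) t :=
  intervalIntegral.integral_hasDerivAt_right
    ((continuous_Rint_integrand G A).intervalIntegrable _ _)
    (continuous_Rint_integrand G A).aestronglyMeasurable.stronglyMeasurableAtFilter
    (continuous_Rint_integrand G A).continuousAt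

omit [FiniteDimensional ℂ H] in
theorem Rint_zero (G A : H →L[ℂ] H) : Rint G A 0 = 0 :=
  intervalIntegral.integral_same

theorem continuous_Rint (G A : H →L[ℂ] H) : Continuous (Rint G A) :=
  continuous_iff_continuousAt.2 fun t => (hasDerivAt_Rint G A t).continuousAt

/-- The cocycle property of `R_t`, which makes `Q ↦ e^{tG} Q e^{tG*} + R_t` a semigroup. -/
theorem Rint_add (G A : H →L[ℂ] H) (s t : ℝ) :
    Rint G A (s + t) = expSemigroup G s * Rint G A t * star (expSemigroup G s) + Rint G A s := by
  have hi := fun a b => (continuous_Rint_integrand G A).intervalIntegrable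
    (μ := MeasureTheory.volume) a b
  have h1 : Rint G A (s + t) = Rint G A s +
      ∫ u in s..s + t, expSemigroup G u * A * expSemigroup (star G) u :=
    (intervalIntegral.integral_add_adjacent_intervals (hi _ _) (hi _ _)).symm
  have h2 := intervalIntegral.integral_comp_add_left (a := 0) (b := t)
    (fun u => expSemigroup G u * A * expSemigroup (star G) u) s
  rw [add_zero] at h2
  rw [h1, ← h2, add_comm]
  congr 1
  have h3 : ∀ u, expSemigroup G (s + u) * A * expSemigroup (star G) (s + u) =
      expSemigroup G s * (expSemigroup G u * A * expSemigroup (star G) u) *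
        star (expSemigroup G s) := by
    intro u
    rw [expSemigroup_add, add_comm s u, expSemigroup_add (star G), star_expSemigroup]
    simp only [mul_assoc]
  simp_rw [h3]
  let L : (H →L[ℂ] H) →L[ℂ] (H →L[ℂ] H) :=
    (ContinuousLinearMap.mul ℂ (H →L[ℂ] H)).flip (star (expSemigroup G s)) *
      ContinuousLinearMap.mul ℂ (H →L[ℂ] H) (expSemigroup G s)
  exact L.intervalIntegral_comp_comm (hi 0 t)

omit [FiniteDimensional ℂ H] in
theorem Rint_mono (G : H →L[ℂ] H) {A B : H →L[ℂ] H} (h : A ≤ B) {t : ℝ} (ht : 0 ≤ t) :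
    Rint G A t ≤ Rint G B t := by
  rw [← sub_nonneg, Rint, Rint, ← intervalIntegral.integral_sub
    ((continuous_Rint_integrand G B).intervalIntegrable _ _)
    ((continuous_Rint_integrand G A).intervalIntegrable _ _),
    intervalIntegral.integral_of_le ht]
  refine MeasureTheory.integral_nonneg fun s => ?_
  rw [Pi.zero_apply, ← sub_mul, ← mul_sub, ← star_expSemigroup]
  exact star_right_conjugate_nonneg (sub_nonneg.2 h) _

omit [FiniteDimensional ℂ H] in
/-- The bound `R_t ≤ 1 - e^{tG} e^{tG*}` is attained for `A = -G - G*`. -/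
theorem Rint_neg_add_star (G : H →L[ℂ] H) (t : ℝ) :
    Rint G (-G - star G) t = 1 - expSemigroup G t * star (expSemigroup G t) := by
  have h : ∀ s ∈ Set.uIcc 0 t, HasDerivAt
      (fun s => -(expSemigroup G s * expSemigroup (star G) s))
      (expSemigroup G s * (-G - star G) * expSemigroup (star G) s) s := by
    intro s _
    have := ((hasDerivAt_expSemigroup G s).mul (hasDerivAt_expSemigroup' (star G) s)).neg
    refine this.congr_deriv ?_
    simp only [mul_sub, sub_mul, mul_neg, neg_mul, mul_assoc]
    abel
  rw [Rint, intervalIntegral.integral_eq_sub_of_hasDerivAt h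
    ((continuous_Rint_integrand G _).intervalIntegrable _ _), expSemigroup_zero,
    expSemigroup_zero, star_expSemigroup, mul_one]
  abel

theorem isCompatiblePair_expSemigroup {G A : H →L[ℂ] H} (h : IsGeneratingPair G A) {t : ℝ}
    (ht : 0 ≤ t) : IsCompatiblePair (expSemigroup G t) (Rint G A t) := by
  refine ⟨h.contraction t ht, ?_, ?_⟩
  · have := Rint_mono G h.nonneg ht
    have h0 : Rint G 0 t = 0 := by simp [Rint]
    rwa [h0] at this
  · have := Rint_mono G h.le ht
    rwa [Rint_neg_add_star] at this

/-- An operator with negative real part generates a contraction semigroup. -/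
theorem norm_expSemigroup_le_one {G : H →L[ℂ] H} (h : 0 ≤ -G - star G) {t : ℝ} (ht : 0 ≤ t) :
    ‖expSemigroup G t‖ ≤ 1 := by
  have h1 := Rint_mono G h ht
  have h0 : Rint G 0 t = 0 := by simp [Rint]
  rw [h0, Rint_neg_add_star, sub_nonneg] at h1
  have h2 := CStarAlgebra.norm_le_norm_of_nonneg_of_le (mul_star_self_nonneg _) h1
  rw [CStarRing.norm_self_mul_star] at h2
  rcases subsingleton_or_nontrivial H with hH | hH
  · have : expSemigroup G t = 0 := by ext x; exact Subsingleton.elim _ _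
    rw [this, norm_zero]; exact zero_le_one
  · rw [norm_one] at h2
    nlinarith [norm_nonneg (expSemigroup G t)]

/-- The action of the flow on symbols. -/
def flowSymbol (G A : H →L[ℂ] H) (t : ℝ) (Q : H →L[ℂ] H) : H →L[ℂ] H :=
  expSemigroup G t * Q * star (expSemigroup G t) + Rint G A t

omit [FiniteDimensional ℂ H] in
theorem flowSymbol_zero (G A Q : H →L[ℂ] H) : flowSymbol G A 0 Q = Q := by
  rw [flowSymbol, expSemigroup_zero, Rint_zero, star_one, one_mul, mul_one, add_zero]

theorem flowSymbol_add (G A : H →L[ℂ] H) (s t : ℝ) (Q : H →L[ℂ] H) :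
    flowSymbol G A (s + t) Q = flowSymbol G A s (flowSymbol G A t Q) := by
  simp only [flowSymbol, Rint_add, expSemigroup_add, star_mul, mul_add, add_mul, mul_assoc,
    add_assoc]

theorem continuous_flowSymbol (G A Q : H →L[ℂ] H) : Continuous fun t => flowSymbol G A t Q :=
  (((continuous_expSemigroup G).mul continuous_const).mul (continuous_expSemigroup G).star).add
    (continuous_Rint G A)

theorem hasDerivAt_flowSymbol (G A Q : H →L[ℂ] H) :
    HasDerivAt (fun t => flowSymbol G A t Q) (A + G * Q + Q * star G) 0 := by
  have h1 := (((hasDerivAt_expSemigroup G 0).mul_const Q).mul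
    (hasDerivAt_expSemigroup (star G) 0)).add (hasDerivAt_Rint G A 0)
  refine (h1.congr_of_eventuallyEq ?_).congr_deriv ?_
  · filter_upwards with t
    rw [flowSymbol, star_expSemigroup]
    rfl
  · simp only [expSemigroup_zero, one_mul, mul_one]
    abel

end Contraction

/-! ### The semigroup of a generating pair -/

section Flow

variable {H K : Type*}
  [NormedAddCommGroup H] [InnerProductSpace ℂ H] [FiniteDimensional ℂ H] [CompleteSpace H]
  [NormedAddCommGroup K] [InnerProductSpace ℂ K] [FiniteDimensional ℂ K]
  {Z : H →ₗ⋆[ℂ] Module.End ℂ K} (hZ : IsCARField Z) (hirr : IsIrreducibleField Z)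
include hZ hirr

omit [CompleteSpace H] in
theorem continuous_of_moments {α : Type*} [TopologicalSpace α] {X : α → Module.End ℂ K}
    (h : ∀ (m n : ℕ) (v : Fin m → H) (w : Fin n → H),
      Continuous fun t => tau (X t * (creation Z v * star (creation Z w)))) :
    Continuous fun t => LinearMap.toContinuousLinearMap (X t) := by
  have := hirr.nontrivial
  have hT : ∀ T : Module.End ℂ K, Continuous fun t => tau (X t * T) := by
    intro T
    have hT : T ∈ monomialSpan Z := by rw [monomialSpan_eq_top hZ hirr]; trivial
    induction hT using Submodule.span_induction with
    | mem x hx =>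
      obtain ⟨m, n, v, w, rfl⟩ := hx
      exact h m n v w
    | zero => simpa using continuous_const
    | add x y _ _ hx hy =>
      simp only [mul_add, map_add]
      exact hx.add hy
    | smul c x _ hx =>
      simp only [mul_smul_comm, map_smul]
      exact hx.const_smul c
  rw [continuous_clm_apply]
  intro y
  let b := stdOrthonormalBasis ℂ K
  have h1 : ∀ t, LinearMap.toContinuousLinearMap (X t) y =
      ∑ i, (Module.finrank ℂ K * tau (X t * ketbra y (b i)) : ℂ) • b i := by
    intro t
    simp_rw [← inner_eq_tau]
    exact (b.sum_repr' (X t y)).symm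
  simp_rw [h1]
  exact continuous_finsetSum _ fun i _ => (continuous_const.mul (hT _)).smul continuous_const

theorem gaussianDensity_isGaussianWithSymbol {Q : H →L[ℂ] H} (h0 : 0 ≤ Q) (h1 : Q ≤ 1) :
    IsGaussianWithSymbol Z Q (gaussianDensity Z Q) :=
  (isQuasiFree_gaussianDensity hZ hirr h0 h1).isGaussianWithSymbol hZ

theorem gaussianDensity_moment_of_ne {Q : H →L[ℂ] H} (h0 : 0 ≤ Q) (h1 : Q ≤ 1) {m n : ℕ}
    (v : Fin m → H) (w : Fin n → H) (hmn : m ≠ n) :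
    tau (gaussianDensity Z Q * (creation Z v * star (creation Z w))) = 0 := by
  rw [star_creation, creation]
  exact (gaussianDensity_isGaussianWithSymbol hZ hirr h0 h1).moment_of_ne _ _ _ _ hmn

theorem gaussianDensity_moment {Q : H →L[ℂ] H} (h0 : 0 ≤ Q) (h1 : Q ≤ 1) {n : ℕ}
    (v w : Fin n → H) :
    tau (gaussianDensity Z Q * (creation Z v * star (creation Z w))) =
      (Matrix.of fun j k => ⟪w j, Q (v k)⟫_ℂ).det := by
  rw [star_creation, creation]
  exact (gaussianDensity_isGaussianWithSymbol hZ hirr h0 h1).moment_eq_det _ _ _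

theorem continuous_gaussianDensity {α : Type*} [TopologicalSpace α] {Q : α → H →L[ℂ] H}
    (h0 : ∀ t, 0 ≤ Q t) (h1 : ∀ t, Q t ≤ 1) (hQ : Continuous Q) :
    Continuous fun t => LinearMap.toContinuousLinearMap (gaussianDensity Z (Q t)) := by
  refine continuous_of_moments hZ hirr fun m n v w => ?_
  rcases eq_or_ne m n with rfl | hmn
  · simp_rw [gaussianDensity_moment hZ hirr (h0 _) (h1 _)]
    refine Continuous.matrix_det (continuous_matrix fun i j => ?_)
    exact continuous_const.inner (hQ.clm_apply continuous_const)
  · simp_rw [gaussianDensity_moment_of_ne hZ hirr (h0 _) (h1 _) v w hmn]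
    exact continuous_const

theorem gaussianSpan_le : gaussianSpan Z ≤ Subalgebra.toSubmodule (arakiWyss Z) := by
  refine Submodule.span_le.2 ?_
  rintro _ ⟨Q, h0, h1, rfl⟩
  exact gaussianDensity_mem_arakiWyss hZ hirr h0 h1

variable {G A : H →L[ℂ] H} (hGA : IsGeneratingPair G A)
include hGA

theorem ehkFlow_gaussianDensity (t : ℝ≥0) {Q : H →L[ℂ] H} (h0 : 0 ≤ Q) (h1 : Q ≤ 1) :
    ehkFlow Z G A t (gaussianDensity Z Q) = gaussianDensity Z (flowSymbol G A t Q) :=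
  ehk_gaussianDensity hZ hirr (isCompatiblePair_expSemigroup hGA t.2) h0 h1

theorem flowSymbol_nonneg (t : ℝ≥0) {Q : H →L[ℂ] H} (h0 : 0 ≤ Q) (h1 : Q ≤ 1) :
    0 ≤ flowSymbol G A t Q :=
  map_symbol_nonneg hZ hirr (isCompatiblePair_expSemigroup hGA t.2) h0 h1

theorem flowSymbol_le_one (t : ℝ≥0) {Q : H →L[ℂ] H} (h0 : 0 ≤ Q) (h1 : Q ≤ 1) :
    flowSymbol G A t Q ≤ 1 :=
  map_symbol_le_one hZ hirr (isCompatiblePair_expSemigroup hGA t.2) h0 h1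

theorem ehkFlow_mem (t : ℝ≥0) {X : Module.End ℂ K} (hX : X ∈ arakiWyss Z) :
    ehkFlow Z G A t X ∈ arakiWyss Z := by
  have h := mem_gaussianSpan_of_mem_arakiWyss hZ hirr hX
  induction h using Submodule.span_induction with
  | mem x hx =>
    obtain ⟨Q, h0, h1, rfl⟩ := hx
    rw [ehkFlow_gaussianDensity hZ hirr hGA t h0 h1]
    exact gaussianDensity_mem_arakiWyss hZ hirr (flowSymbol_nonneg hZ hirr hGA t h0 h1)
      (flowSymbol_le_one hZ hirr hGA t h0 h1)
  | zero => rw [map_zero]; exact zero_mem _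
  | add x y hx' hy' hx hy =>
    rw [map_add]
    exact add_mem (hx (gaussianSpan_le hZ hirr hx')) (hy (gaussianSpan_le hZ hirr hy'))
  | smul c x hx' hx =>
    rw [map_smul]
    exact (arakiWyss Z).smul_mem (hx (gaussianSpan_le hZ hirr hx')) c

/-- The restriction of the flow of a generating pair to the Araki–Wyss algebra. -/
def restrictedFlow (t : ℝ≥0) : arakiWyss Z →ₗ[ℂ] arakiWyss Z :=
  ((ehkFlow Z G A t) ∘ₗ arakiWyssIncl Z).codRestrict (Subalgebra.toSubmodule (arakiWyss Z))
    fun X => ehkFlow_mem hZ hirr hGA t X.2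

theorem restrictedFlow_gaussian (t : ℝ≥0) {Q : H →L[ℂ] H} (h0 : 0 ≤ Q) (h1 : Q ≤ 1) :
    restrictedFlow hZ hirr hGA t
      ⟨gaussianDensity Z Q, gaussianDensity_mem_arakiWyss hZ hirr h0 h1⟩ =
      ⟨gaussianDensity Z (flowSymbol G A t Q), gaussianDensity_mem_arakiWyss hZ hirr
        (flowSymbol_nonneg hZ hirr hGA t h0 h1) (flowSymbol_le_one hZ hirr hGA t h0 h1)⟩ :=
  Subtype.ext (ehkFlow_gaussianDensity hZ hirr hGA t h0 h1)

theorem isRestrictedFlow_restrictedFlow :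
    IsRestrictedFlow Z G A (restrictedFlow hZ hirr hGA) := fun _ _ => rfl

theorem isGIGSemigroup_restrictedFlow : IsGIGSemigroup Z (restrictedFlow hZ hirr hGA) := by
  have hop := fun t : ℝ≥0 => ehk_isGIGQuantumOperation hZ hirr
    (isCompatiblePair_expSemigroup hGA t.2)
  refine ⟨?_, fun s t => ?_, fun X => ?_, fun t => ⟨fun n a ha => ?_, fun X => ?_⟩,
    fun t X hX => ?_⟩
  · refine eq_of_eq_on_gaussian hZ hirr fun Q h0 h1 => ?_
    rw [restrictedFlow_gaussian hZ hirr hGA 0 h0 h1]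
    refine Subtype.ext ?_
    simp [flowSymbol_zero]
  · refine eq_of_eq_on_gaussian hZ hirr fun Q h0 h1 => ?_
    rw [LinearMap.comp_apply, restrictedFlow_gaussian hZ hirr hGA _ h0 h1,
      restrictedFlow_gaussian hZ hirr hGA t h0 h1, restrictedFlow_gaussian hZ hirr hGA s
        (flowSymbol_nonneg hZ hirr hGA t h0 h1) (flowSymbol_le_one hZ hirr hGA t h0 h1)]
    refine Subtype.ext ?_
    simp [flowSymbol_add]
  · obtain ⟨X, hX⟩ := X
    change Continuous fun t : ℝ≥0 => LinearMap.toContinuousLinearMap (ehkFlow Z G A t X)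
    have h := mem_gaussianSpan_of_mem_arakiWyss hZ hirr hX
    clear hX
    induction h using Submodule.span_induction with
    | mem x hx =>
      obtain ⟨Q, h0, h1, rfl⟩ := hx
      simp_rw [ehkFlow_gaussianDensity hZ hirr hGA _ h0 h1]
      exact continuous_gaussianDensity hZ hirr (fun t => flowSymbol_nonneg hZ hirr hGA t h0 h1)
        (fun t => flowSymbol_le_one hZ hirr hGA t h0 h1)
        ((continuous_flowSymbol G A Q).comp NNReal.continuous_coe)
    | zero => simpa using continuous_const
    | add x y _ _ hx hy =>
      simp only [map_add]
      exact hx.add hy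
    | smul c x _ hx =>
      simp only [map_smul]
      exact hx.const_smul c
  · exact (hop t).isQuantumOperation.completelyPositive n (fun i j => arakiWyssIncl Z (a i j)) ha
  · exact (hop t).isQuantumOperation.tracePreserving (arakiWyssIncl Z X)
  · exact (hop t).map_gig _ hX

end Flow

/-! ### Continuous semigroups in finite dimension and their generators -/

section Generators

/-- A continuous semigroup in a Banach algebra is an exponential: it is differentiable, because
`T t * ∫ s in 0..a, T s = ∫ s in t..t + a, T s`, and the integral is invertible for small `a`. -/
theorem exists_eq_exp {𝔸 : Type*} [NormedRing 𝔸] [NormedAlgebra ℝ 𝔸] [CompleteSpace 𝔸]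
    {T : ℝ → 𝔸} (hT : Continuous T) (h0 : T 0 = 1)
    (hadd : ∀ s t, 0 ≤ s → 0 ≤ t → T (s + t) = T s * T t) :
    ∃ L : 𝔸, ∀ t, 0 ≤ t → T t = NormedSpace.exp (t • L) := by
  have hi := fun a b => hT.intervalIntegrable (μ := MeasureTheory.volume) a b
  let F : ℝ → 𝔸 := fun u => ∫ s in (0 : ℝ)..u, T s
  have hF : ∀ u, HasDerivAt F (T u) u := fun u =>
    intervalIntegral.integral_hasDerivAt_right (hi 0 u)
      hT.aestronglyMeasurable.stronglyMeasurableAtFilter hT.continuousAt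
  have hF0 : F 0 = 0 := intervalIntegral.integral_same
  obtain ⟨a, ha, hu⟩ : ∃ a : ℝ, 0 < a ∧ IsUnit (F a) := by
    have h1 := (hF 0).tendsto_slope_zero_right
    have h2 : ∀ᶠ x in nhds (T 0), IsUnit x := by
      rw [h0]
      exact Units.isOpen.mem_nhds isUnit_one
    have h3 := (h1.eventually h2).and self_mem_nhdsWithin
    obtain ⟨a, hu, ha⟩ := h3.exists
    have ha : 0 < a := ha
    refine ⟨a, ha, ?_⟩
    rw [zero_add, hF0, sub_zero] at hu
    have := hu.smul (Units.mk0 a ha.ne')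
    rwa [Units.smul_def, Units.val_mk0, smul_inv_smul₀ ha.ne'] at this
  obtain ⟨M, hM⟩ := hu
  have hTM : ∀ t, 0 ≤ t → T t = (F (t + a) - F t) * (↑M⁻¹ : 𝔸) := by
    intro t ht
    rw [Units.eq_mul_inv_iff_mul_eq, hM]
    have e1 : F (t + a) - F t = ∫ s in t..t + a, T s :=
      intervalIntegral.integral_interval_sub_left (hi _ _) (hi _ _)
    have e2 := intervalIntegral.integral_comp_add_left (a := 0) (b := a) T t
    rw [add_zero] at e2
    rw [e1, ← e2]
    have e3 : ∫ s in (0 : ℝ)..a, T (t + s) = ∫ s in (0 : ℝ)..a, T t * T s := by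
      refine intervalIntegral.integral_congr fun s hs => ?_
      rw [Set.uIcc_of_le ha.le] at hs
      exact hadd t s ht hs.1
    rw [e3]
    exact ((ContinuousLinearMap.mul ℝ 𝔸 (T t)).intervalIntegral_comp_comm (hi 0 a)).symm
  set L : 𝔸 := (T a - 1) * (↑M⁻¹ : 𝔸) with hL
  have hder : ∀ t, 0 ≤ t → HasDerivWithinAt T (T t * L) (Set.Ici t) t := by
    intro t ht
    have h1 : HasDerivAt (fun u => (F (u + a) - F u) * (↑M⁻¹ : 𝔸))
        ((T (t + a) - T t) * (↑M⁻¹ : 𝔸)) t :=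
      ((((hF (t + a)).comp_add_const t a).sub (hF t)).mul_const _)
    have h2 : (T (t + a) - T t) * (↑M⁻¹ : 𝔸) = T t * L := by
      rw [hadd t a ht ha.le, hL, ← mul_assoc, mul_sub, mul_one]
    rw [h2] at h1
    exact h1.hasDerivWithinAt.congr (fun u hu => hTM u (ht.trans hu)) (hTM t ht)
  refine ⟨L, fun b hb => ?_⟩
  let := NormedAlgebra.restrictScalars ℚ ℝ 𝔸
  have hexp : Continuous fun t : ℝ => NormedSpace.exp (t • (-L)) :=
    continuous_iff_continuousAt.2 fun t => (hasDerivAt_exp_smul_const (-L) t).continuousAt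
  have hconst := constant_of_has_deriv_right_zero (a := 0) (b := b)
    (f := fun t => T t * NormedSpace.exp (t • (-L))) (hT.mul hexp).continuousOn
    (fun t ht => by
      refine ((hder t ht.1).mul
        (hasDerivAt_exp_smul_const' (-L) t).hasDerivWithinAt).congr_deriv ?_
      rw [mul_assoc, ← mul_add, ← add_mul, add_neg_cancel, zero_mul, mul_zero]) b ⟨hb, le_rfl⟩
  simp only [h0, zero_smul, NormedSpace.exp_zero, mul_one] at hconst
  have hinv : NormedSpace.exp (b • (-L)) * NormedSpace.exp (b • L) = 1 := by
    rw [← NormedSpace.exp_add_of_commute]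
    · rw [smul_neg, neg_add_cancel, NormedSpace.exp_zero]
    · exact ((Commute.refl L).neg_left.smul_left b).smul_right b
  calc T b = T b * (NormedSpace.exp (b • (-L)) * NormedSpace.exp (b • L)) := by rw [hinv, mul_one]
    _ = _ := by rw [← mul_assoc, hconst, one_mul]

variable {V : Type*} [AddCommGroup V] [Module ℂ V]

/-- `L` is the generator of the family `P`: the derivative of `t ↦ P t X` at `0` is `L X`, tested
against linear functionals. -/
def IsGenerator (P : ℝ≥0 → V →ₗ[ℂ] V) (L : V →ₗ[ℂ] V) : Prop :=
  ∀ (f : V →ₗ[ℂ] ℂ) (X : V),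
    HasDerivWithinAt (fun t : ℝ => f (P t.toNNReal X)) (f (L X)) (Set.Ici 0) 0

variable [FiniteDimensional ℂ V] {P P' : ℝ≥0 → V →ₗ[ℂ] V}

/-- The operator `X` in the coordinates of a basis. -/
def inCoordinates (X : V →ₗ[ℂ] V) :
    (Fin (Module.finrank ℂ V) → ℂ) →L[ℂ] (Fin (Module.finrank ℂ V) → ℂ) :=
  LinearMap.toContinuousLinearMap ((Module.finBasis ℂ V).equivFun.toLinearMap ∘ₗ X ∘ₗ
    (Module.finBasis ℂ V).equivFun.symm.toLinearMap)

theorem inCoordinates_apply (X : V →ₗ[ℂ] V) (y : Fin (Module.finrank ℂ V) → ℂ) :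
    inCoordinates X y =
      (Module.finBasis ℂ V).equivFun (X ((Module.finBasis ℂ V).equivFun.symm y)) := rfl

theorem inCoordinates_injective : Function.Injective (inCoordinates (V := V)) := by
  intro X Y h
  ext x
  have := congrArg (fun A => A ((Module.finBasis ℂ V).equivFun x)) h
  simpa only [inCoordinates_apply, LinearEquiv.symm_apply_apply,
    EmbeddingLike.apply_eq_iff_eq] using this

theorem exists_inCoordinates_eq_exp (h0 : P 0 = LinearMap.id)
    (hadd : ∀ s t, P (s + t) = P s ∘ₗ P t)
    (hc : ∀ (f : V →ₗ[ℂ] ℂ) (X : V), Continuous fun t => f (P t X)) :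
    ∃ L : (Fin (Module.finrank ℂ V) → ℂ) →L[ℂ] (Fin (Module.finrank ℂ V) → ℂ),
      ∀ t : ℝ, 0 ≤ t → inCoordinates (P t.toNNReal) = NormedSpace.exp (t • L) := by
  refine exists_eq_exp (T := fun t : ℝ => inCoordinates (P t.toNNReal)) ?_ ?_ ?_
  · rw [continuous_clm_apply]
    intro y
    refine continuous_pi fun i => ?_
    exact (hc ((Module.finBasis ℂ V).coord i) _).comp continuous_real_toNNReal
  · simp only [Real.toNNReal_zero, h0]
    ext y : 1
    rw [inCoordinates_apply, LinearMap.id_apply, LinearEquiv.apply_symm_apply]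
    rfl
  · intro s t hs ht
    simp only [Real.toNNReal_add hs ht, hadd]
    ext y : 1
    rw [mul_apply_eq_comp, inCoordinates_apply, inCoordinates_apply, inCoordinates_apply,
      LinearEquiv.symm_apply_apply, LinearMap.comp_apply]

theorem hasDerivWithinAt_of_inCoordinates
    {L : (Fin (Module.finrank ℂ V) → ℂ) →L[ℂ] (Fin (Module.finrank ℂ V) → ℂ)}
    (hL : ∀ t : ℝ, 0 ≤ t → inCoordinates (P t.toNNReal) = NormedSpace.exp (t • L))
    (f : V →ₗ[ℂ] ℂ) (X : V) :
    HasDerivWithinAt (fun t : ℝ => f (P t.toNNReal X))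
      (f ((Module.finBasis ℂ V).equivFun.symm (L ((Module.finBasis ℂ V).equivFun X))))
      (Set.Ici 0) 0 := by
  let g : (Fin (Module.finrank ℂ V) → ℂ) →L[ℂ] ℂ := LinearMap.toContinuousLinearMap
    (f ∘ₗ (Module.finBasis ℂ V).equivFun.symm.toLinearMap)
  let ev : ((Fin (Module.finrank ℂ V) → ℂ) →L[ℂ] (Fin (Module.finrank ℂ V) → ℂ)) →L[ℂ] ℂ :=
    g ∘L (ContinuousLinearMap.apply ℂ _ ((Module.finBasis ℂ V).equivFun X))
  have h1 := hasDerivAt_exp_smul_const (𝕂 := ℝ) L 0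
  rw [zero_smul, NormedSpace.exp_zero, one_mul] at h1
  have h2 := ((ev.restrictScalars ℝ).hasFDerivAt.comp_hasDerivAt (0 : ℝ) h1).hasDerivWithinAt
    (s := Set.Ici 0)
  have hev : ∀ t : ℝ, 0 ≤ t → f (P t.toNNReal X) = ev (NormedSpace.exp (t • L)) := by
    intro t ht
    rw [← hL t ht]
    change _ = f ((Module.finBasis ℂ V).equivFun.symm (inCoordinates _ _))
    rw [inCoordinates_apply, LinearEquiv.symm_apply_apply, LinearEquiv.symm_apply_apply]
  exact h2.congr (fun t ht => hev t ht) (hev 0 le_rfl)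

theorem exists_isGenerator (h0 : P 0 = LinearMap.id)
    (hadd : ∀ s t, P (s + t) = P s ∘ₗ P t)
    (hc : ∀ (f : V →ₗ[ℂ] ℂ) (X : V), Continuous fun t => f (P t X)) :
    ∃ L, IsGenerator P L := by
  obtain ⟨L, hL⟩ := exists_inCoordinates_eq_exp h0 hadd hc
  let M : V →ₗ[ℂ] V := (Module.finBasis ℂ V).equivFun.symm.toLinearMap ∘ₗ
    (L : (Fin (Module.finrank ℂ V) → ℂ) →ₗ[ℂ] (Fin (Module.finrank ℂ V) → ℂ)) ∘ₗ
    (Module.finBasis ℂ V).equivFun.toLinearMap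
  have hM : ∀ X, M X =
      (Module.finBasis ℂ V).equivFun.symm (L ((Module.finBasis ℂ V).equivFun X)) := fun _ => rfl
  refine ⟨M, fun f X => ?_⟩
  rw [hM]
  exact hasDerivWithinAt_of_inCoordinates hL f X

/-- A continuous semigroup is determined by its generator. -/
theorem eq_of_isGenerator (h0 : P 0 = LinearMap.id)
    (hadd : ∀ s t, P (s + t) = P s ∘ₗ P t)
    (hc : ∀ (f : V →ₗ[ℂ] ℂ) (X : V), Continuous fun t => f (P t X))
    (h0' : P' 0 = LinearMap.id) (hadd' : ∀ s t, P' (s + t) = P' s ∘ₗ P' t)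
    (hc' : ∀ (f : V →ₗ[ℂ] ℂ) (X : V), Continuous fun t => f (P' t X)) {L : V →ₗ[ℂ] V}
    (hP : IsGenerator P L) (hP' : IsGenerator P' L) : P = P' := by
  have key : ∀ {P : ℝ≥0 → V →ₗ[ℂ] V} {M}, IsGenerator P L →
      (∀ t : ℝ, 0 ≤ t → inCoordinates (P t.toNNReal) = NormedSpace.exp (t • M)) →
      M = inCoordinates L := by
    intro P M hP hM
    ext y i
    have h1 := hP ((Module.finBasis ℂ V).coord i) ((Module.finBasis ℂ V).equivFun.symm y)
    have h2 := hasDerivWithinAt_of_inCoordinates hM ((Module.finBasis ℂ V).coord i)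
      ((Module.finBasis ℂ V).equivFun.symm y)
    have h3 := (uniqueDiffWithinAt_Ici (0 : ℝ)).eq_deriv _ h2 h1
    rw [LinearEquiv.apply_symm_apply] at h3
    have h4 : ∀ v, (Module.finBasis ℂ V).coord i v = (Module.finBasis ℂ V).equivFun v i :=
      fun v => rfl
    rw [h4, h4, LinearEquiv.apply_symm_apply] at h3
    exact h3
  obtain ⟨M, hM⟩ := exists_inCoordinates_eq_exp h0 hadd hc
  obtain ⟨M', hM'⟩ := exists_inCoordinates_eq_exp h0' hadd' hc'
  funext t
  refine inCoordinates_injective ?_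
  have e1 := hM t t.2
  have e2 := hM' t t.2
  rw [Real.toNNReal_coe] at e1 e2
  rw [e1, e2, key hP hM, key hP' hM']

end Generators

section GIGGenerators

variable {H K : Type*}
  [NormedAddCommGroup H] [InnerProductSpace ℂ H] [FiniteDimensional ℂ H] [CompleteSpace H]
  [NormedAddCommGroup K] [InnerProductSpace ℂ K] [FiniteDimensional ℂ K]
  {Z : H →ₗ⋆[ℂ] Module.End ℂ K} {P P' : ℝ≥0 → arakiWyss Z →ₗ[ℂ] arakiWyss Z}

instance : FiniteDimensional ℂ (arakiWyss Z) :=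
  FiniteDimensional.of_injective (arakiWyssIncl Z) Subtype.val_injective

omit [CompleteSpace H] in
theorem IsGIGSemigroup.continuous_functional (hP : IsGIGSemigroup Z P)
    (f : arakiWyss Z →ₗ[ℂ] ℂ) (X : arakiWyss Z) : Continuous fun t => f (P t X) := by
  have hj : LinearMap.ker
      ((LinearMap.toContinuousLinearMap (𝕜 := ℂ) (E := K) (F' := K)).toLinearMap ∘ₗ
      arakiWyssIncl Z) = ⊥ := by
    rw [LinearMap.ker_eq_bot]
    exact LinearMap.toContinuousLinearMap.injective.comp Subtype.val_injective
  obtain ⟨g, hg⟩ := LinearMap.exists_leftInverse_of_injective _ hj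
  have h1 : ∀ Y : arakiWyss Z, f Y =
      (f ∘ₗ g) (LinearMap.toContinuousLinearMap (arakiWyssIncl Z Y)) := by
    intro Y
    exact congrArg f (LinearMap.congr_fun hg Y).symm
  simp_rw [h1]
  exact (LinearMap.continuous_of_finiteDimensional (f ∘ₗ g)).comp (hP.continuous X)

omit [CompleteSpace H] in
theorem IsGIGSemigroup.exists_isGenerator (hP : IsGIGSemigroup Z P) : ∃ L, IsGenerator P L :=
  GIG.exists_isGenerator hP.zero hP.add hP.continuous_functional

omit [CompleteSpace H] in
theorem IsGIGSemigroup.eq_of_isGenerator (hP : IsGIGSemigroup Z P) (hP' : IsGIGSemigroup Z P')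
    {L : arakiWyss Z →ₗ[ℂ] arakiWyss Z} (h : IsGenerator P L) (h' : IsGenerator P' L) : P = P' :=
  GIG.eq_of_isGenerator hP.zero hP.add hP.continuous_functional hP'.zero hP'.add
    hP'.continuous_functional h h'

end GIGGenerators

/-! ### Sesquilinear operator-valued forms without corner -/

section Corner

/-- A sesquilinear form that vanishes on orthogonal pairs is a multiple of the inner product. -/
theorem eq_inner_mul_of_orthogonal {H : Type*} [NormedAddCommGroup H] [InnerProductSpace ℂ H]
    (f : H →ₗ[ℂ] H →ₗ⋆[ℂ] ℂ) (hf : ∀ x w, ⟪w, x⟫_ℂ = 0 → f x w = 0) {e : H} (he : ‖e‖ = 1)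
    (x w : H) : f x w = ⟪w, x⟫_ℂ * f e e := by
  let g : H →ₗ[ℂ] H →ₗ⋆[ℂ] ℂ := f - f e e • (innerₛₗ ℂ).flip
  have hg : ∀ x w, g x w = f x w - f e e * ⟪w, x⟫_ℂ := fun x w => rfl
  have hee : ⟪e, e⟫_ℂ = 1 := by rw [inner_self_eq_norm_sq_to_K, he]; simp
  have hg0 : ∀ x w, ⟪w, x⟫_ℂ = 0 → g x w = 0 := by
    intro x w h
    rw [hg, hf x w h, h, mul_zero, sub_zero]
  have hge : g e e = 0 := by rw [hg, hee, mul_one, sub_self]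
  have hperp : ∀ z, ⟪e, z⟫_ℂ = 0 → g z z = 0 := by
    intro z hz
    have hz' : ⟪z, e⟫_ℂ = 0 := by rw [← inner_conj_symm, hz, map_zero]
    -- `‖z‖ e + z` and `‖z‖ e - z` are orthogonal
    have h1 : ⟪(‖z‖ : ℂ) • e + z, (‖z‖ : ℂ) • e - z⟫_ℂ = 0 := by
      simp only [inner_add_left, inner_sub_right, inner_smul_left, inner_smul_right, hz, hz', hee,
        inner_self_eq_norm_sq_to_K, Complex.conj_ofReal]
      simp
      ring
    have h2 := hg0 _ _ h1
    simp only [map_add, map_sub, LinearMap.sub_apply, map_smul, LinearMap.smul_apply,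
      LinearMap.map_smulₛₗ, hge, hg0 _ _ hz, hg0 _ _ hz', smul_zero, zero_sub, sub_zero,
      zero_add, neg_eq_zero] at h2
    exact h2
  have hdiag : ∀ x, g x x = 0 := by
    intro x
    set z := x - ⟪e, x⟫_ℂ • e with hz
    have hez : ⟪e, z⟫_ℂ = 0 := by rw [hz, inner_sub_right, inner_smul_right, hee, mul_one, sub_self]
    have hze : ⟪z, e⟫_ℂ = 0 := by rw [← inner_conj_symm, hez, map_zero]
    have hx : x = z + ⟪e, x⟫_ℂ • e := by rw [hz, sub_add_cancel]
    rw [hx]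
    simp only [map_add, LinearMap.add_apply, map_smul, LinearMap.smul_apply,
      LinearMap.map_smulₛₗ, hge, hg0 _ _ hez, hg0 _ _ hze, hperp z hez, smul_zero, add_zero]
  have := mem_of_forall_diag_mem g (p := ⊥) (fun x => by rw [hdiag x]; exact zero_mem _) x w
  rw [Submodule.mem_bot, hg, sub_eq_zero] at this
  rw [this, mul_comm]

theorem eq_zero_of_forall_real {h : ℂ → ℂ} (hd : Differentiable ℂ h) (h0 : ∀ r : ℝ, h r = 0)
    (z : ℂ) : h z = 0 := by
  have hfreq : ∃ᶠ w in nhdsWithin (0 : ℂ) {0}ᶜ, h w = 0 := by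
    have h1 : Filter.Tendsto (fun r : ℝ => (r : ℂ)) (nhdsWithin 0 {0}ᶜ) (nhdsWithin 0 {0}ᶜ) := by
      refine tendsto_nhdsWithin_iff.2 ⟨?_, ?_⟩
      · have := Complex.continuous_ofReal.tendsto (0 : ℝ)
        rw [Complex.ofReal_zero] at this
        exact this.mono_left nhdsWithin_le_nhds
      · filter_upwards [self_mem_nhdsWithin] with r hr
        simpa using hr
    refine h1.frequently ?_
    exact (Filter.Eventually.of_forall fun r => h0 r).frequently
  exact AnalyticOnNhd.eqOn_zero_of_preconnected_of_frequently_eq_zero (f := h)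
    (fun w _ => hd.analyticAt w) isPreconnected_univ (Set.mem_univ 0) hfreq (Set.mem_univ z)

/-- An entire function of two variables that vanishes on the pairs `(z, conj z)` is zero. -/
theorem eq_zero_of_forall_conj {f : ℂ → ℂ → ℂ} (hd : Differentiable ℂ fun z : ℂ × ℂ => f z.1 z.2)
    (h0 : ∀ z : ℂ, f z (starRingEnd ℂ z) = 0) (z w : ℂ) : f z w = 0 := by
  have hd' : ∀ a b : ℂ → ℂ, Differentiable ℂ a → Differentiable ℂ b →
      Differentiable ℂ fun t => f (a t) (b t) := fun a b ha hb => hd.comp (ha.prodMk hb)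
  have h1 : ∀ (s : ℝ) (t : ℂ), f (s + t * Complex.I) (s - t * Complex.I) = 0 := by
    intro s t
    refine eq_zero_of_forall_real (h := fun t => f (s + t * Complex.I) (s - t * Complex.I))
      (hd' _ _ (by fun_prop) (by fun_prop)) (fun r => ?_) t
    have := h0 (s + r * Complex.I)
    rwa [map_add, map_mul, Complex.conj_I, Complex.conj_ofReal, Complex.conj_ofReal, mul_neg,
      ← sub_eq_add_neg] at this
  have h2 : ∀ s t : ℂ, f (s + t * Complex.I) (s - t * Complex.I) = 0 := by
    intro s t
    exact eq_zero_of_forall_real (h := fun s => f (s + t * Complex.I) (s - t * Complex.I))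
      (hd' _ _ (by fun_prop) (by fun_prop)) (fun r => h1 r t) s
  have h3 := h2 ((z + w) / 2) ((z - w) / (2 * Complex.I))
  have e1 : (z + w) / 2 + (z - w) / (2 * Complex.I) * Complex.I = z := by
    field_simp
    ring
  have e2 : (z + w) / 2 - (z - w) / (2 * Complex.I) * Complex.I = w := by
    field_simp
    ring
  rwa [e1, e2] at h3

variable {H : Type*} [NormedAddCommGroup H] [InnerProductSpace ℂ H] [FiniteDimensional ℂ H]
  [CompleteSpace H]

omit [FiniteDimensional ℂ H] [CompleteSpace H] in
/-- If the operators `K u u` have no corner on the orthogonal complement of `u`, then neither has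
`K x y` between the orthogonal complements of `x` and `y`. The line `u = x + z (y - x)` passes
through `x` at `z = 0`, while `conj z` may be treated as an independent variable, in which the
line passes through `y` at `conj z = 1`. -/
theorem inner_eq_zero_of_corner {k : H →ₗ[ℂ] H →ₗ⋆[ℂ] (H →L[ℂ] H)}
    (hk : ∀ u p q : H, ⟪p, u⟫_ℂ = 0 → ⟪u, q⟫_ℂ = 0 → ⟪p, k u u q⟫_ℂ = 0)
    {x y p q : H} (hp : ⟪p, x⟫_ℂ = 0) (hq : ⟪y, q⟫_ℂ = 0) : ⟪p, k x y q⟫_ℂ = 0 := by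
  rcases eq_or_ne x 0 with rfl | hx
  · simp
  rcases eq_or_ne y 0 with rfl | hy
  · simp
  set b := y - x with hb
  let t : H → H → ℂ → ℂ → ℂ := fun p q z w => ⟪p, k x x q⟫_ℂ + z * ⟪p, k b x q⟫_ℂ +
    w * ⟪p, k x b q⟫_ℂ + z * w * ⟪p, k b b q⟫_ℂ
  let f : ℂ → ℂ → ℂ := fun z w =>
    (⟪x, x⟫_ℂ + z * ⟪x, b⟫_ℂ) * (⟪x, y⟫_ℂ + w * ⟪b, y⟫_ℂ) * t p q z w -
    (⟪x, x⟫_ℂ + z * ⟪x, b⟫_ℂ) * (⟪x, q⟫_ℂ + w * ⟪b, q⟫_ℂ) * t p y z w -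
    (⟪p, x⟫_ℂ + z * ⟪p, b⟫_ℂ) * (⟪x, y⟫_ℂ + w * ⟪b, y⟫_ℂ) * t x q z w +
    (⟪p, x⟫_ℂ + z * ⟪p, b⟫_ℂ) * (⟪x, q⟫_ℂ + w * ⟪b, q⟫_ℂ) * t x y z w
  have hd : Differentiable ℂ fun z : ℂ × ℂ => f z.1 z.2 := by
    simp only [f, t]
    fun_prop
  have ht : ∀ p q z, t p q z (starRingEnd ℂ z) = ⟪p, k (x + z • b) (x + z • b) q⟫_ℂ := by
    intro p q z
    simp only [t, map_add, LinearMap.add_apply, map_smul, LinearMap.smul_apply,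
      LinearMap.map_smulₛₗ, add_apply, smul_apply, inner_add_right, inner_smul_right]
    ring
  have hf : ∀ z, f z (starRingEnd ℂ z) = 0 := by
    intro z
    set u := x + z • b with hu
    have h1 := hk u (starRingEnd ℂ ⟪x, u⟫_ℂ • p - starRingEnd ℂ ⟪p, u⟫_ℂ • x)
      (⟪u, y⟫_ℂ • q - ⟪u, q⟫_ℂ • y)
      (by rw [inner_sub_left, inner_smul_left, inner_smul_left, Complex.conj_conj,
            Complex.conj_conj]; ring)
      (by rw [inner_sub_right, inner_smul_right, inner_smul_right]; ring)
    have e1 : ∀ a, ⟪a, x⟫_ℂ + z * ⟪a, b⟫_ℂ = ⟪a, u⟫_ℂ := fun a => by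
      rw [hu, inner_add_right, inner_smul_right]
    have e2 : ∀ a, ⟪x, a⟫_ℂ + starRingEnd ℂ z * ⟪b, a⟫_ℂ = ⟪u, a⟫_ℂ := fun a => by
      rw [hu, inner_add_left, inner_smul_left]
    simp only [f, e1, e2, ht]
    simp only [map_sub, map_smul, inner_sub_left, inner_sub_right, inner_smul_left,
      inner_smul_right, Complex.conj_conj] at h1
    rw [← h1]
    ring
  have h1 := eq_zero_of_forall_conj hd hf 0 1
  have e1 : ⟪x, y⟫_ℂ + ⟪b, y⟫_ℂ = ⟪y, y⟫_ℂ := by rw [← inner_add_left, hb, add_sub_cancel]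
  have e2 : ⟪x, q⟫_ℂ + ⟪b, q⟫_ℂ = 0 := by rw [← inner_add_left, hb, add_sub_cancel, hq]
  have e3 : ⟪p, k x x q⟫_ℂ + ⟪p, k x b q⟫_ℂ = ⟪p, k x y q⟫_ℂ := by
    rw [← inner_add_right, ← add_apply, ← map_add, hb, add_sub_cancel]
  simp only [f, t, zero_mul, add_zero, one_mul, e1, e2, e3, hp, mul_zero, sub_zero] at h1
  exact (mul_eq_zero.1 h1).resolve_left
    (mul_ne_zero (inner_self_ne_zero.2 hx) (inner_self_ne_zero.2 hy))

/-- A hermitian operator-valued form `k` such that every `k u u` has no corner on the orthogonal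
complement of `u` is of the form `k x x = |G x⟩⟨x| + |x⟩⟨G x|`, with a linear `G`. -/
theorem exists_rankOne_of_corner {k : H →ₗ[ℂ] H →ₗ⋆[ℂ] (H →L[ℂ] H)}
    (hstar : ∀ x y, star (k x y) = k y x)
    (hk : ∀ u p q : H, ⟪p, u⟫_ℂ = 0 → ⟪u, q⟫_ℂ = 0 → ⟪p, k u u q⟫_ℂ = 0) :
    ∃ G : H →L[ℂ] H, ∀ x, k x x =
      InnerProductSpace.rankOne ℂ (G x) x + InnerProductSpace.rankOne ℂ x (G x) := by
  rcases subsingleton_or_nontrivial H with hH | hH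
  · exact ⟨0, fun x => by ext y; exact Subsingleton.elim _ _⟩
  obtain ⟨e, he⟩ := exists_norm_eq H (zero_le_one (α := ℝ))
  have hee : ⟪e, e⟫_ℂ = 1 := by rw [inner_self_eq_norm_sq_to_K, he]; simp
  have hconj : ∀ a b x y, starRingEnd ℂ ⟪a, k x y b⟫_ℂ = ⟪b, k y x a⟫_ℂ := by
    intro a b x y
    rw [inner_conj_symm, ← inner_star_right, hstar]
  -- the form `(x, p) ↦ ⟪p, k x y q⟫`, for `q` orthogonal to `y`
  have h1 : ∀ x y p q, ⟪y, q⟫_ℂ = 0 → ⟪p, k x y q⟫_ℂ = ⟪p, x⟫_ℂ * ⟪e, k e y q⟫_ℂ := by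
    intro x y p q hq
    let f : H →ₗ[ℂ] H →ₗ⋆[ℂ] ℂ := LinearMap.mk₂'ₛₗ (RingHom.id ℂ) (starRingEnd ℂ)
      (fun x p => ⟪p, k x y q⟫_ℂ) (by intros; simp) (by intros; simp) (by intros; simp)
      (by intros; simp [mul_comm])
    exact eq_inner_mul_of_orthogonal f (fun x p hp => inner_eq_zero_of_corner hk hp hq) he x p
  have h2 : ∀ x y p q, ⟪p, k x y q⟫_ℂ = ⟪p, x⟫_ℂ * ⟪e, k e y q⟫_ℂ +
      ⟪y, q⟫_ℂ * (⟪p, k x e e⟫_ℂ - ⟪p, x⟫_ℂ * ⟪e, k e e e⟫_ℂ) := by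
    intro x y p q
    let f : H →ₗ[ℂ] H →ₗ⋆[ℂ] ℂ := LinearMap.mk₂'ₛₗ (RingHom.id ℂ) (starRingEnd ℂ)
      (fun q y => ⟪p, k x y q⟫_ℂ - ⟪p, x⟫_ℂ * ⟪e, k e y q⟫_ℂ)
      (by intros; simp only [map_add, inner_add_right]; ring)
      (by intros; simp only [map_smul, inner_smul_right, RingHom.id_apply, smul_eq_mul]; ring)
      (by intros; simp only [map_add, add_apply, inner_add_right]; ring)
      (by
        intros
        simp only [LinearMap.map_smulₛₗ, smul_apply, inner_smul_right, smul_eq_mul]; ring)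
    have h3 := eq_inner_mul_of_orthogonal f
      (fun q y hq => sub_eq_zero.2 (h1 x y p q hq)) he q y
    have h4 : ∀ q y, f q y = ⟪p, k x y q⟫_ℂ - ⟪p, x⟫_ℂ * ⟪e, k e y q⟫_ℂ := fun _ _ => rfl
    rw [h4, h4] at h3
    rw [← h3]
    ring
  set c := ⟪e, k e e e⟫_ℂ with hc
  have hcc : starRingEnd ℂ c = c := hconj e e e e
  let G : H →L[ℂ] H := LinearMap.toContinuousLinearMap
    { toFun := fun x => k x e e - (c / 2) • x
      map_add' := fun x y => by simp only [map_add, LinearMap.add_apply, add_apply, smul_add]; abel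
      map_smul' := fun a x => by
        simp only [map_smul, LinearMap.smul_apply, smul_apply, smul_sub, RingHom.id_apply,
          smul_comm a (c / 2)] }
  have hG : ∀ x, G x = k x e e - (c / 2) • x := fun _ => rfl
  refine ⟨G, fun x => ?_⟩
  ext q
  refine ext_inner_left ℂ fun p => ?_
  have h5 : ⟪e, k e x q⟫_ℂ = starRingEnd ℂ ⟪q, k x e e⟫_ℂ := (hconj _ _ _ _).symm
  rw [h2, h5, add_apply, inner_add_right, InnerProductSpace.rankOne_apply,
    InnerProductSpace.rankOne_apply, inner_smul_right, inner_smul_right,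
    ← inner_conj_symm (G x) q, hG, inner_sub_right, inner_sub_right, inner_smul_right,
    inner_smul_right, map_sub, map_mul, map_div₀, hcc, inner_conj_symm x q, map_ofNat]
  ring

end Corner

/-! ### Affine families of Gaussian states -/

section Lines

variable {H K : Type*}
  [NormedAddCommGroup H] [InnerProductSpace ℂ H] [FiniteDimensional ℂ H] [CompleteSpace H]
  [NormedAddCommGroup K] [InnerProductSpace ℂ K] [FiniteDimensional ℂ K]
  {Z : H →ₗ⋆[ℂ] Module.End ℂ K}

/-- The operator `|x⟩⟨x|`. -/
abbrev proj (x : H) : H →L[ℂ] H := InnerProductSpace.rankOne ℂ x x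

omit [FiniteDimensional ℂ H] [CompleteSpace H] in
theorem proj_nonneg (x : H) : 0 ≤ proj x := by
  refine nonneg_of_forall_inner fun y => ?_
  rw [InnerProductSpace.rankOne_apply, inner_smul_right, ← inner_conj_symm y x, mul_comm,
    ← Complex.normSq_eq_conj_mul_self]
  exact_mod_cast Complex.normSq_nonneg _

omit [FiniteDimensional ℂ H] in
theorem proj_le_one {x : H} (hx : ‖x‖ = 1) : proj x ≤ 1 :=
  (InnerProductSpace.isStarProjection_rankOne_self hx).le_one

omit [FiniteDimensional ℂ H] in
theorem ofReal_smul_le {A B : H →L[ℂ] H} (h : A ≤ B) {s : ℝ} (hs : 0 ≤ s) :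
    (s : ℂ) • A ≤ (s : ℂ) • B := by
  rw [ContinuousLinearMap.le_def, ← ContinuousLinearMap.nonneg_iff_isPositive] at h ⊢
  rw [← smul_sub]
  exact smul_nonneg (by exact_mod_cast hs) h

omit [FiniteDimensional ℂ H] in
theorem ofReal_smul_nonneg {A : H →L[ℂ] H} (h : 0 ≤ A) {s : ℝ} (hs : 0 ≤ s) : 0 ≤ (s : ℂ) • A := by
  simpa using ofReal_smul_le h hs

omit [FiniteDimensional ℂ H] in
theorem ofReal_smul_le_self {A : H →L[ℂ] H} (h : 0 ≤ A) {s : ℝ} (hs : s ≤ 1) :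
    (s : ℂ) • A ≤ A := by
  have := ofReal_smul_nonneg h (sub_nonneg.2 hs)
  rw [ContinuousLinearMap.le_def, ← ContinuousLinearMap.nonneg_iff_isPositive]
  convert this using 1
  push_cast
  module

omit [FiniteDimensional ℂ H] [CompleteSpace H] in
theorem inner_self_of_norm {x : H} (hx : ‖x‖ = 1) : ⟪x, x⟫_ℂ = 1 := by
  rw [inner_self_eq_norm_sq_to_K, hx]; simp

omit [FiniteDimensional ℂ H] [CompleteSpace H] in
theorem inner_apply_comm_of_nonneg {Q : H →L[ℂ] H} (hQ : 0 ≤ Q) (φ ψ : H) :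
    ⟪Q φ, ψ⟫_ℂ = ⟪φ, Q ψ⟫_ℂ :=
  ((ContinuousLinearMap.nonneg_iff_isPositive Q).1 hQ).isSymmetric φ ψ

variable (hZ : IsCARField Z) (hirr : IsIrreducibleField Z)
include hZ hirr

/-- The Gaussian states whose symbols differ only in the occupation of the mode `x`, in terms of
the one in which this mode is maximally mixed. -/
theorem gaussianDensity_add_smul_proj {Q : H →L[ℂ] H} {x : H} (hx : ‖x‖ = 1) (hQ : 0 ≤ Q)
    (hQx1 : Q + proj x ≤ 1) (hQx : Q x = 0) {s : ℝ} (h0 : 0 ≤ s) (h1 : s ≤ 1) :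
    gaussianDensity Z (Q + (s : ℂ) • proj x) =
      gaussianDensity Z (Q + (1 / 2 : ℂ) • proj x) *
        ((2 * s : ℂ) • occ Z x + (2 - 2 * s : ℂ) • (1 - occ Z x)) := by
  have hh : ((1 / 2 : ℝ) : ℂ) = 1 / 2 := by norm_num
  have hp := proj_nonneg x
  have hpos : 0 ≤ Q + (1 / 2 : ℂ) • proj x := by
    rw [← hh]; exact add_nonneg hQ (ofReal_smul_nonneg hp (by norm_num))
  have hle : Q + (1 / 2 : ℂ) • proj x ≤ 1 := by
    rw [← hh]
    exact (add_le_add le_rfl (ofReal_smul_le_self hp (by norm_num))).trans hQx1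
  have hmid : (Q + (1 / 2 : ℂ) • proj x) x = (1 / 2 : ℂ) • x := by
    rw [add_apply, hQx, smul_apply, InnerProductSpace.rankOne_apply, inner_self_of_norm hx,
      one_smul, zero_add]
  have h2 := (isQuasiFree_gaussianDensity hZ hirr hpos hle).update hZ
    (inner_apply_comm_of_nonneg hpos) hx hmid h0 h1
  have h3 : Q + (1 / 2 : ℂ) • proj x + ((s : ℂ) - 1 / 2) • proj x = Q + (s : ℂ) • proj x := by
    module
  rw [h3] at h2
  exact ((h2.isGaussianWithSymbol hZ).eq_gaussianDensity hZ hirr).symm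

/-- The Gaussian density matrix is an affine function of the occupation of a mode. -/
theorem gaussianDensity_line {Q : H →L[ℂ] H} {x : H} (hx : ‖x‖ = 1) (hQ : 0 ≤ Q)
    (hQx1 : Q + proj x ≤ 1) (hQx : Q x = 0) {s : ℝ} (h0 : 0 ≤ s) (h1 : s ≤ 1) :
    gaussianDensity Z (Q + (s : ℂ) • proj x) =
      (1 - s : ℂ) • gaussianDensity Z Q + (s : ℂ) • gaussianDensity Z (Q + proj x) := by
  have e0 := gaussianDensity_add_smul_proj hZ hirr hx hQ hQx1 hQx le_rfl zero_le_one
  have e1 := gaussianDensity_add_smul_proj hZ hirr hx hQ hQx1 hQx zero_le_one le_rfl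
  rw [Complex.ofReal_zero, zero_smul, add_zero] at e0
  rw [Complex.ofReal_one, one_smul] at e1
  rw [gaussianDensity_add_smul_proj hZ hirr hx hQ hQx1 hQx h0 h1, e0, e1, ← mul_smul_comm,
    ← mul_smul_comm, ← mul_add]
  congr 1
  module

/-- Adding a particle to the vacuum. -/
theorem gaussianDensity_proj {x : H} (hx : ‖x‖ = 1) :
    gaussianDensity Z (proj x) = star (Z x) * gaussianDensity Z 0 * Z x := by
  have hp := proj_nonneg x
  have hle : (0 : H →L[ℂ] H) + proj x ≤ 1 := by rw [zero_add]; exact proj_le_one hx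
  have e0 := gaussianDensity_add_smul_proj hZ hirr hx le_rfl hle rfl le_rfl zero_le_one
  have e1 := gaussianDensity_add_smul_proj hZ hirr hx le_rfl hle rfl zero_le_one le_rfl
  rw [Complex.ofReal_zero, zero_smul, add_zero] at e0
  rw [Complex.ofReal_one, one_smul, zero_add] at e1
  have hh : ((1 / 2 : ℝ) : ℂ) = 1 / 2 := by norm_num
  have hmid : ((0 : H →L[ℂ] H) + (1 / 2 : ℂ) • proj x) x = (1 / 2 : ℂ) • x := by
    rw [add_apply, zero_apply, smul_apply, InnerProductSpace.rankOne_apply, inner_self_of_norm hx,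
      one_smul, zero_add]
  have hcomm := (isQuasiFree_gaussianDensity hZ hirr (Q := 0 + (1 / 2 : ℂ) • proj x)
    (by rw [← hh, zero_add]; exact ofReal_smul_nonneg hp (by norm_num))
    (by
      rw [← hh]
      exact (add_le_add le_rfl (ofReal_smul_le_self hp (by norm_num))).trans hle)).mul_star_of_half
    hmid
  rw [e0, e1]
  generalize gaussianDensity Z (0 + (1 / 2 : ℂ) • proj x) = D at hcomm
  have h2 : (1 - occ Z x) * Z x = Z x := by
    rw [sub_mul, one_mul, occ_mul_Z hZ, sub_zero]
  simp only [mul_zero, zero_smul, zero_add, mul_one, sub_self, add_zero, sub_zero,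
    mul_smul_comm, smul_mul_assoc, ← mul_assoc, ← hcomm]
  rw [mul_assoc, h2, mul_assoc]
  rfl

/-- The sum of the two Gaussian densities obtained by filling one of two orthogonal modes depends
on the plane spanned by the modes only. -/
theorem gaussianDensity_plane {Q : H →L[ℂ] H} {x z : H} (hx : ‖x‖ = 1) (hz : ‖z‖ = 1)
    (hxz : ⟪x, z⟫_ℂ = 0) (hQ : 0 ≤ Q) (hQ1 : Q + (proj x + proj z) ≤ 1) (hQx : Q x = 0)
    (hQz : Q z = 0) :
    gaussianDensity Z (Q + proj x) + gaussianDensity Z (Q + proj z) =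
      (4 : ℂ) • gaussianDensity Z (Q + (1 / 2 : ℂ) • (proj x + proj z)) - gaussianDensity Z Q -
        gaussianDensity Z (Q + (proj x + proj z)) := by
  have hh : ((1 / 2 : ℝ) : ℂ) = 1 / 2 := by norm_num
  have hzx : ⟪z, x⟫_ℂ = 0 := by rw [← inner_conj_symm, hxz, map_zero]
  have hxp := proj_nonneg x
  have hzp := proj_nonneg z
  have hx1 : Q + proj x ≤ 1 :=
    le_trans (add_le_add le_rfl (le_add_of_nonneg_right hzp)) hQ1
  have hz1 : Q + proj z ≤ 1 :=
    le_trans (add_le_add le_rfl (le_add_of_nonneg_left hxp)) hQ1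
  have hz2 : Q + proj x + proj z ≤ 1 := by rwa [add_assoc]
  have hpz : proj x z = 0 := by rw [InnerProductSpace.rankOne_apply, hxz, zero_smul]
  have hz3 : Q + (1 / 2 : ℂ) • proj x + proj z ≤ 1 := by
    refine le_trans ?_ hz2
    rw [← hh]
    exact add_le_add (add_le_add le_rfl (ofReal_smul_le_self hxp (by norm_num))) le_rfl
  have hpos : 0 ≤ Q + (1 / 2 : ℂ) • proj x := by
    rw [← hh]; exact add_nonneg hQ (ofReal_smul_nonneg hxp (by norm_num))
  have e1 := gaussianDensity_line hZ hirr hz hpos hz3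
    (by rw [add_apply, hQz, smul_apply, hpz, smul_zero, zero_add]) (s := 1 / 2) (by norm_num)
    (by norm_num)
  have e2 := gaussianDensity_line hZ hirr hx hQ hx1 hQx (s := 1 / 2) (by norm_num)
    (by norm_num)
  have e3 := gaussianDensity_line hZ hirr hx (add_nonneg hQ hzp)
    (by rw [add_assoc, add_comm (proj z)]; exact hQ1)
    (by rw [add_apply, hQx, InnerProductSpace.rankOne_apply, hzx, zero_smul, zero_add])
    (s := 1 / 2) (by norm_num) (by norm_num)
  rw [hh] at e1 e2 e3
  have e4 : Q + (1 / 2 : ℂ) • proj x + proj z = Q + proj z + (1 / 2 : ℂ) • proj x := by abel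
  have e5 : Q + (1 / 2 : ℂ) • (proj x + proj z) =
      Q + (1 / 2 : ℂ) • proj x + (1 / 2 : ℂ) • proj z := by module
  have e6 : Q + proj z + proj x = Q + (proj x + proj z) := by abel
  rw [e6] at e3
  rw [e5, e1, e4, e2, e3]
  module

/-! ### The drift of the symbol -/

omit [NormedAddCommGroup K] [InnerProductSpace ℂ K] [FiniteDimensional ℂ K] hZ hirr
  [FiniteDimensional ℂ H] [CompleteSpace H] in
/-- Two orthonormal vectors can be rotated in the plane that they span in such a way that the
first one becomes orthogonal to a given vector `w`. -/
theorem exists_rotation {x z : H} (hx : ‖x‖ = 1) (hz : ‖z‖ = 1) (hxz : ⟪x, z⟫_ℂ = 0) (w : H) :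
    ∃ x' z' : H, ‖x'‖ = 1 ∧ ‖z'‖ = 1 ∧ ⟪x', z'⟫_ℂ = 0 ∧ proj x' + proj z' = proj x + proj z ∧
      ⟪w, x'⟫_ℂ = 0 ∧ x' ∈ Submodule.span ℂ {x, z} ∧ z' ∈ Submodule.span ℂ {x, z} := by
  have hxs : x ∈ Submodule.span ℂ {x, z} := Submodule.subset_span (by simp)
  have hzs : z ∈ Submodule.span ℂ {x, z} := Submodule.subset_span (by simp)
  rcases eq_or_ne ⟪w, x⟫_ℂ 0 with hw | hw
  · exact ⟨x, z, hx, hz, hxz, rfl, hw, hxs, hzs⟩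
  have hzx : ⟪z, x⟫_ℂ = 0 := by rw [← inner_conj_symm, hxz, map_zero]
  have hxx := inner_self_of_norm hx
  have hzz := inner_self_of_norm hz
  set N : ℝ := Complex.normSq ⟪w, z⟫_ℂ + Complex.normSq ⟪w, x⟫_ℂ with hN
  have hNpos : 0 < N := add_pos_of_nonneg_of_pos (Complex.normSq_nonneg _)
    (Complex.normSq_pos.2 hw)
  have hr : ((√N : ℝ) : ℂ) ≠ 0 := by exact_mod_cast (Real.sqrt_pos.2 hNpos).ne'
  have hr2 : ((√N : ℝ) : ℂ) * (√N : ℝ) = N := by exact_mod_cast Real.mul_self_sqrt hNpos.le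
  set a : ℂ := ⟪w, z⟫_ℂ / (√N : ℝ) with ha
  set b : ℂ := ⟪w, x⟫_ℂ / (√N : ℝ) with hb
  have hab : a * starRingEnd ℂ a + b * starRingEnd ℂ b = 1 := by
    rw [ha, hb, map_div₀, map_div₀, Complex.conj_ofReal, div_mul_div_comm, div_mul_div_comm, hr2,
      ← add_div, Complex.mul_conj, Complex.mul_conj, ← Complex.ofReal_add, ← hN, div_self]
    exact_mod_cast hNpos.ne'
  have hnorm : ∀ v : H, ⟪v, v⟫_ℂ = 1 → ‖v‖ = 1 := by
    intro v hv
    have : (‖v‖ : ℂ) ^ 2 = 1 := by rw [← hv, inner_self_eq_norm_sq_to_K]; rfl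
    have h2 : ‖v‖ ^ 2 = 1 := by exact_mod_cast this
    nlinarith [norm_nonneg v]
  refine ⟨a • x - b • z, starRingEnd ℂ b • x + starRingEnd ℂ a • z, hnorm _ ?_, hnorm _ ?_, ?_, ?_,
    ?_, Submodule.sub_mem _ (Submodule.smul_mem _ _ hxs) (Submodule.smul_mem _ _ hzs),
    Submodule.add_mem _ (Submodule.smul_mem _ _ hxs) (Submodule.smul_mem _ _ hzs)⟩
  · simp only [inner_sub_left, inner_sub_right, inner_smul_left, inner_smul_right, hxx, hzz, hxz,
      hzx]
    linear_combination hab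
  · simp only [inner_add_left, inner_add_right, inner_smul_left, inner_smul_right, hxx, hzz, hxz,
      hzx, Complex.conj_conj]
    linear_combination hab
  · simp only [inner_sub_left, inner_add_right, inner_smul_left, inner_smul_right, hxx, hzz, hxz,
      hzx]
    ring
  · ext y
    simp only [add_apply, InnerProductSpace.rankOne_apply, inner_sub_left, inner_add_left,
      inner_smul_left, Complex.conj_conj]
    rw [← one_smul ℂ (⟪x, y⟫_ℂ • x + ⟪z, y⟫_ℂ • z), ← hab]
    module
  · rw [inner_sub_right, inner_smul_right, inner_smul_right, ha, hb]
    ring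

section Drift

variable {F : Module.End ℂ K →ₗ[ℂ] (H →L[ℂ] H)}
  (hcorner : ∀ (Q : H →L[ℂ] H) (x p q : H), ‖x‖ = 1 → 0 ≤ Q → Q + proj x ≤ 1 → Q x = 0 →
    ⟪p, x⟫_ℂ = 0 → ⟪x, q⟫_ℂ = 0 →
    ⟪p, (F (gaussianDensity Z (Q + proj x)) - F (gaussianDensity Z Q)) q⟫_ℂ = 0)
include hcorner

/-- The second differences of the drift vanish: they depend only on the plane spanned by the two
modes, and have no corner on the orthogonal complement of any vector of this plane. -/
theorem drift_add_drift {Q : H →L[ℂ] H} {x z : H} (hx : ‖x‖ = 1) (hz : ‖z‖ = 1)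
    (hxz : ⟪x, z⟫_ℂ = 0) (hQ : 0 ≤ Q) (hQ1 : Q + (proj x + proj z) ≤ 1) (hQx : Q x = 0)
    (hQz : Q z = 0) :
    F (gaussianDensity Z (Q + (proj x + proj z))) + F (gaussianDensity Z Q) =
      F (gaussianDensity Z (Q + proj x)) + F (gaussianDensity Z (Q + proj z)) := by
  rw [← sub_eq_zero]
  set Δ := F (gaussianDensity Z (Q + (proj x + proj z))) + F (gaussianDensity Z Q) -
    (F (gaussianDensity Z (Q + proj x)) + F (gaussianDensity Z (Q + proj z))) with hΔ
  have hzero : (Δ : H →ₗ[ℂ] H) = 0 := by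
    rw [← inner_map_self_eq_zero]
    intro w
    obtain ⟨x', z', hx', hz', hxz', hP, hw, hxs, hzs⟩ := exists_rotation hx hz hxz w
    have hker : Submodule.span ℂ {x, z} ≤ LinearMap.ker (Q : H →ₗ[ℂ] H) := by
      rw [Submodule.span_le]
      rintro y (rfl | rfl)
      · exact hQx
      · exact hQz
    have hQx' : Q x' = 0 := hker hxs
    have hQz' : Q z' = 0 := hker hzs
    have hzx' : ⟪z', x'⟫_ℂ = 0 := by rw [← inner_conj_symm, hxz', map_zero]
    have hw' : ⟪x', w⟫_ℂ = 0 := by rw [← inner_conj_symm, hw, map_zero]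
    have hQ1' : Q + (proj x' + proj z') ≤ 1 := by rwa [hP]
    have e1 := congrArg F (gaussianDensity_plane hZ hirr hx hz hxz hQ hQ1 hQx hQz)
    have e2 := congrArg F (gaussianDensity_plane hZ hirr hx' hz' hxz' hQ hQ1' hQx' hQz')
    rw [hP, ← e1, map_add, map_add] at e2
    have e3 : Δ = (F (gaussianDensity Z (Q + proj z' + proj x')) -
        F (gaussianDensity Z (Q + proj z'))) -
        (F (gaussianDensity Z (Q + proj x')) - F (gaussianDensity Z Q)) := by
      have e4 : Q + proj z' + proj x' = Q + (proj x + proj z) := by rw [← hP]; abel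
      rw [hΔ, ← e2, e4]
      abel
    have c1 := hcorner (Q + proj z') x' w w hx' (add_nonneg hQ (proj_nonneg _))
      (by rwa [add_assoc, add_comm (proj z')])
      (by rw [add_apply, hQx', InnerProductSpace.rankOne_apply, hzx', zero_smul, zero_add]) hw hw'
    have c2 := hcorner Q x' w w hx' hQ
      (le_trans (add_le_add le_rfl (le_add_of_nonneg_right (proj_nonneg z'))) hQ1') hQx' hw hw'
    rw [← inner_conj_symm]
    change starRingEnd ℂ ⟪w, Δ w⟫_ℂ = 0
    rw [e3, sub_apply, inner_sub_right, c1, c2, sub_zero, map_zero]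
  exact ContinuousLinearMap.coe_injective hzero

/-- Because the second differences of the drift vanish, modes can be filled one by one and their
contributions add up. -/
theorem drift_diagonal {ι : Type*} [Fintype ι] (b : OrthonormalBasis ι ℂ H) {r : ι → ℝ}
    (h0 : ∀ i, 0 ≤ r i) (h1 : ∀ i, r i ≤ 1) (s : Finset ι) :
    F (gaussianDensity Z (∑ i ∈ s, (r i : ℂ) • proj (b i))) = F (gaussianDensity Z 0) +
      ∑ i ∈ s, (r i : ℂ) • (F (gaussianDensity Z (proj (b i))) - F (gaussianDensity Z 0)) := by
  classical
  have hpos : ∀ s : Finset ι, 0 ≤ ∑ i ∈ s, (r i : ℂ) • proj (b i) := fun s =>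
    Finset.sum_nonneg fun i _ => ofReal_smul_nonneg (proj_nonneg _) (h0 i)
  have hle : ∀ s t : Finset ι, Disjoint s t →
      ∑ i ∈ s, (r i : ℂ) • proj (b i) + ∑ i ∈ t, proj (b i) ≤ 1 := by
    intro s t hst
    calc _ ≤ ∑ i ∈ s, proj (b i) + ∑ i ∈ t, proj (b i) := add_le_add
          (Finset.sum_le_sum fun i _ => ofReal_smul_le_self (proj_nonneg _) (h1 i)) le_rfl
      _ = ∑ i ∈ s ∪ t, proj (b i) := (Finset.sum_union hst).symm
      _ ≤ ∑ i, proj (b i) := Finset.sum_le_sum_of_subset_of_nonneg (Finset.subset_univ _)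
          fun i _ _ => proj_nonneg _
      _ = 1 := sum_rankOne_eq_one b
  have hker : ∀ (s : Finset ι) (k : ι), k ∉ s → (∑ i ∈ s, (r i : ℂ) • proj (b i)) (b k) = 0 := by
    intro s k hk
    rw [sum_apply]
    refine Finset.sum_eq_zero fun i hi => ?_
    rw [smul_apply, InnerProductSpace.rankOne_apply,
      b.inner_eq_zero (show i ≠ k from fun h => hk (h ▸ hi)), zero_smul, smul_zero]
  have hstep : ∀ (s : Finset ι) (k : ι), k ∉ s →
      F (gaussianDensity Z (∑ i ∈ s, (r i : ℂ) • proj (b i) + proj (b k))) -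
        F (gaussianDensity Z (∑ i ∈ s, (r i : ℂ) • proj (b i))) =
      F (gaussianDensity Z (proj (b k))) - F (gaussianDensity Z 0) := by
    intro s
    induction s using Finset.induction_on with
    | empty => intro k _; simp
    | insert j s hj ih =>
      intro k hk
      have hkj : k ≠ j := fun h => hk (h ▸ Finset.mem_insert_self _ _)
      have hks : k ∉ s := fun h => hk (Finset.mem_insert_of_mem h)
      set Q := ∑ i ∈ s, (r i : ℂ) • proj (b i) with hQ
      have hjk : Q + (proj (b j) + proj (b k)) ≤ 1 := by
        have := hle s {j, k} (by simp [hj, hks])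
        rwa [Finset.sum_pair hkj.symm] at this
      have hQj : Q + proj (b j) ≤ 1 := by
        have := hle s {j} (by simpa using hj)
        rwa [Finset.sum_singleton] at this
      have e1 := congrArg F (gaussianDensity_line hZ hirr (b.orthonormal.1 j) (hpos s) hQj
        (hker s j hj) (h0 j) (h1 j))
      have e2 := congrArg F (gaussianDensity_line hZ hirr (b.orthonormal.1 j)
        (add_nonneg (hpos s) (proj_nonneg (b k)))
        (by rw [← hQ, add_assoc, add_comm (proj (b k))]; exact hjk)
        (by
          rw [add_apply, hker s j hj, InnerProductSpace.rankOne_apply, b.inner_eq_zero hkj,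
            zero_smul, zero_add]) (h0 j) (h1 j))
      have e3 := drift_add_drift hZ hirr hcorner (b.orthonormal.1 j) (b.orthonormal.1 k)
        (b.inner_eq_zero hkj.symm) (hpos s) hjk (hker s j hj) (hker s k hks)
      rw [Finset.sum_insert hj, ← hQ, add_comm ((r j : ℂ) • proj (b j)) Q, e1,
        add_right_comm, e2, ← ih k hks]
      rw [← hQ, add_assoc Q (proj (b k)), add_comm (proj (b k))]
      simp only [map_add, map_smul]
      rw [eq_sub_of_add_eq e3]
      module
  induction s using Finset.induction_on with
  | empty => simp
  | insert k s hk ih =>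
    have hQk : ∑ i ∈ s, (r i : ℂ) • proj (b i) + proj (b k) ≤ 1 := by
      have := hle s {k} (by simpa using hk)
      rwa [Finset.sum_singleton] at this
    have e1 := congrArg F (gaussianDensity_line hZ hirr (b.orthonormal.1 k) (hpos s) hQk
      (hker s k hk) (h0 k) (h1 k))
    have e2 := hstep s k hk
    rw [Finset.sum_insert hk, Finset.sum_insert hk, add_comm ((r k : ℂ) • proj (b k)), e1, ← e2]
    simp only [map_add, map_smul]
    rw [ih]
    module

/-- The drift of the symbol is an affine function of the symbol, of the form
`Q ↦ A + G Q + Q G*`. -/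
theorem exists_drift (hself : ∀ Q : H →L[ℂ] H, 0 ≤ Q → Q ≤ 1 →
      star (F (gaussianDensity Z Q)) = F (gaussianDensity Z Q)) :
    ∃ G : H →L[ℂ] H, ∀ Q : H →L[ℂ] H, 0 ≤ Q → Q ≤ 1 →
      F (gaussianDensity Z Q) = F (gaussianDensity Z 0) + G * Q + Q * star G := by
  set A := F (gaussianDensity Z 0) with hA
  let k : H →ₗ[ℂ] H →ₗ⋆[ℂ] (H →L[ℂ] H) := LinearMap.mk₂'ₛₗ (RingHom.id ℂ) (starRingEnd ℂ)
    (fun x y => F (star (Z x) * gaussianDensity Z 0 * Z y) - ⟪y, x⟫_ℂ • A)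
    (by
      intros
      simp only [map_add, star_add, add_mul, inner_add_right, add_smul]; abel)
    (by
      intros
      simp only [← starField_apply, map_smul, smul_mul_assoc, inner_smul_right, RingHom.id_apply,
        smul_sub, smul_smul])
    (by
      intros
      simp only [map_add, mul_add, inner_add_left, add_smul]; abel)
    (by
      intros
      simp only [LinearMap.map_smulₛₗ, mul_smul_comm, inner_smul_left, RingHom.id_apply,
        smul_sub, smul_smul])
  have hk : ∀ x y, k x y = F (star (Z x) * gaussianDensity Z 0 * Z y) - ⟪y, x⟫_ℂ • A :=
    fun _ _ => rfl
  have hunit : ∀ x, ‖x‖ = 1 → k x x = F (gaussianDensity Z (proj x)) - A := by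
    intro x hx
    rw [hk, gaussianDensity_proj hZ hirr hx, inner_self_of_norm hx, one_smul]
  -- every vector is a multiple of a unit vector
  have hscale : ∀ x, x ≠ 0 → ∃ (c : ℝ) (u : H), ‖u‖ = 1 ∧ c ≠ 0 ∧ x = (c : ℂ) • u ∧
      k x x = ((c : ℂ) * c) • (F (gaussianDensity Z (proj u)) - A) := by
    intro x hx
    have hn : ‖x‖ ≠ 0 := norm_ne_zero_iff.2 hx
    have hn' : (‖x‖ : ℂ) ≠ 0 := by exact_mod_cast hn
    have hu : ‖((‖x‖ : ℂ)⁻¹) • x‖ = 1 := by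
      rw [norm_smul, norm_inv, Complex.norm_real, norm_norm, inv_mul_cancel₀ hn]
    have hxu : x = (‖x‖ : ℂ) • (((‖x‖ : ℂ)⁻¹) • x) := by rw [smul_inv_smul₀ hn']
    refine ⟨‖x‖, _, hu, hn, hxu, ?_⟩
    rw [← hunit _ hu]
    conv_lhs => rw [hxu]
    rw [LinearMap.map_smulₛₗ (k _), map_smul k, LinearMap.smul_apply, Complex.conj_ofReal,
      smul_smul]
  have hdiag : ∀ x, star (k x x) = k x x := by
    intro x
    rcases eq_or_ne x 0 with rfl | hx
    · simp
    obtain ⟨c, u, hu, -, -, e⟩ := hscale x hx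
    rw [e, star_smul, star_sub, hself _ (proj_nonneg u) (proj_le_one hu), hA,
      hself 0 le_rfl zero_le_one]
    simp
  have hstar : ∀ x y, star (k x y) = k y x := by
    intro x y
    let g : H →ₗ[ℂ] H →ₗ⋆[ℂ] (H →L[ℂ] H) := LinearMap.mk₂'ₛₗ (RingHom.id ℂ) (starRingEnd ℂ)
      (fun x y => k x y - star (k y x))
      (by intros; simp only [map_add, LinearMap.add_apply, star_add]; abel)
      (by
        intros
        simp only [map_smul, LinearMap.smul_apply, LinearMap.map_smulₛₗ, star_smul,
          RCLike.star_def, Complex.conj_conj, RingHom.id_apply, smul_sub])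
      (by intros; simp only [map_add, LinearMap.add_apply, star_add]; abel)
      (by
        intros
        simp only [map_smul, LinearMap.smul_apply, LinearMap.map_smulₛₗ, star_smul,
          RCLike.star_def, smul_sub])
    have hg : ∀ x y, g x y = k x y - star (k y x) := fun _ _ => rfl
    have := mem_of_forall_diag_mem g (p := ⊥)
      (fun x => by rw [hg, hdiag, sub_self]; exact zero_mem _) y x
    rw [Submodule.mem_bot, hg, sub_eq_zero] at this
    exact this.symm
  have hkcorner : ∀ u p q : H, ⟪p, u⟫_ℂ = 0 → ⟪u, q⟫_ℂ = 0 → ⟪p, k u u q⟫_ℂ = 0 := by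
    intro u p q hp hq
    rcases eq_or_ne u 0 with rfl | hu0
    · simp
    obtain ⟨c, u', hu', hc, rfl, e⟩ := hscale u hu0
    have hc' : (c : ℂ) ≠ 0 := by exact_mod_cast hc
    rw [inner_smul_right] at hp
    rw [inner_smul_left, Complex.conj_ofReal] at hq
    have := hcorner 0 u' p q hu' le_rfl (by rw [zero_add]; exact proj_le_one hu') rfl
      ((mul_eq_zero.1 hp).resolve_left hc') ((mul_eq_zero.1 hq).resolve_left hc')
    rw [zero_add] at this
    rw [e, smul_apply, inner_smul_right, this, mul_zero]
  obtain ⟨G, hG⟩ := exists_rankOne_of_corner hstar hkcorner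
  refine ⟨G, fun Q h0 h1 => ?_⟩
  obtain ⟨b, r, hr0, hr1, rfl⟩ := exists_eq_sum_rankOne h0 h1
  rw [drift_diagonal hZ hirr hcorner b hr0 hr1, add_assoc, Finset.mul_sum, Finset.sum_mul,
    ← Finset.sum_add_distrib]
  congr 1
  refine Finset.sum_congr rfl fun i _ => ?_
  rw [← hA, ← hunit _ (b.orthonormal.1 i), hG]
  ext y
  simp only [smul_apply, add_apply, mul_apply_eq_comp, InnerProductSpace.rankOne_apply, map_smul,
    inner_star_right, smul_add]

end Drift

end Lines

/-! ### The symbol of an evolved Gaussian state -/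

theorem nonneg_of_hasDerivWithinAt {f : ℝ → ℂ} {f' : ℂ}
    (hf : HasDerivWithinAt f f' (Set.Ici 0) 0) (h0 : f 0 = 0) (hpos : ∀ t, 0 ≤ t → 0 ≤ f t) :
    0 ≤ f' := by
  have h1 := (hasDerivWithinAt_iff_tendsto_slope' Set.self_notMem_Ioi).1
    (hf.mono Set.Ioi_subset_Ici_self)
  refine ge_of_tendsto h1 ?_
  filter_upwards [self_mem_nhdsWithin] with t ht
  have ht : 0 < t := ht
  rw [slope_def_module, h0, sub_zero, sub_zero]
  exact smul_nonneg (inv_nonneg.2 ht.le) (hpos t ht.le)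

/-- The derivative of a determinant depends only on the value and the derivative of the matrix. -/
theorem exists_hasDerivWithinAt_det {n : ℕ} (M₀ M' : Matrix (Fin n) (Fin n) ℂ) :
    ∃ d : ℂ, ∀ M : ℝ → Matrix (Fin n) (Fin n) ℂ, M 0 = M₀ →
      (∀ i j, HasDerivWithinAt (fun t => M t i j) (M' i j) (Set.Ici 0) 0) →
      HasDerivWithinAt (fun t => (M t).det) d (Set.Ici 0) 0 := by
  refine ⟨∑ σ : Equiv.Perm (Fin n), Equiv.Perm.sign σ •
    ∑ i, (∏ j ∈ Finset.univ.erase i, M₀ (σ j) j) • M' (σ i) i, fun M hM h => ?_⟩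
  simp only [Matrix.det_apply]
  refine HasDerivWithinAt.fun_sum fun σ _ => ?_
  have := HasDerivWithinAt.fun_finsetProd (u := Finset.univ) (f := fun i t => M t (σ i) i)
    (f' := fun i => M' (σ i) i) (fun i _ => h (σ i) i)
  simp only [hM] at this
  exact this.const_smul _

theorem isGeneratingPair_of_le {H : Type*} [NormedAddCommGroup H] [InnerProductSpace ℂ H]
    [FiniteDimensional ℂ H] [CompleteSpace H] {G A : H →L[ℂ] H} (h0 : 0 ≤ A)
    (h1 : A ≤ -G - star G) :
    IsGeneratingPair G A :=
  ⟨fun _ ht => norm_expSemigroup_le_one (h0.trans h1) ht, h0, h1⟩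

section Moments

variable {H K : Type*}
  [NormedAddCommGroup H] [InnerProductSpace ℂ H] [FiniteDimensional ℂ H] [CompleteSpace H]
  [NormedAddCommGroup K] [InnerProductSpace ℂ K] [FiniteDimensional ℂ K]
  {Z : H →ₗ⋆[ℂ] Module.End ℂ K}

variable (Z) in
/-- The operator of second moments of `X`: `⟪φ, M ψ⟫ = τ(X Z*(ψ) Z(φ))`. -/
def secondMoments : Module.End ℂ K →ₗ[ℂ] (H →L[ℂ] H) where
  toFun X := LinearMap.toContinuousLinearMap (∑ j, (tau ∘ₗ LinearMap.mulLeft ℂ X ∘ₗ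
    LinearMap.mulRight ℂ (Z (stdOrthonormalBasis ℂ H j)) ∘ₗ starField Z).smulRight
      (stdOrthonormalBasis ℂ H j))
  map_add' X Y := by
    ext ψ
    simp [add_mul, add_smul, Finset.sum_add_distrib]
  map_smul' c X := by
    ext ψ
    simp [mul_smul, Finset.smul_sum]

omit [CompleteSpace H] in
theorem secondMoments_apply (X : Module.End ℂ K) (ψ : H) : secondMoments Z X ψ =
    ∑ j, tau (X * (star (Z ψ) * Z (stdOrthonormalBasis ℂ H j))) • stdOrthonormalBasis ℂ H j := by
  change (∑ j, (tau ∘ₗ LinearMap.mulLeft ℂ X ∘ₗ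
    LinearMap.mulRight ℂ (Z (stdOrthonormalBasis ℂ H j)) ∘ₗ starField Z).smulRight
      (stdOrthonormalBasis ℂ H j)) ψ = _
  simp [starField_apply]

omit [CompleteSpace H] in
theorem inner_secondMoments (X : Module.End ℂ K) (φ ψ : H) :
    ⟪φ, secondMoments Z X ψ⟫_ℂ = tau (X * (star (Z ψ) * Z φ)) := by
  rw [secondMoments_apply, inner_sum]
  conv_rhs => rw [← (stdOrthonormalBasis ℂ H).sum_repr' φ]
  simp only [map_sum, LinearMap.map_smulₛₗ, Finset.mul_sum, mul_smul_comm, map_smul,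
    inner_smul_right, inner_conj_symm, smul_eq_mul, mul_comm]

variable (hZ : IsCARField Z) (hirr : IsIrreducibleField Z)
include hZ hirr

theorem secondMoments_gaussianDensity {Q : H →L[ℂ] H} (h0 : 0 ≤ Q) (h1 : Q ≤ 1) :
    secondMoments Z (gaussianDensity Z Q) = Q := by
  ext ψ
  refine ext_inner_left ℂ fun φ => ?_
  rw [inner_secondMoments, (gaussianDensity_isGaussianWithSymbol hZ hirr h0 h1).symbol]

theorem gaussianDensity_moment_two {Q : H →L[ℂ] H} (h0 : 0 ≤ Q) (h1 : Q ≤ 1) (a b c d : H) :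
    tau (gaussianDensity Z Q * (creation Z ![c, d] * star (creation Z ![a, b]))) =
      ⟪a, Q c⟫_ℂ * ⟪b, Q d⟫_ℂ - ⟪a, Q d⟫_ℂ * ⟪b, Q c⟫_ℂ := by
  rw [gaussianDensity_moment hZ hirr h0 h1, Matrix.det_fin_two]
  rfl

variable {P : ℝ≥0 → arakiWyss Z →ₗ[ℂ] arakiWyss Z}

/-- A Gaussian density matrix as an element of the Araki–Wyss algebra. -/
def gaussianElement {Q : H →L[ℂ] H} (h0 : 0 ≤ Q) (h1 : Q ≤ 1) : arakiWyss Z :=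
  ⟨gaussianDensity Z Q, gaussianDensity_mem_arakiWyss hZ hirr h0 h1⟩

theorem IsGIGSemigroup.evolve (hP : IsGIGSemigroup Z P) (t : ℝ≥0) {Q : H →L[ℂ] H} (h0 : 0 ≤ Q)
    (h1 : Q ≤ 1) : 0 ≤ secondMoments Z (P t (gaussianElement hZ hirr h0 h1)) ∧
      secondMoments Z (P t (gaussianElement hZ hirr h0 h1)) ≤ 1 ∧
      (P t (gaussianElement hZ hirr h0 h1) : Module.End ℂ K) =
        gaussianDensity Z (secondMoments Z (P t (gaussianElement hZ hirr h0 h1))) := by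
  obtain ⟨Q', h0', h1', h⟩ := (isGIGState_iff hZ hirr).1
    (hP.map_gig t (gaussianElement hZ hirr h0 h1)
      ⟨Q, gaussianDensity_isGaussianWithSymbol hZ hirr h0 h1⟩)
  have h : (P t (gaussianElement hZ hirr h0 h1) : Module.End ℂ K) = gaussianDensity Z Q' := h
  rw [h, secondMoments_gaussianDensity hZ hirr h0' h1']
  exact ⟨h0', h1', rfl⟩

theorem IsGIGSemigroup.evolve_zero (hP : IsGIGSemigroup Z P) {Q : H →L[ℂ] H} (h0 : 0 ≤ Q)
    (h1 : Q ≤ 1) : secondMoments Z (P (0 : ℝ).toNNReal (gaussianElement hZ hirr h0 h1)) = Q := by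
  rw [Real.toNNReal_zero, hP.zero]
  exact secondMoments_gaussianDensity hZ hirr h0 h1

omit hZ hirr [CompleteSpace H] in
theorem IsGenerator.hasDerivWithinAt_tau {L : arakiWyss Z →ₗ[ℂ] arakiWyss Z} (hL : IsGenerator P L)
    (X : arakiWyss Z) (Y : Module.End ℂ K) :
    HasDerivWithinAt (fun t : ℝ => tau ((P t.toNNReal X : Module.End ℂ K) * Y))
      (tau ((L X : Module.End ℂ K) * Y)) (Set.Ici 0) 0 :=
  hL (tau ∘ₗ LinearMap.mulRight ℂ Y ∘ₗ arakiWyssIncl Z) X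

omit hZ hirr [CompleteSpace H] in
theorem IsGenerator.hasDerivWithinAt_inner {L : arakiWyss Z →ₗ[ℂ] arakiWyss Z}
    (hL : IsGenerator P L) (X : arakiWyss Z) (φ ψ : H) :
    HasDerivWithinAt (fun t : ℝ => ⟪φ, secondMoments Z (P t.toNNReal X) ψ⟫_ℂ)
      ⟪φ, secondMoments Z (L X) ψ⟫_ℂ (Set.Ici 0) 0 := by
  simp only [inner_secondMoments]
  exact hL.hasDerivWithinAt_tau X _

/-- The generator of a semigroup that preserves the Gaussian states is determined by the drift of
the symbols. -/
theorem IsGIGSemigroup.generator_ext {P' : ℝ≥0 → arakiWyss Z →ₗ[ℂ] arakiWyss Z}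
    (hP : IsGIGSemigroup Z P) (hP' : IsGIGSemigroup Z P') {L L' : arakiWyss Z →ₗ[ℂ] arakiWyss Z}
    (hL : IsGenerator P L) (hL' : IsGenerator P' L')
    (h : ∀ (Q : H →L[ℂ] H) (h0 : 0 ≤ Q) (h1 : Q ≤ 1),
      secondMoments Z (L (gaussianElement hZ hirr h0 h1)) =
        secondMoments Z (L' (gaussianElement hZ hirr h0 h1))) : L = L' := by
  refine eq_of_eq_on_gaussian hZ hirr fun Q h0 h1 => ?_
  refine Subtype.ext (eq_of_moments hZ hirr fun m n v w => ?_)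
  have hd := hL.hasDerivWithinAt_tau (gaussianElement hZ hirr h0 h1)
    (creation Z v * star (creation Z w))
  have hd' := hL'.hasDerivWithinAt_tau (gaussianElement hZ hirr h0 h1)
    (creation Z v * star (creation Z w))
  rcases eq_or_ne m n with rfl | hmn
  · obtain ⟨d, hdet⟩ := exists_hasDerivWithinAt_det (Matrix.of fun j k => ⟪w j, Q (v k)⟫_ℂ)
      (Matrix.of fun j k =>
        ⟪w j, secondMoments Z (L (gaussianElement hZ hirr h0 h1)) (v k)⟫_ℂ)
    have e : ∀ {P : ℝ≥0 → arakiWyss Z →ₗ[ℂ] arakiWyss Z}, IsGIGSemigroup Z P → ∀ t : ℝ,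
        tau ((P t.toNNReal (gaussianElement hZ hirr h0 h1) : Module.End ℂ K) *
          (creation Z v * star (creation Z w))) =
        (Matrix.of fun j k => ⟪w j, secondMoments Z
          (P t.toNNReal (gaussianElement hZ hirr h0 h1)) (v k)⟫_ℂ).det := by
      intro P hP t
      obtain ⟨g0, g1, g⟩ := hP.evolve hZ hirr t.toNNReal h0 h1
      conv_lhs => rw [g]
      exact gaussianDensity_moment hZ hirr g0 g1 v w
    simp only [e hP] at hd
    simp only [e hP'] at hd'
    have d1 := hdet (fun t => Matrix.of fun j k => ⟪w j, secondMoments Z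
      (P t.toNNReal (gaussianElement hZ hirr h0 h1)) (v k)⟫_ℂ)
      (by simp only [hP.evolve_zero hZ hirr h0 h1])
      (fun j k => hL.hasDerivWithinAt_inner (gaussianElement hZ hirr h0 h1) (w j) (v k))
    have d2 := hdet (fun t => Matrix.of fun j k => ⟪w j, secondMoments Z
      (P' t.toNNReal (gaussianElement hZ hirr h0 h1)) (v k)⟫_ℂ)
      (by simp only [hP'.evolve_zero hZ hirr h0 h1]) (fun j k => by
      have := hL'.hasDerivWithinAt_inner (gaussianElement hZ hirr h0 h1) (w j) (v k)
      rw [← h Q h0 h1] at this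
      exact this)
    exact ((uniqueDiffWithinAt_Ici (0 : ℝ)).eq_deriv _ hd d1).trans
      ((uniqueDiffWithinAt_Ici (0 : ℝ)).eq_deriv _ d2 hd')
  · have e : ∀ {P : ℝ≥0 → arakiWyss Z →ₗ[ℂ] arakiWyss Z}, IsGIGSemigroup Z P → ∀ t : ℝ,
        tau ((P t.toNNReal (gaussianElement hZ hirr h0 h1) : Module.End ℂ K) *
          (creation Z v * star (creation Z w))) = 0 := by
      intro P hP t
      obtain ⟨g0, g1, g⟩ := hP.evolve hZ hirr t.toNNReal h0 h1
      rw [g]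
      exact gaussianDensity_moment_of_ne hZ hirr g0 g1 v w hmn
    simp only [e hP] at hd
    simp only [e hP'] at hd'
    exact (uniqueDiffWithinAt_Ici (0 : ℝ)).eq_deriv _ hd hd'

theorem IsGIGSemigroup.star_drift (hP : IsGIGSemigroup Z P) {L : arakiWyss Z →ₗ[ℂ] arakiWyss Z}
    (hL : IsGenerator P L) {Q : H →L[ℂ] H} (h0 : 0 ≤ Q) (h1 : Q ≤ 1) :
    star (secondMoments Z (L (gaussianElement hZ hirr h0 h1))) =
      secondMoments Z (L (gaussianElement hZ hirr h0 h1)) := by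
  ext ψ
  refine ext_inner_left ℂ fun φ => ?_
  have d1 := hL.hasDerivWithinAt_inner (gaussianElement hZ hirr h0 h1) φ ψ
  have d2 := (hL.hasDerivWithinAt_inner (gaussianElement hZ hirr h0 h1) ψ φ).star
  have e : ∀ t : ℝ, star
      ⟪ψ, secondMoments Z (P t.toNNReal (gaussianElement hZ hirr h0 h1)) φ⟫_ℂ =
      ⟪φ, secondMoments Z (P t.toNNReal (gaussianElement hZ hirr h0 h1)) ψ⟫_ℂ := by
    intro t
    rw [← inner_apply_comm_of_nonneg (hP.evolve hZ hirr t.toNNReal h0 h1).1]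
    exact inner_conj_symm _ _
  simp only [e] at d2
  rw [inner_star_right, (uniqueDiffWithinAt_Ici (0 : ℝ)).eq_deriv _ d1 d2]
  exact (inner_conj_symm _ _).symm

/-- Filling a mode changes the drift of the symbol by an operator without corner on the orthogonal
complement of this mode. Along the affine family of Gaussian states that joins the two states, the
`2 × 2` moments are affine, so that the difference of the evolved symbols has vanishing `2 × 2`
minors; the claim is the derivative of this relation. -/
theorem IsGIGSemigroup.corner_drift (hP : IsGIGSemigroup Z P)
    {L : arakiWyss Z →ₗ[ℂ] arakiWyss Z} (hL : IsGenerator P L) {Q : H →L[ℂ] H} {x p q : H}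
    (hx : ‖x‖ = 1) (h0 : 0 ≤ Q) (hQ1 : Q + proj x ≤ 1) (hQx : Q x = 0) (hp : ⟪p, x⟫_ℂ = 0)
    (hq : ⟪x, q⟫_ℂ = 0) (h1 : Q ≤ 1) (h0' : 0 ≤ Q + proj x) :
    ⟪p, (secondMoments Z (L (gaussianElement hZ hirr h0' hQ1)) -
      secondMoments Z (L (gaussianElement hZ hirr h0 h1))) q⟫_ℂ = 0 := by
  have hh : ((1 / 2 : ℝ) : ℂ) = 1 / 2 := by norm_num
  have hm0 : 0 ≤ Q + (1 / 2 : ℂ) • proj x := by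
    rw [← hh]; exact add_nonneg h0 (ofReal_smul_nonneg (proj_nonneg x) (by norm_num))
  have hm1 : Q + (1 / 2 : ℂ) • proj x ≤ 1 := by
    rw [← hh]
    exact (add_le_add le_rfl (ofReal_smul_le_self (proj_nonneg x) (by norm_num))).trans hQ1
  set D₀ := gaussianElement hZ hirr h0 h1 with hD₀
  set D₁ := gaussianElement hZ hirr h0' hQ1 with hD₁
  set D := gaussianElement hZ hirr hm0 hm1 with hD
  have hmid : D = (1 / 2 : ℂ) • D₀ + (1 / 2 : ℂ) • D₁ := by
    refine Subtype.ext ?_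
    have := gaussianDensity_line hZ hirr hx h0 hQ1 hQx (s := 1 / 2) (by norm_num) (by norm_num)
    rw [hh] at this
    refine this.trans ?_
    norm_num
    rfl
  let σ : ℝ → arakiWyss Z → (H →L[ℂ] H) := fun t X => secondMoments Z (P t.toNNReal X)
  have hσ : ∀ t, σ t D = (1 / 2 : ℂ) • σ t D₀ + (1 / 2 : ℂ) • σ t D₁ := by
    intro t
    simp only [σ, hmid, map_add, map_smul]
    exact (map_add (secondMoments Z) _ _).trans
      (congrArg₂ _ (map_smul (secondMoments Z) _ _) (map_smul (secondMoments Z) _ _))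
  have hPmid : ∀ t : ℝ, (P t.toNNReal D : Module.End ℂ K) =
      (1 / 2 : ℂ) • (P t.toNNReal D₀ : Module.End ℂ K) +
        (1 / 2 : ℂ) • (P t.toNNReal D₁ : Module.End ℂ K) := by
    intro t
    rw [hmid, map_add, map_smul, map_smul]
    rfl
  have hdet : ∀ t, (⟪x, σ t D₁ x⟫_ℂ - ⟪x, σ t D₀ x⟫_ℂ) * (⟪p, σ t D₁ q⟫_ℂ - ⟪p, σ t D₀ q⟫_ℂ) -
      (⟪x, σ t D₁ q⟫_ℂ - ⟪x, σ t D₀ q⟫_ℂ) * (⟪p, σ t D₁ x⟫_ℂ - ⟪p, σ t D₀ x⟫_ℂ) = 0 := by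
    intro t
    obtain ⟨a0, a1, a⟩ := hP.evolve hZ hirr t.toNNReal h0 h1
    obtain ⟨b0, b1, b⟩ := hP.evolve hZ hirr t.toNNReal h0' hQ1
    obtain ⟨c0, c1, c⟩ := hP.evolve hZ hirr t.toNNReal hm0 hm1
    have ma := gaussianDensity_moment_two hZ hirr a0 a1 x p x q
    have mb := gaussianDensity_moment_two hZ hirr b0 b1 x p x q
    have mc := gaussianDensity_moment_two hZ hirr c0 c1 x p x q
    rw [← a] at ma
    rw [← b] at mb
    rw [← c] at mc
    change tau ((P t.toNNReal D : Module.End ℂ K) * _) =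
      ⟪x, σ t D x⟫_ℂ * ⟪p, σ t D q⟫_ℂ - ⟪x, σ t D q⟫_ℂ * ⟪p, σ t D x⟫_ℂ at mc
    change tau ((P t.toNNReal D₀ : Module.End ℂ K) * _) =
      ⟪x, σ t D₀ x⟫_ℂ * ⟪p, σ t D₀ q⟫_ℂ - ⟪x, σ t D₀ q⟫_ℂ * ⟪p, σ t D₀ x⟫_ℂ at ma
    change tau ((P t.toNNReal D₁ : Module.End ℂ K) * _) =
      ⟪x, σ t D₁ x⟫_ℂ * ⟪p, σ t D₁ q⟫_ℂ - ⟪x, σ t D₁ q⟫_ℂ * ⟪p, σ t D₁ x⟫_ℂ at mb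
    rw [hPmid, add_mul, smul_mul_assoc, smul_mul_assoc, map_add, map_smul, map_smul, ma, mb,
      hσ] at mc
    simp only [add_apply, smul_apply, inner_add_right, inner_smul_right, smul_eq_mul] at mc
    linear_combination 4 * mc
  have hd := fun φ ψ => (hL.hasDerivWithinAt_inner D₁ φ ψ).sub (hL.hasDerivWithinAt_inner D₀ φ ψ)
  have hderiv := ((hd x x).mul (hd p q)).sub ((hd x q).mul (hd p x))
  have hzero : HasDerivWithinAt (fun _ : ℝ => (0 : ℂ)) 0 (Set.Ici 0) 0 :=
    hasDerivWithinAt_const _ _ _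
  have hval₀ : secondMoments Z (P (0 : ℝ).toNNReal D₀) = Q := hP.evolve_zero hZ hirr h0 h1
  have hval₁ : secondMoments Z (P (0 : ℝ).toNNReal D₁) = Q + proj x :=
    hP.evolve_zero hZ hirr h0' hQ1
  have h3 := (uniqueDiffWithinAt_Ici (0 : ℝ)).eq_deriv _
    (hderiv.congr_of_eventuallyEq (f₁ := fun _ => 0)
      (Filter.Eventually.of_forall fun t => (hdet t).symm)
      (hdet 0).symm) hzero
  simp only [Pi.sub_apply, hval₀, hval₁, add_apply, inner_add_right,
    InnerProductSpace.rankOne_apply,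
    inner_smul_right, inner_self_of_norm hx, hp, hq] at h3
  rw [sub_apply, inner_sub_right]
  linear_combination h3

/-! ### Every semigroup is the flow of a generating pair -/

/-- The symbol `Q` starts to move in the direction `A + G Q + Q G*`. -/
theorem restrictedFlow_drift {G A : H →L[ℂ] H} (hGA : IsGeneratingPair G A)
    {L : arakiWyss Z →ₗ[ℂ] arakiWyss Z} (hL : IsGenerator (restrictedFlow hZ hirr hGA) L)
    {Q : H →L[ℂ] H} (h0 : 0 ≤ Q) (h1 : Q ≤ 1) :
    secondMoments Z (L (gaussianElement hZ hirr h0 h1)) = A + G * Q + Q * star G := by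
  ext ψ
  refine ext_inner_left ℂ fun φ => ?_
  have d1 := hL.hasDerivWithinAt_inner (gaussianElement hZ hirr h0 h1) φ ψ
  let ev : (H →L[ℂ] H) →L[ℂ] ℂ := (innerSL ℂ φ) ∘L (ContinuousLinearMap.apply ℂ H ψ)
  have d2 := ((ev.restrictScalars ℝ).hasFDerivAt.comp_hasDerivAt (0 : ℝ)
    (hasDerivAt_flowSymbol G A Q)).hasDerivWithinAt (s := Set.Ici 0)
  refine (uniqueDiffWithinAt_Ici (0 : ℝ)).eq_deriv _ d1 (d2.congr ?_ ?_) <;>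
  · have e : ∀ t : ℝ, 0 ≤ t → ⟪φ, secondMoments Z
        (restrictedFlow hZ hirr hGA t.toNNReal (gaussianElement hZ hirr h0 h1)) ψ⟫_ℂ =
        ⟪φ, flowSymbol G A t Q ψ⟫_ℂ := by
      intro t ht
      rw [gaussianElement, restrictedFlow_gaussian hZ hirr hGA t.toNNReal h0 h1,
        secondMoments_gaussianDensity hZ hirr (flowSymbol_nonneg hZ hirr hGA _ h0 h1)
          (flowSymbol_le_one hZ hirr hGA _ h0 h1), Real.coe_toNNReal t ht]
    first
    | exact fun t ht => e t ht
    | exact e 0 le_rfl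

/-- The flows of two generating pairs agree if and only if their drifts do. -/
theorem restrictedFlow_eq_iff {G A G' A' : H →L[ℂ] H} (hGA : IsGeneratingPair G A)
    (hGA' : IsGeneratingPair G' A') :
    restrictedFlow hZ hirr hGA = restrictedFlow hZ hirr hGA' ↔
      ∀ Q : H →L[ℂ] H, 0 ≤ Q → Q ≤ 1 →
        A + G * Q + Q * star G = A' + G' * Q + Q * star G' := by
  have hP := isGIGSemigroup_restrictedFlow hZ hirr hGA
  have hP' := isGIGSemigroup_restrictedFlow hZ hirr hGA'
  obtain ⟨L, hL⟩ := hP.exists_isGenerator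
  obtain ⟨L', hL'⟩ := hP'.exists_isGenerator
  constructor
  · intro h Q h0 h1
    rw [← restrictedFlow_drift hZ hirr hGA hL h0 h1]
    rw [h] at hL
    exact restrictedFlow_drift hZ hirr hGA' hL h0 h1
  · intro h
    have hLL : L = L' := hP.generator_ext hZ hirr hP' hL hL' fun Q h0 h1 => by
      rw [restrictedFlow_drift hZ hirr hGA hL h0 h1, restrictedFlow_drift hZ hirr hGA' hL' h0 h1,
        h Q h0 h1]
    rw [← hLL] at hL'
    exact hP.eq_of_isGenerator hP' hL hL'

/-- The drift of the symbol has the form `A + G Q + Q G*`, so that the semigroup has the same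
generator as the flow of `(G, A)`. -/
theorem IsGIGSemigroup.exists_generatingPair (hP : IsGIGSemigroup Z P) :
    ∃ (G A : H →L[ℂ] H) (hGA : IsGeneratingPair G A), P = restrictedFlow hZ hirr hGA := by
  obtain ⟨L, hL⟩ := hP.exists_isGenerator
  obtain ⟨F, hF⟩ := LinearMap.exists_extend (p := Subalgebra.toSubmodule (arakiWyss Z))
    (secondMoments Z ∘ₗ arakiWyssIncl Z ∘ₗ L)
  have hFg : ∀ (Q : H →L[ℂ] H) (h0 : 0 ≤ Q) (h1 : Q ≤ 1), F (gaussianDensity Z Q) =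
      secondMoments Z (L (gaussianElement hZ hirr h0 h1)) := fun Q h0 h1 =>
    LinearMap.congr_fun hF (gaussianElement hZ hirr h0 h1)
  obtain ⟨G, hG⟩ := exists_drift hZ hirr (F := F)
    (fun Q x p q hx h0 hQ1 hQx hp hq => by
      have h1 : Q ≤ 1 := le_trans (le_add_of_nonneg_right (proj_nonneg x)) hQ1
      have h0' := add_nonneg h0 (proj_nonneg x)
      rw [hFg _ h0' hQ1, hFg _ h0 h1]
      exact hP.corner_drift hZ hirr hL hx h0 hQ1 hQx hp hq h1 h0')
    (fun Q h0 h1 => by rw [hFg Q h0 h1]; exact hP.star_drift hZ hirr hL h0 h1)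
  set A := F (gaussianDensity Z 0) with hA
  have hdrift : ∀ (Q : H →L[ℂ] H) (h0 : 0 ≤ Q) (h1 : Q ≤ 1),
      secondMoments Z (L (gaussianElement hZ hirr h0 h1)) = A + G * Q + Q * star G :=
    fun Q h0 h1 => (hFg Q h0 h1).symm.trans (hG Q h0 h1)
  -- the symbol cannot leave `0 ≤ Q` at `Q = 0`, nor `Q ≤ 1` at `Q = 1`
  have hA0 : 0 ≤ A := by
    refine nonneg_of_forall_inner fun x => ?_
    have hd := hL.hasDerivWithinAt_inner (gaussianElement hZ hirr le_rfl zero_le_one) x x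
    rw [hdrift 0, mul_zero, zero_mul, add_zero, add_zero] at hd
    refine nonneg_of_hasDerivWithinAt hd ?_ fun t _ => ?_
    · rw [hP.evolve_zero hZ hirr, zero_apply, inner_zero_right]
    · exact ((ContinuousLinearMap.nonneg_iff_isPositive _).1
        (hP.evolve hZ hirr t.toNNReal le_rfl zero_le_one).1).inner_nonneg_right x
  have hA1 : A ≤ -G - star G := by
    rw [ContinuousLinearMap.le_def, ← ContinuousLinearMap.nonneg_iff_isPositive]
    refine nonneg_of_forall_inner fun x => ?_
    have hd := (hL.hasDerivWithinAt_inner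
      (gaussianElement hZ hirr zero_le_one le_rfl) x x).const_sub ⟪x, x⟫_ℂ
    rw [hdrift 1, mul_one, one_mul] at hd
    have e : -⟪x, (A + G + star G) x⟫_ℂ = ⟪x, (-G - star G - A) x⟫_ℂ := by
      rw [← inner_neg_right, ← neg_apply]
      congr 2
      abel
    rw [e] at hd
    refine nonneg_of_hasDerivWithinAt hd ?_ fun t _ => ?_
    · rw [hP.evolve_zero hZ hirr, one_apply_eq_self, sub_self]
    · have := (hP.evolve hZ hirr t.toNNReal zero_le_one (le_refl (1 : H →L[ℂ] H))).2.1
      rw [ContinuousLinearMap.le_def] at this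
      have h2 := this.inner_nonneg_right x
      rwa [sub_apply, inner_sub_right, one_apply_eq_self] at h2
  have hGA := isGeneratingPair_of_le hA0 hA1
  refine ⟨G, A, hGA, ?_⟩
  have hP' := isGIGSemigroup_restrictedFlow hZ hirr hGA
  obtain ⟨L', hL'⟩ := hP'.exists_isGenerator
  have hLL : L = L' := hP.generator_ext hZ hirr hP' hL hL' fun Q h0 h1 => by
    rw [hdrift Q h0 h1, restrictedFlow_drift hZ hirr hGA hL' h0 h1]
  rw [← hLL] at hL'
  exact hP.eq_of_isGenerator hP' hL hL'

end Moments

/-! ### Generating pairs with the same flow -/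

section Uniqueness

variable {H : Type*} [NormedAddCommGroup H] [InnerProductSpace ℂ H] [FiniteDimensional ℂ H]
  [CompleteSpace H]

omit [FiniteDimensional ℂ H] in
/-- The drift at `Q = 0` gives `A`. Then `D = G' - G` satisfies `D Q + Q D* = 0` on the projections
`Q = |u⟩⟨u|`, so that every vector is an eigenvector of `D`, with an imaginary eigenvalue. -/
theorem drift_eq_iff {G A G' A' : H →L[ℂ] H} :
    (∀ Q : H →L[ℂ] H, 0 ≤ Q → Q ≤ 1 → A + G * Q + Q * star G = A' + G' * Q + Q * star G') ↔
      A = A' ∧ ∃ c : ℝ, G' = G + ((c : ℂ) * Complex.I) • (1 : H →L[ℂ] H) := by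
  constructor
  · intro h
    have hA : A = A' := by simpa using h 0 le_rfl zero_le_one
    refine ⟨hA, ?_⟩
    rcases subsingleton_or_nontrivial H with hH | hH
    · exact ⟨0, by ext x; exact Subsingleton.elim _ _⟩
    obtain ⟨e, he⟩ := exists_norm_eq H (zero_le_one (α := ℝ))
    set D := G' - G with hD
    have hDQ : ∀ Q : H →L[ℂ] H, 0 ≤ Q → Q ≤ 1 → D * Q + Q * star D = 0 := by
      intro Q h0 h1
      have h2 := h Q h0 h1
      rw [hA, add_assoc, add_assoc, add_right_inj] at h2
      rw [hD, star_sub, sub_mul, mul_sub, ← sub_eq_zero.2 h2.symm]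
      abel
    have horth : ∀ x w, ⟪w, x⟫_ℂ = 0 → ⟪w, D x⟫_ℂ = 0 := by
      intro x w hw
      rcases eq_or_ne x 0 with rfl | hx
      · simp
      have hn : (‖x‖ : ℂ) ≠ 0 := by exact_mod_cast norm_ne_zero_iff.2 hx
      set u := ((‖x‖ : ℂ)⁻¹) • x with hu
      have hu1 : ‖u‖ = 1 := by
        rw [hu, norm_smul, norm_inv, Complex.norm_real, norm_norm,
          inv_mul_cancel₀ (norm_ne_zero_iff.2 hx)]
      have hxu : x = (‖x‖ : ℂ) • u := by rw [hu, smul_inv_smul₀ hn]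
      have hwu : ⟪w, u⟫_ℂ = 0 := by rw [hu, inner_smul_right, hw, mul_zero]
      have h2 := congrArg (fun T : H →L[ℂ] H => ⟪w, T u⟫_ℂ)
        (hDQ (proj u) (proj_nonneg u) (proj_le_one hu1))
      simp only [add_apply, mul_apply_eq_comp, InnerProductSpace.rankOne_apply, map_smul,
        inner_add_right, inner_smul_right, inner_self_of_norm hu1, hwu, mul_zero, add_zero, one_mul,
        zero_apply, inner_zero_right] at h2
      rw [hxu, map_smul, inner_smul_right, h2, mul_zero]
    let f : H →ₗ[ℂ] H →ₗ⋆[ℂ] ℂ := LinearMap.mk₂'ₛₗ (RingHom.id ℂ) (starRingEnd ℂ)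
      (fun x w => ⟪w, D x⟫_ℂ) (by intros; simp) (by intros; simp) (by intros; simp)
      (by intros; simp [mul_comm])
    have hf := eq_inner_mul_of_orthogonal f horth he
    have hfD : ∀ x w, f x w = ⟪w, D x⟫_ℂ := fun _ _ => rfl
    have hDc : D = ⟪e, D e⟫_ℂ • (1 : H →L[ℂ] H) := by
      ext x
      refine ext_inner_left ℂ fun w => ?_
      rw [← hfD, hf, hfD, smul_apply, one_apply_eq_self, inner_smul_right, mul_comm]
    have hskew := congrArg (fun T : H →L[ℂ] H => ⟪e, T e⟫_ℂ) (hDQ 1 zero_le_one le_rfl)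
    simp only [mul_one, one_mul, add_apply, inner_add_right, inner_star_right, zero_apply,
      inner_zero_right] at hskew
    rw [← inner_conj_symm (D e) e] at hskew
    set z : ℂ := ⟪e, D e⟫_ℂ
    have hre : z.re = 0 := by
      have := congrArg Complex.re hskew
      simp only [Complex.add_re, Complex.conj_re, Complex.zero_re] at this
      linarith
    refine ⟨z.im, ?_⟩
    have hc : (z.im : ℂ) * Complex.I = z := by
      refine Complex.ext ?_ ?_ <;> simp [hre]
    rw [hc, ← hDc, hD, add_sub_cancel]
  · rintro ⟨rfl, c, rfl⟩ Q - -
    rw [star_add, star_smul, star_one, RCLike.star_def, map_mul, Complex.conj_I,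
      Complex.conj_ofReal, add_mul, mul_add, smul_mul_assoc, mul_smul_comm, one_mul, mul_one]
    module

omit [FiniteDimensional ℂ H] in
theorem neg_sub_star_add_smul (G : H →L[ℂ] H) (c : ℝ) :
    -(G + ((c : ℂ) * Complex.I) • (1 : H →L[ℂ] H)) -
      star (G + ((c : ℂ) * Complex.I) • (1 : H →L[ℂ] H)) = -G - star G := by
  rw [star_add, star_smul, star_one, RCLike.star_def, map_mul, Complex.conj_I,
    Complex.conj_ofReal]
  module

omit [CompleteSpace H] in
theorem im_trace_add_smul (G : H →L[ℂ] H) (c : ℝ) :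
    (LinearMap.trace ℂ H ((G + ((c : ℂ) * Complex.I) • (1 : H →L[ℂ] H) : H →L[ℂ] H) :
      H →ₗ[ℂ] H)).im =
    (LinearMap.trace ℂ H (G : H →ₗ[ℂ] H)).im + c * Module.finrank ℂ H := by
  have : ((G + ((c : ℂ) * Complex.I) • (1 : H →L[ℂ] H) : H →L[ℂ] H) : H →ₗ[ℂ] H) =
      (G : H →ₗ[ℂ] H) + ((c : ℂ) * Complex.I) • (1 : H →ₗ[ℂ] H) := rfl
  rw [this, map_add, map_smul, LinearMap.trace_one, Complex.add_im, smul_eq_mul]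
  simp

end Uniqueness

end GIG

end

theorem theorem4p3
    {H K : Type*}
    [NormedAddCommGroup H] [InnerProductSpace ℂ H] [FiniteDimensional ℂ H] [CompleteSpace H]
    [NormedAddCommGroup K] [InnerProductSpace ℂ K] [FiniteDimensional ℂ K]
    (Z : H →ₗ⋆[ℂ] Module.End ℂ K)
    (hZ : GIG.IsCARField Z) (hirr : GIG.IsIrreducibleField Z) :
    -- every semigroup comes from a pair
    (∀ P : ℝ≥0 → (GIG.arakiWyss Z →ₗ[ℂ] GIG.arakiWyss Z), GIG.IsGIGSemigroup Z P →
      ∃ G A : H →L[ℂ] H, GIG.IsGeneratingPair G A ∧ GIG.IsRestrictedFlow Z G A P) ∧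
    -- every pair gives a semigroup
    (∀ G A : H →L[ℂ] H, GIG.IsGeneratingPair G A →
      (∀ t : ℝ≥0,
        GIG.IsCompatiblePair (GIG.expSemigroup G t) (GIG.Rint G A t) ∧
        GIG.IsGIGQuantumOperation Z (GIG.ehkFlow Z G A t)) ∧
      ∃ P : ℝ≥0 → (GIG.arakiWyss Z →ₗ[ℂ] GIG.arakiWyss Z),
        GIG.IsRestrictedFlow Z G A P ∧ GIG.IsGIGSemigroup Z P) ∧
    -- two pairs give the same semigroup exactly when they differ by an imaginary multiple of `1`
    -- in the first component
    (∀ G A G' A' : H →L[ℂ] H, GIG.IsGeneratingPair G A → GIG.IsGeneratingPair G' A' →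
      ((∀ (t : ℝ≥0), ∀ X ∈ GIG.arakiWyss Z,
          GIG.ehkFlow Z G A t X = GIG.ehkFlow Z G' A' t X) ↔
        A = A' ∧ ∃ c : ℝ, G' = G + ((c : ℂ) * Complex.I) • (1 : H →L[ℂ] H))) ∧
    -- hence the one-to-one correspondence, the free constant being fixed by `Im Tr G = 0`
    (∃ e : {p : (H →L[ℂ] H) × (H →L[ℂ] H) //
          GIG.IsGeneratingPair p.1 p.2 ∧
            (LinearMap.trace ℂ H (p.1 : H →ₗ[ℂ] H)).im = 0} ≃
        {P : ℝ≥0 → (GIG.arakiWyss Z →ₗ[ℂ] GIG.arakiWyss Z) // GIG.IsGIGSemigroup Z P},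
      ∀ p, GIG.IsRestrictedFlow Z p.1.1 p.1.2 (e p).1) := by
  have hflow : ∀ {G A G' A' : H →L[ℂ] H} (h : GIG.IsGeneratingPair G A)
      (h' : GIG.IsGeneratingPair G' A'),
      GIG.restrictedFlow hZ hirr h = GIG.restrictedFlow hZ hirr h' ↔
        A = A' ∧ ∃ c : ℝ, G' = G + ((c : ℂ) * Complex.I) • (1 : H →L[ℂ] H) := fun h h' =>
    (GIG.restrictedFlow_eq_iff hZ hirr h h').trans GIG.drift_eq_iff
  refine ⟨fun P hP => ?_, fun G A hGA => ⟨fun t => ?_, ?_⟩, fun G A G' A' h h' => ?_, ?_⟩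
  · obtain ⟨G, A, hGA, rfl⟩ := hP.exists_generatingPair hZ hirr
    exact ⟨G, A, hGA, GIG.isRestrictedFlow_restrictedFlow hZ hirr hGA⟩
  · have := GIG.isCompatiblePair_expSemigroup hGA t.2
    exact ⟨this, GIG.ehk_isGIGQuantumOperation hZ hirr this⟩
  · exact ⟨_, GIG.isRestrictedFlow_restrictedFlow hZ hirr hGA,
      GIG.isGIGSemigroup_restrictedFlow hZ hirr hGA⟩
  · rw [← hflow h h']
    constructor
    · intro heq
      funext t
      ext X : 1
      exact Subtype.ext (heq t X X.2)
    · intro heq t X hX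
      exact congrArg Subtype.val (LinearMap.congr_fun (congrFun heq t) ⟨X, hX⟩)
  · refine ⟨Equiv.ofBijective (fun p => ⟨GIG.restrictedFlow hZ hirr p.2.1,
      GIG.isGIGSemigroup_restrictedFlow hZ hirr p.2.1⟩) ⟨?_, ?_⟩,
      fun p => GIG.isRestrictedFlow_restrictedFlow hZ hirr p.2.1⟩
    · rintro ⟨⟨G, A⟩, h, ht⟩ ⟨⟨G', A'⟩, h', ht'⟩ heq
      obtain ⟨rfl, c, rfl⟩ := (hflow h h').1 (congrArg Subtype.val heq)
      simp only [GIG.im_trace_add_smul] at ht'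
      rw [ht, zero_add] at ht'
      refine Subtype.ext (Prod.ext ?_ rfl)
      change G = G + ((c : ℂ) * Complex.I) • (1 : H →L[ℂ] H)
      rcases mul_eq_zero.1 ht' with hc | hd
      · rw [hc, Complex.ofReal_zero, zero_mul, zero_smul, add_zero]
      · have hd : Module.finrank ℂ H = 0 := by exact_mod_cast hd
        have := Module.finrank_zero_iff.1 hd
        ext x
        exact Subsingleton.elim _ _
    · rintro ⟨P, hP⟩
      obtain ⟨G, A, hGA, rfl⟩ := hP.exists_generatingPair hZ hirr
      set c : ℝ := -(LinearMap.trace ℂ H (G : H →ₗ[ℂ] H)).im / Module.finrank ℂ H with hc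
      have hGA' : GIG.IsGeneratingPair (G + ((c : ℂ) * Complex.I) • (1 : H →L[ℂ] H)) A :=
        GIG.isGeneratingPair_of_le hGA.nonneg
          (by rw [GIG.neg_sub_star_add_smul]; exact hGA.le)
      refine ⟨⟨(G + ((c : ℂ) * Complex.I) • (1 : H →L[ℂ] H), A), hGA', ?_⟩,
        Subtype.ext ((hflow hGA hGA').2 ⟨rfl, c, rfl⟩).symm⟩
      rw [GIG.im_trace_add_smul]
      rcases eq_or_ne (Module.finrank ℂ H) 0 with hd | hd
      · have := Module.finrank_zero_iff.1 hd
        have h0 : (G : H →ₗ[ℂ] H) = 0 := by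
          ext x
          exact Subsingleton.elim _ _
        rw [h0, hd, map_zero]
        simp
      · rw [hc, div_mul_cancel₀ _ (by exact_mod_cast hd)]
        ring
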